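/- **Setting.** Let $d\ge 1$, $T>0$, and let $U$ be a compact metric space. $\mathcal P_c(\mathbb R^d)$ is the set of Borel probability measures with compact support, $\mathcal P(K)$ the set of those concentrated on $K$, $W_p$ the Wasserstein distances, $\Gamma_o(\mu,\nu)$ the set of $2$-optimal transport plans, $\mathcal M_1(\mu)=\int|x|\,d\mu(x)$, and $B_R(\mu)=\bigcup_{x\in\operatorname{supp}\mu}B(x,R)$. Fix $v:[0,T]\times\mathcal P_c(\mathbb R^d)\times U\times\mathbb R^d\to\mathbb R^d$, $\varphi:\mathcal P_c(\mathbb R^d)\to\mathbb R$ and $\mu^0\in\mathcal P_c(\mathbb R^d)$. *Wasserstein gradients.* For $\phi:\mathcal P_c(\mathbb R^d)\to\mathbb R$, a map $\xi\in L^2(\mu;\mathbb R^d)$ belongs to $\partial^-\phi(\mu)$ if for every $R>0$ $$\phi(\nu)-\phi(\mu)\ \ge \inf_{\gamma\in\Gamma_o(\mu,\nu)}\int\langle \xi(x),y-x\rangle\,d\gamma(x,y)+o_R(W_2(\mu,\nu))\qquad\text{for }\nu\in\mathcal P(B_R(\mu)),$$ and $\xi\in\partial^+\phi(\mu)$ if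 $-\xi\in\partial^-(-\phi)(\mu)$. The functional $\phi$ is locally differentiable at $\mu$ if there is an element $\nabla\phi(\mu)$ of $\partial^-\phi(\mu)\cap\partial^+\phi(\mu)$ that lies in the tangent space $\mathrm{Tan}_\mu=\overline{\{\nabla\zeta:\zeta\in C_c^\infty(\mathbb R^d)\}}^{L^2(\mu)}$ (it is then unique in $\mathrm{Tan}_\mu$). For vector-valued $\phi$, $\mathrm D\phi(\mu)(y)$ is the matrix whose rows are the gradients $\nabla\phi_i(\mu)(y)$ of the components. *Standing hypotheses.* 1. For all $(\mu,u,x)$, $t\mapsto v(t,\mu,u,x)$ is Lebesgue measurable; there is $m\in L^1([0,T],\mathbb R_+)$ with $|v(t,\mu,u,x)|\le m(t)(1+|x|+\mathcal M_1(\mu))$ for a.e. $t$ and all $(\mu,u,x)$. 2. For each $R>0$ and $K=B(0,R)$ there are $l_K,L_K\in L^1([0,T],\mathbb R_+)$ such that for a.e. $t$, all $u\in U$, $\mu,\nu\in\mathcal P(K)$ and $x,y\in K$: $|v(t,\mu,u,x)-v(t,\mu,u,y)|\le l_K(t)|x-y|$ and $|v(t,\mu,u,x)-v(t,\nu,u,x)|\le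 L_K(t)W_1(\mu,\nu)$. 3. For a.e. $t$ and all $u$: $x\mapsto v(t,\mu,u,x)$ is differentiable for every $\mu$; $\mu\mapsto v(t,\mu,u,x)$ is locally differentiable for every $x$; and, for every $K=B(0,R)$, the maps $(\mu,x)\mapsto \mathrm D_xv(t,\mu,u,x)$ and (for a suitable representative) $(\mu,x,y)\mapsto \mathrm D_\mu v(t,\mu,u,x)(y)$ are continuous on $\mathcal P(K)\times K$ and $\mathcal P(K)\times K\times K$, where $\mathcal P(K)$ carries $W_1$. 4. For a.e. $t$ and all $(\mu,x)$, $u\mapsto v(t,\mu,u,x)$ is continuous. 5. $\varphi$ is $W_1$-Lipschitz on $\mathcal P(K)$ for every $K=B(0,R)$, and locally differentiable at every $\mu\in\mathcal P_c(\mathbb R^d)$ with a gradient $\nabla\varphi(\mu)$ that has a continuous representative. *Control problem.* Controls are Lebesgue measurable maps $u:[0,T]\to U$. For $\tau\in[0,T]$, a trajectory driven by $u$ from $(\tau,\mu_\tau)$ is a $W_1$-continuous curve $\mu:[\tau,T]\to\mathcal P_c(\mathbb R^d)$ with $\mu(\tau)=\mu_\tau$ that solves $\partial_t\mu(t)+\mathrm{div}_x(v(t,\mu(t),u(t))\mu(t))=0$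 in the sense of distributions. A pair $(\mu,u)$ is admissible if $u$ is a control and $\mu$ is a trajectory driven by $u$ from $(0,\mu^0)$; it is optimal if it is admissible and minimises $\varphi(\mu(T))$ among all admissible pairs. The value function is $$\mathcal V(\tau,\mu_\tau)=\inf\{\varphi(\mu(T)) : \mu\text{ is a trajectory from }(\tau,\mu_\tau)\text{ driven by some control}\}.$$ *Maximum principle.* Let $\mathbb H(t,\nu,u)=\int_{\mathbb R^{2d}}\langle r,v(t,\pi^1_\#\nu,u,x)\rangle\,d\nu(x,r)$ for $\nu\in\mathcal P_c(\mathbb R^{2d})$. A curve $\nu^*:[0,T]\to\mathcal P_c(\mathbb R^{2d})$ satisfies the PMP along $(\mu^*,u^*)$ if - for some $R'>0$ and $m'\in L^1([0,T],\mathbb R_+)$, $\operatorname{supp}\nu^*(t)\subset B(0,R')\times B(0,R')$ for all $t\in[0,T]$ and $W_1(\nu^*(\tau),\nu^*(t))\le\int_\tau^t m'(s)\,ds$ for $0\le\tau\le t\le T$; - $\partial_t\nu^*(t)+\mathrm{div}_{(x,r)}\big(\mathbb J\,\nabla_\nu\mathbb H(t,\nu^*(t),u^*(t))\,\nu^*(t)\big)=0$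 in the sense of distributions, where $\mathbb J(a,b)=(b,-a)$ and $$\nabla_\nu\mathbb H(t,\nu^*(t),u^*(t))(x,r)=\Big(\mathrm D_xv(t,\mu^*(t),u^*(t),x)^\top r+\int \mathrm D_\mu v(t,\mu^*(t),u^*(t),y)(x)^\top p\,d\nu^*(t)(y,p),\ \ v(t,\mu^*(t),u^*(t),x)\Big);$$ - $\pi^1_\#\nu^*(t)=\mu^*(t)$ for all $t\in[0,T]$, and $\nu^*(T)=(\mathrm{Id},-\nabla\varphi(\mu^*(T)))_\#\mu^*(T)$; - $\mathbb H(t,\nu^*(t),u^*(t))=\max_{u\in U}\mathbb H(t,\nu^*(t),u)$ for a.e. $t\in[0,T]$. Let $\bar\nu^*(t)(x)=\int r\,d\nu^*_x(t)(r)$ be the barycentric projection of $\nu^*(t)$, where $(\nu_x^*(t))_x$ is the disintegration of $\nu^*(t)$ against its first marginal $\mu^*(t)$. *Dini superdifferential.* A pair $(\delta,\xi)\in\mathbb R\times L^2(\mu;\mathbb R^d)$ belongs to $\eth^+\mathcal V(\tau,\mu)$ if for all $h\in\mathbb R$ and $\mathcal F\in L^\infty(\mu;\mathbb R^d)$ $$\limsup_{\epsilon\to0^+}\frac{\mathcal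 V(\tau+\epsilon h,(\mathrm{Id}+\epsilon\mathcal F)_\#\mu)-\mathcal V(\tau,\mu)}{\epsilon}\ \le\ \int\langle\xi(x),\mathcal F(x)\rangle\,d\mu(x)+\delta h .$$ **Theorem.** Let $(\mu^*,u^*)$ be an admissible pair, and suppose that there exists a state-costate curve $\nu^*$ that satisfies the PMP along $(\mu^*,u^*)$ together with $$\big(\mathbb H(t,\nu^*(t),u^*(t)),\,-\bar\nu^*(t)\big)\in\eth^+\mathcal V(t,\mu^*(t))\qquad\text{for a.e. }t\in[0,T].$$ Then $(\mu^*,u^*)$ is optimal. -/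

import Mathlib

open MeasureTheory Set Filter Topology
open scoped ENNReal ContDiff InnerProductSpace

namespace MeanField

noncomputable section

/-! ### Compactly supported probability measures, transport plans, Wasserstein distances -/

/-- `𝓟_c(X)`: Borel probability measures with compact support. -/
structure Pc (X : Type*) [TopologicalSpace X] [MeasurableSpace X] where
  toMeasure : Measure X
  isProb : IsProbabilityMeasure toMeasure
  isCompact_support : IsCompact toMeasure.support

instance {X : Type*} [TopologicalSpace X] [MeasurableSpace X] (μ : Pc X) :
    IsProbabilityMeasure μ.toMeasure := μ.isProb

/-- The set `𝓟(K)` of the measures that are concentrated on `K`. -/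
def POn {X : Type*} [TopologicalSpace X] [MeasurableSpace X] (K : Set X) : Set (Pc X) :=
  {μ | μ.toMeasure Kᶜ = 0}

/-- The `R`-fattening `B_R(μ)` of the support of `μ`. -/
def fattening {X : Type*} [PseudoMetricSpace X] [MeasurableSpace X] (R : ℝ) (μ : Pc X) : Set X :=
  ⋃ x ∈ μ.toMeasure.support, Metric.closedBall x R

/-- A continuous image of a compactly supported measure is compactly supported. -/
def Pc.map {X Y : Type*} [TopologicalSpace X] [HereditarilyLindelofSpace X] [MeasurableSpace X]
    [OpensMeasurableSpace X] [TopologicalSpace Y] [T2Space Y] [MeasurableSpace Y] [BorelSpace Y]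
    (μ : Pc X) (f : X → Y) (hf : Continuous f) : Pc Y where
  toMeasure := μ.toMeasure.map f
  isProb := Measure.isProbabilityMeasure_map hf.measurable.aemeasurable
  isCompact_support := by
    have hK : IsCompact (f '' μ.toMeasure.support) := μ.isCompact_support.image hf
    refine hK.of_isClosed_subset Measure.isClosed_support
      (Measure.support_subset_of_isClosed hK.isClosed ?_)
    rw [mem_ae_iff, Measure.map_apply hf.measurable hK.isClosed.measurableSet.compl]
    refine measure_mono_null ?_ (Measure.measure_compl_support (μ := μ.toMeasure))
    intro x hx hx'
    exact hx ⟨x, hx', rfl⟩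

/-- The set `Γ(μ, ν)` of transport plans. -/
def plans {X : Type*} [MeasurableSpace X] (μ ν : Measure X) : Set (Measure (X × X)) :=
  {γ | IsProbabilityMeasure γ ∧ γ.map Prod.fst = μ ∧ γ.map Prod.snd = ν}

/-- The transport cost `∫ |x - y|^p dγ`. -/
def cost {X : Type*} [PseudoEMetricSpace X] [MeasurableSpace X] (p : ℝ)
    (γ : Measure (X × X)) : ℝ≥0∞ :=
  ∫⁻ z, edist z.1 z.2 ^ p ∂γ

/-- The Wasserstein distance `W_p`; it is finite between compactly supported measures. -/
def wass {X : Type*} [PseudoEMetricSpace X] [MeasurableSpace X] (p : ℝ) (μ ν : Pc X) : ℝ :=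
  ((⨅ γ ∈ plans μ.toMeasure ν.toMeasure, cost p γ) ^ (1 / p)).toReal

/-- The set `Γ_o(μ, ν)` of `2`-optimal transport plans. -/
def optPlans {X : Type*} [PseudoEMetricSpace X] [MeasurableSpace X] (μ ν : Pc X) :
    Set (Measure (X × X)) :=
  {γ | γ ∈ plans μ.toMeasure ν.toMeasure ∧
    ∀ γ' ∈ plans μ.toMeasure ν.toMeasure, cost 2 γ ≤ cost 2 γ'}

/-- Continuity of `(μ, y) ↦ f μ y` on `𝓟₁(K) × S`, where `𝓟₁(K)` is `𝓟(K)` with the distance `W₁`. -/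
def JointlyContinuous {X Y Z : Type*} [PseudoEMetricSpace X] [MeasurableSpace X]
    [PseudoMetricSpace Y] [PseudoMetricSpace Z] (K : Set X) (S : Set Y) (f : Pc X → Y → Z) : Prop :=
  ∀ μ ∈ POn K, ∀ y ∈ S, ∀ ε > 0, ∃ δ > 0, ∀ μ' ∈ POn K, ∀ y' ∈ S,
    wass 1 μ μ' < δ → dist y y' < δ → dist (f μ y) (f μ' y') < ε

/-! ### Wasserstein gradients -/

/-- The state space `ℝ^d`. -/
abbrev E (d : ℕ) := EuclideanSpace ℝ (Fin d)

/-- `ξ` belongs to the localised classical Fréchet subdifferential `∂⁻φ(μ)`. -/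
def IsSubgradient {d : ℕ} (φ : Pc (E d) → ℝ) (μ : Pc (E d)) (ξ : E d → E d) : Prop :=
  MemLp ξ 2 μ.toMeasure ∧
    ∀ R > 0, ∀ ε > 0, ∃ δ > 0, ∀ ν ∈ POn (fattening R μ), wass 2 μ ν ≤ δ →
      sInf ((fun γ : Measure (E d × E d) => ∫ z, ⟪ξ z.1, z.2 - z.1⟫_ℝ ∂γ) '' optPlans μ ν)
        - ε * wass 2 μ ν ≤ φ ν - φ μ

/-- `ξ` belongs to the localised classical Fréchet superdifferential `∂⁺φ(μ)`. -/
def IsSupergradient {d : ℕ} (φ : Pc (E d) → ℝ) (μ : Pc (E d)) (ξ : E d → E d) : Prop :=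
  IsSubgradient (fun ρ => -φ ρ) μ (fun x => -ξ x)

/-- `ξ` belongs to the analytical tangent space at `μ`, the `L²(μ)`-closure of the gradients of
smooth compactly supported functions. -/
def IsTangent {d : ℕ} (μ : Pc (E d)) (ξ : E d → E d) : Prop :=
  MemLp ξ 2 μ.toMeasure ∧
    ∀ ε > 0, ∃ ζ : E d → ℝ, ContDiff ℝ ∞ ζ ∧ HasCompactSupport ζ ∧
      eLpNorm (fun x => ξ x - gradient ζ x) 2 μ.toMeasure < ENNReal.ofReal ε

/-- `ξ` is (a representative of) the Wasserstein gradient `∇φ(μ)`: the tangent element lying in both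
the sub- and the superdifferential. It is unique `μ`-almost everywhere. (Outside the tangent space
there is no uniqueness: vector fields orthogonal to it do not change the two inequalities.) -/
def IsWassersteinGradient {d : ℕ} (φ : Pc (E d) → ℝ) (μ : Pc (E d)) (ξ : E d → E d) : Prop :=
  IsTangent μ ξ ∧ IsSubgradient φ μ ξ ∧ IsSupergradient φ μ ξ

/-! ### Continuity equations -/

/-- The `W₁`-continuous curve `μ` of compactly supported measures solves
`∂ₜμ + div(w(t) μ(t)) = 0` on `[a, b]` in the sense of distributions: for each test function `ψ`,
the map `t ↦ ∫ ψ dμ(t)` is absolutely continuous with derivative `∫ ⟨∇ψ, w(t)⟩ dμ(t)` a.e. -/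
def SolvesCE {X : Type*} [NormedAddCommGroup X] [NormedSpace ℝ X] [MeasurableSpace X]
    (a b : ℝ) (w : ℝ → X → X) (μ : ℝ → Pc X) : Prop :=
  (∀ t ∈ Icc a b, Tendsto (fun s => wass 1 (μ s) (μ t)) (𝓝[Icc a b] t) (𝓝 0)) ∧
  (∀ᵐ t ∂volume.restrict (Icc a b), Integrable (w t) (μ t).toMeasure) ∧
  ∀ ψ : X → ℝ, ContDiff ℝ ∞ ψ → HasCompactSupport ψ →
    IntegrableOn (fun t => ∫ x, fderiv ℝ ψ x (w t x) ∂(μ t).toMeasure) (Icc a b) ∧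
    ∀ t ∈ Icc a b, ∫ x, ψ x ∂(μ t).toMeasure =
      ∫ x, ψ x ∂(μ a).toMeasure + ∫ s in a..t, ∫ x, fderiv ℝ ψ x (w s x) ∂(μ s).toMeasure

/-! ### The control problem: dynamics `v(t, μ, u, x)` and final cost `φ` -/

/-- `Dv t μ u x y` is the matrix `D_μ v(t, μ, u, x)(y)`, whose rows are the values at `y` of the
Wasserstein gradients of the components of `ρ ↦ v(t, ρ, u, x)` at `μ`, chosen continuous in
`(μ, x, y)`. -/
def IsMeasureDerivative {d : ℕ} {U : Type*} (T : ℝ) (v : ℝ → Pc (E d) → U → E d → E d)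
    (Dv : ℝ → Pc (E d) → U → E d → E d → (E d →L[ℝ] E d)) : Prop :=
  (∀ᵐ t ∂volume.restrict (Icc 0 T), ∀ u μ x, ∀ i : Fin d,
    IsWassersteinGradient (fun ρ => v t ρ u x i) μ
      (fun y => ContinuousLinearMap.adjoint (Dv t μ u x y) (EuclideanSpace.single i 1))) ∧
  ∀ R > 0, ∀ᵐ t ∂volume.restrict (Icc 0 T), ∀ u,
    JointlyContinuous (Metric.closedBall (0 : E d) R)
      (Metric.closedBall (0 : E d) R ×ˢ Metric.closedBall (0 : E d) R)
      (fun μ z => Dv t μ u z.1 z.2)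

/-- The standing regularity assumptions on the dynamics and on the final cost. -/
structure Hypotheses {d : ℕ} {U : Type*} [TopologicalSpace U] (T : ℝ)
    (v : ℝ → Pc (E d) → U → E d → E d) (φ : Pc (E d) → ℝ) : Prop where
  measurable_time : ∀ μ u x,
    AEStronglyMeasurable (fun t => v t μ u x) (volume.restrict (Icc 0 T))
  sublinear : ∃ m : ℝ → ℝ, (∀ t, 0 ≤ m t) ∧ IntegrableOn m (Icc 0 T) ∧
    ∀ᵐ t ∂volume.restrict (Icc 0 T), ∀ u μ x,
      ‖v t μ u x‖ ≤ m t * (1 + ‖x‖ + ∫ y, ‖y‖ ∂μ.toMeasure)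
  lipschitz : ∀ R > 0, ∃ l L : ℝ → ℝ, (∀ t, 0 ≤ l t) ∧ (∀ t, 0 ≤ L t) ∧
    IntegrableOn l (Icc 0 T) ∧ IntegrableOn L (Icc 0 T) ∧
    ∀ᵐ t ∂volume.restrict (Icc 0 T), ∀ u,
      ∀ μ ∈ POn (Metric.closedBall (0 : E d) R), ∀ ν ∈ POn (Metric.closedBall (0 : E d) R),
      ∀ x ∈ Metric.closedBall (0 : E d) R, ∀ y ∈ Metric.closedBall (0 : E d) R,
        ‖v t μ u x - v t μ u y‖ ≤ l t * ‖x - y‖ ∧ ‖v t μ u x - v t ν u x‖ ≤ L t * wass 1 μ ν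
  differentiable_space : ∀ᵐ t ∂volume.restrict (Icc 0 T), ∀ u μ, Differentiable ℝ (v t μ u)
  continuous_space_derivative : ∀ R > 0, ∀ᵐ t ∂volume.restrict (Icc 0 T), ∀ u,
    JointlyContinuous (Metric.closedBall (0 : E d) R) (Metric.closedBall (0 : E d) R)
      (fun μ x => fderiv ℝ (v t μ u) x)
  differentiable_measure : ∃ Dv, IsMeasureDerivative T v Dv
  continuous_control : ∀ᵐ t ∂volume.restrict (Icc 0 T), ∀ μ x, Continuous (fun u => v t μ u x)
  cost_lipschitz : ∀ R > 0, ∃ L : ℝ,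
    ∀ μ ∈ POn (Metric.closedBall (0 : E d) R), ∀ ν ∈ POn (Metric.closedBall (0 : E d) R),
      |φ μ - φ ν| ≤ L * wass 1 μ ν
  cost_differentiable : ∀ μ, ∃ g, Continuous g ∧ IsWassersteinGradient φ μ g

/-- The set of admissible controls: Lebesgue measurable maps `[0, T] → U`. -/
def controls (U : Type*) [MeasurableSpace U] (T : ℝ) : Set (ℝ → U) :=
  {u | AEMeasurable u (volume.restrict (Icc 0 T))}

/-- `μ` solves the controlled Cauchy problem on `[τ, T]` with `μ(τ) = μτ`, driven by `u`. -/
def IsTrajectory {d : ℕ} {U : Type*} (T : ℝ) (v : ℝ → Pc (E d) → U → E d → E d)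
    (τ : ℝ) (μτ : Pc (E d)) (μ : ℝ → Pc (E d)) (u : ℝ → U) : Prop :=
  SolvesCE τ T (fun t => v t (μ t) (u t)) μ ∧ μ τ = μτ

/-- Admissible trajectory-control pairs for the problem started at `μ₀` at time `0`. -/
def IsAdmissible {d : ℕ} {U : Type*} [MeasurableSpace U] (T : ℝ)
    (v : ℝ → Pc (E d) → U → E d → E d) (μ₀ : Pc (E d)) (μ : ℝ → Pc (E d)) (u : ℝ → U) : Prop :=
  u ∈ controls U T ∧ IsTrajectory T v 0 μ₀ μ u

/-- Admissible pairs that minimise the final cost among all admissible pairs. -/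
def IsOptimal {d : ℕ} {U : Type*} [MeasurableSpace U] (T : ℝ)
    (v : ℝ → Pc (E d) → U → E d → E d) (φ : Pc (E d) → ℝ) (μ₀ : Pc (E d))
    (μ : ℝ → Pc (E d)) (u : ℝ → U) : Prop :=
  IsAdmissible T v μ₀ μ u ∧ ∀ μ' u', IsAdmissible T v μ₀ μ' u' → φ (μ T) ≤ φ (μ' T)

/-- The value function `𝒱(τ, μτ)`. -/
def value {d : ℕ} {U : Type*} [MeasurableSpace U] (T : ℝ)
    (v : ℝ → Pc (E d) → U → E d → E d) (φ : Pc (E d) → ℝ) (τ : ℝ) (μτ : Pc (E d)) : ℝ :=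
  sInf {c | ∃ u ∈ controls U T, ∃ μ, IsTrajectory T v τ μτ μ u ∧ c = φ (μ T)}

/-! ### The Pontryagin maximum principle -/

/-- The first marginal `π¹_# ν` of a measure on the state-costate space. -/
def Pc.fst {d : ℕ} (ν : Pc (E d × E d)) : Pc (E d) := ν.map Prod.fst continuous_fst

/-- The Hamiltonian `ℍ(t, ν, u) = ∫ ⟨r, v(t, π¹_# ν, u, x)⟩ dν(x, r)`. -/
def hamiltonian {d : ℕ} {U : Type*} (v : ℝ → Pc (E d) → U → E d → E d)
    (t : ℝ) (ν : Pc (E d × E d)) (u : U) : ℝ :=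
  ∫ z, ⟪z.2, v t ν.fst u z.1⟫_ℝ ∂ν.toMeasure

/-- The Wasserstein gradient of the Hamiltonian with respect to `ν`, evaluated at `z = (x, r)`. -/
def hamiltonianGrad {d : ℕ} {U : Type*} (v : ℝ → Pc (E d) → U → E d → E d)
    (Dv : ℝ → Pc (E d) → U → E d → E d → (E d →L[ℝ] E d))
    (t : ℝ) (ν : Pc (E d × E d)) (u : U) (z : E d × E d) : E d × E d :=
  (ContinuousLinearMap.adjoint (fderiv ℝ (v t ν.fst u) z.1) z.2 +
      ∫ q, ContinuousLinearMap.adjoint (Dv t ν.fst u q.1 z.1) q.2 ∂ν.toMeasure,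
    v t ν.fst u z.1)

/-- The action of the symplectic matrix with blocks `0, Id, -Id, 0`. -/
def symplectic {d : ℕ} (z : E d × E d) : E d × E d := (z.2, -z.1)

/-- The state-costate curve `ν` satisfies the Pontryagin maximum principle along `(μ, u)`.
The product `E d × E d` carries the maximum norm, which is equivalent to the Euclidean norm of
`ℝ^{2d}`; this only affects the bound in `abs_continuous` by a constant factor. The dynamics and the
terminal condition do not depend on the representatives of the Wasserstein gradients. -/
structure SatisfiesPMP {d : ℕ} {U : Type*} (T : ℝ) (v : ℝ → Pc (E d) → U → E d → E d)
    (φ : Pc (E d) → ℝ) (μ : ℝ → Pc (E d)) (u : ℝ → U) (ν : ℝ → Pc (E d × E d)) : Prop where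
  support_bound : ∃ R > 0, ∀ t ∈ Icc 0 T,
    ν t ∈ POn (Metric.closedBall (0 : E d) R ×ˢ Metric.closedBall (0 : E d) R)
  abs_continuous : ∃ m : ℝ → ℝ, (∀ t, 0 ≤ m t) ∧ IntegrableOn m (Icc 0 T) ∧
    ∀ τ t, 0 ≤ τ → τ ≤ t → t ≤ T → wass 1 (ν τ) (ν t) ≤ ∫ s in τ..t, m s
  dynamics : ∃ Dv, IsMeasureDerivative T v Dv ∧
    SolvesCE 0 T (fun t z => symplectic (hamiltonianGrad v Dv t (ν t) (u t) z)) ν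
  marginal : ∀ t ∈ Icc 0 T, (ν t).fst = μ t
  terminal : ∃ g, Continuous g ∧ IsWassersteinGradient φ (μ T) g ∧
    (ν T).toMeasure = (μ T).toMeasure.map (fun x => (x, -g x))
  maximisation : ∀ᵐ t ∂volume.restrict (Icc 0 T),
    ∀ u', hamiltonian v t (ν t) u' ≤ hamiltonian v t (ν t) (u t)

/-- The barycentric projection `ν̄(x) = ∫ r dν_x(r)` onto the first marginal, where `(ν_x)` is the
disintegration of `ν` against its first marginal. -/
def barycenter {d : ℕ} (ν : Pc (E d × E d)) (x : E d) : E d :=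
  ∫ r, r ∂(ν.toMeasure.condKernel x)

/-! ### Dini superdifferential -/

/-- The measure `(Id + ε F)_# μ` for `F ∈ L^∞(μ)`; its support is again compact. -/
def Pc.perturb {d : ℕ} (μ : Pc (E d)) (F : Lp (E d) ⊤ μ.toMeasure) (ε : ℝ) : Pc (E d) where
  toMeasure := μ.toMeasure.map (fun x => x + ε • F x)
  isProb := Measure.isProbabilityMeasure_map
    (aemeasurable_id.add ((Lp.aestronglyMeasurable F).aemeasurable.const_smul ε))
  isCompact_support := by
    obtain ⟨C, hC⟩ : ∃ C : ℝ, ∀ᵐ x ∂μ.toMeasure, ‖F x‖ ≤ C := by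
      refine ⟨(eLpNormEssSup F μ.toMeasure).toReal, ?_⟩
      have hfin : eLpNormEssSup F μ.toMeasure ≠ ⊤ := by
        have := Lp.eLpNorm_ne_top F
        rwa [eLpNorm_exponent_top] at this
      filter_upwards [enorm_ae_le_eLpNormEssSup F μ.toMeasure] with x hx
      rw [← toReal_enorm]
      exact ENNReal.toReal_mono hfin hx
    obtain ⟨R, hR⟩ := μ.isCompact_support.isBounded.subset_closedBall (0 : E d)
    have hmeas : AEMeasurable (fun x => x + ε • F x) μ.toMeasure :=
      aemeasurable_id.add ((Lp.aestronglyMeasurable F).aemeasurable.const_smul ε)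
    refine (isCompact_closedBall (0 : E d) (R + |ε| * C)).of_isClosed_subset
      Measure.isClosed_support
      (Measure.support_subset_of_isClosed Metric.isClosed_closedBall ?_)
    rw [mem_ae_map_iff hmeas Metric.isClosed_closedBall.measurableSet]
    filter_upwards [hC, Measure.support_mem_ae (μ := μ.toMeasure)] with x hx hxs
    have h1 : ‖x‖ ≤ R := by simpa using hR hxs
    simp only [mem_preimage, mem_closedBall_zero_iff]
    calc ‖x + ε • F x‖ ≤ ‖x‖ + ‖ε • F x‖ := norm_add_le _ _
      _ = ‖x‖ + |ε| * ‖F x‖ := by rw [norm_smul, Real.norm_eq_abs]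
      _ ≤ R + |ε| * C := by gcongr

/-- The upper Dini derivative of `V` at `(τ, μ)` in the direction `(h, F)`, an extended real. -/
def upperDini {d : ℕ} (V : ℝ → Pc (E d) → ℝ) (τ : ℝ) (μ : Pc (E d)) (h : ℝ)
    (F : Lp (E d) ⊤ μ.toMeasure) : EReal :=
  limsup (fun ε : ℝ => (((V (τ + ε * h) (μ.perturb F ε) - V τ μ) / ε : ℝ) : EReal)) (𝓝[>] 0)

/-- The pair `(δ, ξ)` belongs to the localised Dini superdifferential of `V` at `(τ, μ)`. -/
def MemDiniSuperdifferential {d : ℕ} (V : ℝ → Pc (E d) → ℝ) (τ : ℝ) (μ : Pc (E d))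
    (δ : ℝ) (ξ : E d → E d) : Prop :=
  MemLp ξ 2 μ.toMeasure ∧ ∀ (h : ℝ) (F : Lp (E d) ⊤ μ.toMeasure),
    upperDini V τ μ h F ≤ ((∫ x, ⟪ξ x, F x⟫_ℝ ∂μ.toMeasure + δ * h : ℝ) : EReal)

end

end MeanField

/-!
Along the trajectory, `f t = 𝒱(t, μ*(t))` satisfies `f t - f s ≤ ∫ r in s..t, m r` for `s ≤ t` and
some integrable `m`: by dynamic programming, the increment is controlled by the Lipschitz constant
of `𝒱(t, ·)` times the distance by which two trajectories from `μ*(s)` can separate. For such an `f`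
it is enough that its upper right derivative is a.e. nonpositive in order to have `f T ≤ f 0`, that
is `φ(μ*(T)) ≤ 𝒱(0, μ⁰)`. At almost every `t` the curves of the flow are differentiable, so that
`W₁(μ*(t + ε), (Id + εF)_# μ*(t)) = o(ε)` with `F = v(t, μ*(t), u*(t), ·)`. The superdifferential
inequality in the direction `(1, F)` then bounds the upper right derivative of `f` by
`-∫ ⟨ν̄*(t), F⟩ dμ*(t) + ℍ(t, ν*(t), u*(t)) = 0`.
-/

open scoped BoundedContinuousFunction NNReal

namespace MeanField

theorem absolutelyContinuousOnInterval_of_dist_le {Y Z : Type*} [PseudoMetricSpace Y]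
    [PseudoMetricSpace Z] {f : ℝ → Y} {g : ℝ → Z} {a b K : ℝ}
    (hg : AbsolutelyContinuousOnInterval g a b)
    (hfg : ∀ s ∈ uIcc a b, ∀ t ∈ uIcc a b, dist (f s) (f t) ≤ K * dist (g s) (g t)) :
    AbsolutelyContinuousOnInterval f a b := by
  refine squeeze_zero' (Eventually.of_forall fun J => Finset.sum_nonneg fun i _ => dist_nonneg) ?_
    (by simpa using Tendsto.const_mul K hg)
  refine eventually_inf_principal.2 (Eventually.of_forall fun J hJ => ?_)
  rw [Finset.mul_sum]
  exact Finset.sum_le_sum fun i hi => hfg _ (hJ.1 i hi).1 _ (hJ.1 i hi).2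

theorem absolutelyContinuousOnInterval_of_norm_sub_le_integral {F : Type*}
    [SeminormedAddCommGroup F] {f : ℝ → F} {m : ℝ → ℝ} {a b : ℝ} (hab : a ≤ b)
    (hm : IntervalIntegrable m volume a b)
    (hf : ∀ s t, a ≤ s → s ≤ t → t ≤ b → ‖f t - f s‖ ≤ ∫ r in s..t, m r) :
    AbsolutelyContinuousOnInterval f a b := by
  refine absolutelyContinuousOnInterval_of_dist_le (K := 1)
    (hm.absolutelyContinuousOnInterval_intervalIntegral left_mem_uIcc) fun s hs t ht => ?_
  wlog hst : s ≤ t generalizing s t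
  · rw [dist_comm (f s), dist_comm (∫ r in a..s, m r)]
    exact this t ht s hs (le_of_not_ge hst)
  have hm' : ∀ r ∈ uIcc a b, IntervalIntegrable m volume a r := fun r hr =>
    hm.mono_set (uIcc_subset_uIcc_left hr)
  rw [one_mul, dist_comm, dist_comm (∫ r in a..s, m r), dist_eq_norm, Real.dist_eq,
    intervalIntegral.integral_interval_sub_left (hm' t ht) (hm' s hs)]
  rw [uIcc_of_le hab] at hs ht
  exact (hf s t hs.1 hst ht.2).trans (le_abs_self _)

theorem absolutelyContinuousOnInterval_comp_contDiff {f g : ℝ → ℝ} {a b : ℝ}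
    (hf : ContDiff ℝ 1 f) (hg : AbsolutelyContinuousOnInterval g a b) :
    AbsolutelyContinuousOnInterval (fun t => f (g t)) a b := by
  obtain ⟨C, hC⟩ := hg.exists_bound
  obtain ⟨K, hK⟩ := hf.contDiffOn.exists_lipschitzOnWith (by decide)
    (convex_closedBall (0 : ℝ) C) (isCompact_closedBall 0 C)
  exact absolutelyContinuousOnInterval_of_dist_le hg fun s hs t ht =>
    hK.dist_le_mul _ (mem_closedBall_zero_iff.2 (hC s hs)) _ (mem_closedBall_zero_iff.2 (hC t ht))

theorem integral_eq_sub_of_ae_hasDerivAt {f f' : ℝ → ℝ} {a b : ℝ} (hab : a ≤ b)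
    (hf : AbsolutelyContinuousOnInterval f a b)
    (hf' : ∀ᵐ t ∂volume.restrict (Icc a b), HasDerivAt f (f' t) t) :
    ∫ t in a..b, f' t = f b - f a := by
  rw [← hf.integral_deriv_eq_sub]
  refine intervalIntegral.integral_congr_ae_restrict ?_
  rw [uIoc_of_le hab, restrict_Ioc_eq_restrict_Icc]
  filter_upwards [hf'] with t ht using ht.deriv.symm

theorem ae_hasDerivAt_primitive {F : Type*} [NormedAddCommGroup F] [NormedSpace ℝ F]
    [CompleteSpace F] {f : ℝ → F} {a b : ℝ} (hab : a ≤ b) (hf : IntegrableOn f (Icc a b)) :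
    ∀ᵐ t ∂volume.restrict (Icc a b), HasDerivAt (fun s => ∫ r in a..s, f r) (f t) t := by
  have hf_int : IntervalIntegrable f volume a b :=
    (intervalIntegrable_iff_integrableOn_Icc_of_le hab).2 hf
  rw [ae_restrict_iff' measurableSet_Icc, ← uIcc_of_le hab]
  filter_upwards [hf_int.ae_hasDerivAt_integral] with t ht hmem
  exact ht hmem a left_mem_uIcc

theorem integral_primitive_sub {m : ℝ → ℝ} (hm : Integrable m) (a s t : ℝ) :
    (∫ r in a..t, m r) - ∫ r in a..s, m r = ∫ r in s..t, m r :=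
  intervalIntegral.integral_interval_sub_left hm.intervalIntegrable hm.intervalIntegrable

section Rate

variable {m : ℝ → ℝ} {a b s t : ℝ}

theorem primitive_nonneg (hm0 : ∀ r, 0 ≤ m r) (hat : a ≤ t) : 0 ≤ ∫ r in a..t, m r :=
  intervalIntegral.integral_nonneg hat fun r _ => hm0 r

theorem primitive_mono (hm : Integrable m) (hm0 : ∀ r, 0 ≤ m r) (hst : s ≤ t) :
    ∫ r in a..s, m r ≤ ∫ r in a..t, m r := by
  rw [← sub_nonneg, integral_primitive_sub hm]
  exact primitive_nonneg hm0 hst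

theorem exists_primitive_split (hm : Integrable m) (hm0 : ∀ r, 0 ≤ m r) {p q : ℝ} (hat : a ≤ t)
    (hp : 0 ≤ p) (hq : 0 ≤ q) (hpq : ∫ r in a..t, m r ≤ p + q) :
    ∃ s ∈ Icc a t, ∫ r in a..s, m r ≤ p ∧ ∫ r in s..t, m r ≤ q := by
  have hcont : Continuous fun s => ∫ r in a..s, m r :=
    intervalIntegral.continuous_primitive (fun _ _ => hm.intervalIntegrable) a
  obtain ⟨s, hs, hs_eq⟩ : min p (∫ r in a..t, m r) ∈ (fun s => ∫ r in a..s, m r) '' Icc a t := by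
    refine intermediate_value_Icc hat hcont.continuousOn ⟨?_, min_le_right _ _⟩
    rw [intervalIntegral.integral_same]
    exact le_min hp (primitive_nonneg hm0 hat)
  change ∫ r in a..s, m r = _ at hs_eq
  refine ⟨s, hs, hs_eq.trans_le (min_le_left _ _), ?_⟩
  rw [← integral_primitive_sub hm a, hs_eq, sub_le_comm]
  exact le_min (by linarith) (by linarith)

theorem absolutelyContinuousOnInterval_exp_primitive (hm : Integrable m) (c : ℝ) :
    AbsolutelyContinuousOnInterval (fun t => Real.exp (c * ∫ r in a..t, m r)) a b :=
  absolutelyContinuousOnInterval_comp_contDiff Real.contDiff_exp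
    ((hm.intervalIntegrable.absolutelyContinuousOnInterval_intervalIntegral
      left_mem_uIcc).const_mul c)

theorem ae_hasDerivAt_exp_primitive (hab : a ≤ b) (hm : Integrable m) (c : ℝ) :
    ∀ᵐ t ∂volume.restrict (Icc a b), HasDerivAt (fun s => Real.exp (c * ∫ r in a..s, m r))
      (Real.exp (c * ∫ r in a..t, m r) * (c * m t)) t := by
  filter_upwards [ae_hasDerivAt_primitive hab hm.integrableOn] with t ht
  exact (ht.const_mul c).exp

theorem integral_mul_exp_primitive (hm : Integrable m) (hab : a ≤ b) (c : ℝ) :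
    ∫ t in a..b, Real.exp (c * ∫ r in a..t, m r) * (c * m t) =
      Real.exp (c * ∫ r in a..b, m r) - 1 := by
  rw [integral_eq_sub_of_ae_hasDerivAt hab (absolutelyContinuousOnInterval_exp_primitive hm c)
    (ae_hasDerivAt_exp_primitive hab hm c)]
  simp

theorem le_mul_exp_of_le_add_integral {g : ℝ → ℝ} {c : ℝ} (hm : Integrable m)
    (hm0 : ∀ t, 0 ≤ m t) (hab : a ≤ b) (hg : ContinuousOn g (Icc a b))
    (hle : ∀ t ∈ Icc a b, g t ≤ c + ∫ s in a..t, m s * g s) :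
    g b ≤ c * Real.exp (∫ s in a..b, m s) := by
  set G : ℝ → ℝ := fun t => c + ∫ s in a..t, m s * g s
  set e : ℝ → ℝ := fun t => Real.exp (-1 * ∫ r in a..t, m r)
  have hmg : IntervalIntegrable (fun s => m s * g s) volume a b :=
    hm.intervalIntegrable.mul_continuousOn (by rwa [uIcc_of_le hab])
  have hG : AbsolutelyContinuousOnInterval G a b :=
    absolutelyContinuousOnInterval_comp_contDiff (contDiff_const.add contDiff_id)
      (hmg.absolutelyContinuousOnInterval_intervalIntegral left_mem_uIcc)
  have hGe : ∀ᵐ t ∂volume.restrict (Icc a b), HasDerivAt (fun t => G t * e t)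
      (m t * (g t - G t) * e t) t := by
    filter_upwards [ae_hasDerivAt_primitive hab
      ((intervalIntegrable_iff_integrableOn_Icc_of_le hab).1 hmg),
      ae_hasDerivAt_exp_primitive hab hm (-1)] with t hGt het
    convert! (hGt.const_add c).mul het using 1
    ring
  have hmono : G b * e b - G a * e a ≤ 0 := by
    rw [← integral_eq_sub_of_ae_hasDerivAt hab
      (hG.fun_mul (absolutelyContinuousOnInterval_exp_primitive hm (-1))) hGe]
    rw [← neg_nonneg, ← intervalIntegral.integral_neg]
    refine intervalIntegral.integral_nonneg hab fun t ht => neg_nonneg.2 ?_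
    exact mul_nonpos_of_nonpos_of_nonneg
      (mul_nonpos_of_nonneg_of_nonpos (hm0 t) (sub_nonpos.2 (hle t ht))) (Real.exp_nonneg _)
  have hGa : G a * e a = c := by simp [G, e]
  have hGb : G b ≤ c * Real.exp (∫ s in a..b, m s) := by
    rw [← div_le_iff₀ (Real.exp_pos _), div_eq_mul_inv, ← Real.exp_neg, ← neg_one_mul]
    linarith
  exact (hle b (right_mem_Icc.2 hab)).trans hGb

theorem deriv_nonpos_of_right_derivative_nonpos {f : ℝ → ℝ} {f' t : ℝ} (hf : HasDerivAt f f' t)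
    (hle : ∀ η > 0, ∀ᶠ ε in 𝓝[>] (0 : ℝ), f (t + ε) - f t ≤ η * ε) : f' ≤ 0 := by
  refine le_of_forall_pos_le_add fun η hη => ?_
  have hslope := (hasDerivAt_iff_tendsto_slope_zero.1 hf).mono_left
    (nhdsWithin_mono (0 : ℝ) fun x (hx : x ∈ Ioi (0 : ℝ)) => ne_of_gt hx)
  refine le_of_tendsto hslope ?_
  filter_upwards [hle η hη, self_mem_nhdsWithin] with ε hε hε0
  rwa [smul_eq_mul, inv_mul_le_iff₀ hε0, zero_add, mul_comm]

theorem le_of_ae_right_derivative_nonpos {f : ℝ → ℝ} (hm : Integrable m) (hab : a ≤ b)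
    (hf : ∀ s t, a ≤ s → s ≤ t → t ≤ b → f t - f s ≤ ∫ r in s..t, m r)
    (hf' : ∀ᵐ t ∂volume.restrict (Icc a b), ∀ η > 0, ∀ᶠ ε in 𝓝[>] (0 : ℝ),
      f (t + ε) - f t ≤ η * ε) : f b ≤ f a := by
  -- `g` is monotone, so it is a.e. differentiable and its increment dominates the integral of `g'`.
  set g : ℝ → ℝ := fun t => (∫ r in a..t, m r) - f t with hg_def
  have hg : MonotoneOn g (uIcc a b) := by
    rw [uIcc_of_le hab]
    intro s hs t ht hst
    have := hf s t hs.1 hst ht.2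
    rw [← integral_primitive_sub hm a] at this
    simp only [hg_def]
    linarith
  have hderiv : ∫ t in a..b, m t ≤ ∫ t in a..b, deriv g t := by
    refine intervalIntegral.integral_mono_ae_restrict hab hm.intervalIntegrable
      hg.intervalIntegrable_deriv ?_
    rw [← restrict_Ioo_eq_restrict_Icc] at hf' ⊢
    filter_upwards [hf', ae_restrict_of_ae_restrict_of_subset Ioo_subset_Icc_self
      (ae_hasDerivAt_primitive hab hm.integrableOn), ae_restrict_mem measurableSet_Ioo,
      ae_restrict_of_ae hg.ae_differentiableWithinAt_of_mem] with t hft hmt ht hgt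
    rw [uIcc_of_le hab] at hgt
    have hgt' := ((hgt (Ioo_subset_Icc_self ht)).differentiableAt
      (Icc_mem_nhds ht.1 ht.2)).hasDerivAt
    have hft' : HasDerivAt f (m t - deriv g t) t := by
      convert! hmt.sub hgt' using 1
      ext s
      simp [hg_def]
    exact sub_nonpos.1 (deriv_nonpos_of_right_derivative_nonpos hft' hft)
  have hincr := hg.intervalIntegral_deriv_mem_uIcc
  rw [uIcc_of_le (sub_nonneg.2 (hg left_mem_uIcc right_mem_uIcc hab))] at hincr
  have := hderiv.trans hincr.2
  simp only [hg_def, intervalIntegral.integral_same] at this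
  linarith

end Rate

section Concentration

variable {X : Type*} [MeasurableSpace X]

theorem Pc.ext_of_toMeasure [TopologicalSpace X] {μ ν : Pc X} (h : μ.toMeasure = ν.toMeasure) :
    μ = ν := by
  cases μ
  cases ν
  cases h
  rfl

theorem mem_POn_iff [TopologicalSpace X] {K : Set X} {μ : Pc X} :
    μ ∈ POn K ↔ ∀ᵐ x ∂μ.toMeasure, x ∈ K := Iff.rfl

theorem mem_POn_closedBall_iff [SeminormedAddCommGroup X] {R : ℝ} {μ : Pc X} :
    μ ∈ POn (Metric.closedBall (0 : X) R) ↔ ∀ᵐ x ∂μ.toMeasure, ‖x‖ ≤ R := by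
  simp only [mem_POn_iff, mem_closedBall_zero_iff]

theorem POn_mono [TopologicalSpace X] {K L : Set X} (hKL : K ⊆ L) :
    (POn K : Set (Pc X)) ⊆ POn L :=
  fun _ hμ => mem_POn_iff.2 ((mem_POn_iff.1 hμ).mono fun _ hx => hKL hx)

theorem Pc.exists_mem_POn_closedBall [SeminormedAddCommGroup X] [HereditarilyLindelofSpace X]
    (μ : Pc X) : ∃ R > 0, μ ∈ POn (Metric.closedBall (0 : X) R) := by
  obtain ⟨R, hR0, hR⟩ := μ.isCompact_support.isBounded.subset_closedBall_lt 0 (0 : X)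
  refine ⟨R, hR0, mem_POn_iff.2 ?_⟩
  filter_upwards [Measure.support_mem_ae (μ := μ.toMeasure)] with x hx using hR hx

theorem Pc.integrable_of_continuous [TopologicalSpace X] [HereditarilyLindelofSpace X]
    [OpensMeasurableSpace X] {F : Type*} [NormedAddCommGroup F] [SecondCountableTopology F]
    (μ : Pc X) {f : X → F} (hf : Continuous f) : Integrable f μ.toMeasure := by
  borelize F
  obtain ⟨C, hC⟩ := μ.isCompact_support.exists_bound_of_continuousOn hf.continuousOn
  refine Integrable.of_bound hf.measurable.aestronglyMeasurable C ?_
  filter_upwards [Measure.support_mem_ae (μ := μ.toMeasure)] with x hx using hC x hx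

theorem Pc.abs_integral_sub_le [TopologicalSpace X] [HereditarilyLindelofSpace X]
    [OpensMeasurableSpace X] (μ : Pc X) {f g : X → ℝ} (hf : Continuous f) (hg : Continuous g)
    {ε : ℝ} (hfg : ∀ x, dist (f x) (g x) ≤ ε) :
    |∫ x, f x ∂μ.toMeasure - ∫ x, g x ∂μ.toMeasure| ≤ ε := by
  rw [← integral_sub (μ.integrable_of_continuous hf) (μ.integrable_of_continuous hg)]
  simpa using norm_integral_le_of_norm_le_const (μ := μ.toMeasure)
    (Eventually.of_forall fun x => (dist_eq_norm (f x) (g x)).symm.trans_le (hfg x))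

end Concentration

section Wasserstein

variable {X : Type*} [MeasurableSpace X]

theorem map_prodMk_mem_plans {Ω : Type*} [MeasurableSpace Ω] {P : Measure Ω}
    [IsProbabilityMeasure P] {f g : Ω → X} (hf : AEMeasurable f P) (hg : AEMeasurable g P) :
    P.map (fun o => (f o, g o)) ∈ plans (P.map f) (P.map g) :=
  ⟨Measure.isProbabilityMeasure_map (hf.prodMk hg),
    AEMeasurable.map_map_of_aemeasurable measurable_fst.aemeasurable (hf.prodMk hg),
    AEMeasurable.map_map_of_aemeasurable measurable_snd.aemeasurable (hf.prodMk hg)⟩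

variable [PseudoMetricSpace X]

theorem wass_nonneg (p : ℝ) (μ ν : Pc X) : 0 ≤ wass p μ ν := ENNReal.toReal_nonneg

theorem wass_one_eq (μ ν : Pc X) :
    wass 1 μ ν = (⨅ γ ∈ plans μ.toMeasure ν.toMeasure, cost 1 γ).toReal := by
  simp [wass]

theorem cost_one_eq_ofReal {γ : Measure (X × X)} (hγ : Integrable (fun z => dist z.1 z.2) γ) :
    cost 1 γ = ENNReal.ofReal (∫ z, dist z.1 z.2 ∂γ) := by
  rw [ofReal_integral_eq_lintegral_ofReal hγ (Eventually.of_forall fun _ => dist_nonneg)]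
  simp [cost, edist_dist]

variable [SecondCountableTopology X] [BorelSpace X]

theorem wass_one_le_integral_dist {Ω : Type*} [MeasurableSpace Ω] {P : Measure Ω}
    [IsProbabilityMeasure P] {f g : Ω → X} (hf : AEMeasurable f P) (hg : AEMeasurable g P)
    {μ ν : Pc X} (hμ : P.map f = μ.toMeasure) (hν : P.map g = ν.toMeasure)
    (hfg : Integrable (fun o => dist (f o) (g o)) P) :
    wass 1 μ ν ≤ ∫ o, dist (f o) (g o) ∂P := by
  have hdist : AEStronglyMeasurable (fun z : X × X => dist z.1 z.2)
      (P.map fun o => (f o, g o)) := continuous_dist.aestronglyMeasurable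
  have hcost : cost 1 (P.map fun o => (f o, g o)) = ENNReal.ofReal (∫ o, dist (f o) (g o) ∂P) := by
    rw [cost_one_eq_ofReal ((integrable_map_measure hdist (hf.prodMk hg)).2 hfg),
      integral_map (hf.prodMk hg) hdist]
  have hle := iInf₂_le (f := fun γ (_ : γ ∈ plans μ.toMeasure ν.toMeasure) => cost 1 γ) _
    (hμ ▸ hν ▸ map_prodMk_mem_plans hf hg)
  rw [wass_one_eq]
  exact ENNReal.toReal_le_of_le_ofReal (integral_nonneg fun _ => dist_nonneg) (hle.trans_eq hcost)

theorem wass_one_map_le {Y : Type*} [MetricSpace Y] [SecondCountableTopology Y]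
    [MeasurableSpace Y] [BorelSpace Y] (μ : Pc X) {f g : X → Y} (hf : Continuous f)
    (hg : Continuous g) :
    wass 1 (μ.map f hf) (μ.map g hg) ≤ ∫ x, dist (f x) (g x) ∂μ.toMeasure :=
  wass_one_le_integral_dist hf.measurable.aemeasurable hg.measurable.aemeasurable rfl rfl
    (μ.integrable_of_continuous (hf.dist hg))

theorem integrable_dist_of_mem_plans {μ ν : Pc X} {γ : Measure (X × X)}
    (hγ : γ ∈ plans μ.toMeasure ν.toMeasure) : Integrable (fun z : X × X => dist z.1 z.2) γ := by
  obtain ⟨-, hfst, hsnd⟩ := hγ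
  obtain ⟨x₀⟩ : Nonempty X := (nonempty_of_isProbabilityMeasure μ.toMeasure)
  have hdist : Continuous fun x => dist x x₀ := by fun_prop
  have h1 := μ.integrable_of_continuous hdist
  have h2 := ν.integrable_of_continuous hdist
  rw [← hfst] at h1
  rw [← hsnd] at h2
  refine ((h1.comp_measurable measurable_fst).add (h2.comp_measurable measurable_snd)).mono'
    continuous_dist.aestronglyMeasurable (Eventually.of_forall fun z => ?_)
  rw [Real.norm_of_nonneg dist_nonneg]
  exact dist_triangle_right _ _ _

theorem exists_plan_integral_dist_le (μ ν : Pc X) {ε : ℝ} (hε : 0 < ε) :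
    ∃ γ ∈ plans μ.toMeasure ν.toMeasure, ∫ z, dist z.1 z.2 ∂γ ≤ wass 1 μ ν + ε := by
  set I := ⨅ γ ∈ plans μ.toMeasure ν.toMeasure, cost 1 γ with hI
  have hprod : μ.toMeasure.prod ν.toMeasure ∈ plans μ.toMeasure ν.toMeasure :=
    ⟨inferInstance, by simp, by simp⟩
  have hI_top : I ≠ ⊤ := by
    refine ne_top_of_le_ne_top ?_ (iInf₂_le _ hprod)
    rw [cost_one_eq_ofReal (integrable_dist_of_mem_plans hprod)]
    exact ENNReal.ofReal_ne_top
  have hlt : I < I + ENNReal.ofReal ε := ENNReal.lt_add_right hI_top (by simpa using hε)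
  obtain ⟨γ, hγ, hγ_cost⟩ := by simpa only [hI, iInf_lt_iff] using hlt
  refine ⟨γ, hγ, ?_⟩
  rw [cost_one_eq_ofReal (integrable_dist_of_mem_plans hγ), ← hI] at hγ_cost
  rw [wass_one_eq, ← hI, ← ENNReal.toReal_ofReal hε.le,
    ← ENNReal.toReal_add hI_top ENNReal.ofReal_ne_top]
  exact (ENNReal.ofReal_le_iff_le_toReal (by finiteness)).1 hγ_cost.le

theorem abs_integral_sub_le_mul_wass_one {f : X → ℝ} {K : ℝ≥0} (hf : LipschitzWith K f)
    (μ ν : Pc X) :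
    |∫ x, f x ∂μ.toMeasure - ∫ x, f x ∂ν.toMeasure| ≤ K * wass 1 μ ν := by
  have hplan : ∀ ε > 0, |∫ x, f x ∂μ.toMeasure - ∫ x, f x ∂ν.toMeasure| ≤
      K * (wass 1 μ ν + ε) := by
    intro ε hε
    obtain ⟨γ, hγ, hγ_le⟩ := exists_plan_integral_dist_le μ ν hε
    have hγ_dist := integrable_dist_of_mem_plans hγ
    obtain ⟨-, hfst, hsnd⟩ := hγ
    have h1 := μ.integrable_of_continuous hf.continuous
    have h2 := ν.integrable_of_continuous hf.continuous
    rw [← hfst] at h1 ⊢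
    rw [← hsnd] at h2 ⊢
    have h1' : Integrable (fun z : X × X => f z.1) γ := h1.comp_measurable measurable_fst
    have h2' : Integrable (fun z : X × X => f z.2) γ := h2.comp_measurable measurable_snd
    rw [integral_map measurable_fst.aemeasurable h1.1,
      integral_map measurable_snd.aemeasurable h2.1, ← integral_sub h1' h2']
    calc |∫ z, (f z.1 - f z.2) ∂γ| ≤ ∫ z, |f z.1 - f z.2| ∂γ := abs_integral_le_integral_abs
      _ ≤ ∫ z, K * dist z.1 z.2 ∂γ :=
          integral_mono (h1'.sub h2').abs (hγ_dist.const_mul _) fun z => hf.dist_le_mul _ _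
      _ = K * ∫ z, dist z.1 z.2 ∂γ := integral_const_mul _ _
      _ ≤ K * (wass 1 μ ν + ε) := by gcongr
  have hlim : Tendsto (fun ε : ℝ => K * (wass 1 μ ν + ε)) (𝓝[>] 0) (𝓝 (K * wass 1 μ ν)) := by
    have : Continuous fun ε : ℝ => K * (wass 1 μ ν + ε) := by fun_prop
    simpa using (this.tendsto 0).mono_left nhdsWithin_le_nhds
  exact ge_of_tendsto hlim (eventually_mem_nhdsWithin.mono hplan)

end Wasserstein

section Mollifier

open scoped Convolution in
theorem lipschitzWith_convolution_right {X A F G : Type*} [NormedAddCommGroup X]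
    [MeasurableSpace X] [OpensMeasurableSpace X] [NormedAddCommGroup A] [NormedSpace ℝ A]
    [NormedAddCommGroup F] [NormedSpace ℝ F] [NormedAddCommGroup G] [NormedSpace ℝ G]
    (B : A →L[ℝ] F →L[ℝ] G) {μ : Measure X} [IsFiniteMeasureOnCompacts μ] {f : X → A} {g : X → F}
    {c δ : ℝ≥0} (hf : Continuous f) (hcf : HasCompactSupport f) (hc : ∫ t, ‖f t‖ ∂μ ≤ c)
    (hg : LipschitzWith δ g) : LipschitzWith (‖B‖₊ * c * δ) (f ⋆[B, μ] g) := by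
  have hg_cont := hg.continuous
  have hint : ∀ x, Integrable (fun t => B (f t) (g (x - t))) μ := fun x => by
    refine Continuous.integrable_of_hasCompactSupport (by fun_prop) (hcf.mono fun t ht => ?_)
    contrapose! ht
    simp only [Function.mem_support, not_not] at ht ⊢
    simp [ht]
  have hf_int : Integrable (fun t => ‖f t‖) μ := hf.norm.integrable_of_hasCompactSupport hcf.norm
  refine LipschitzWith.of_dist_le_mul fun x y => ?_
  simp only [convolution_def]
  rw [dist_eq_norm, ← integral_sub (hint x) (hint y)]
  calc ‖∫ t, (B (f t) (g (x - t)) - B (f t) (g (y - t))) ∂μ‖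
      ≤ ∫ t, ‖B‖ * ‖f t‖ * (δ * dist x y) ∂μ := by
        refine norm_integral_le_of_norm_le ((hf_int.const_mul _).mul_const _)
          (Eventually.of_forall fun t => ?_)
        rw [← map_sub]
        refine (B.le_opNorm₂ _ _).trans ?_
        gcongr
        simpa [dist_eq_norm] using hg.dist_le_mul (x - t) (y - t)
    _ = ‖B‖ * (∫ t, ‖f t‖ ∂μ) * (δ * dist x y) := by rw [integral_mul_const, integral_const_mul]
    _ ≤ ‖B‖ * c * (δ * dist x y) := by gcongr
    _ = (‖B‖₊ * c * δ : ℝ≥0) * dist x y := by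
        push_cast
        ring

open scoped Convolution in
set_option maxSynthPendingDepth 3 in
theorem exists_mollification (X F : Type*) [NormedAddCommGroup X] [NormedSpace ℝ X]
    [FiniteDimensional ℝ X] [NormedAddCommGroup F] [NormedSpace ℝ F] [CompleteSpace F]
    {r : ℝ} (hr : 0 < r) :
    ∃ C : ℝ≥0, ∀ (g : X → F) (δ : ℝ≥0), LipschitzWith δ g →
      ∃ g' : X → F, ContDiff ℝ ∞ g' ∧ (∀ x, dist (g' x) (g x) ≤ δ * r) ∧ LipschitzWith δ g' ∧
        LipschitzWith (C * δ) (fderiv ℝ g') ∧ (HasCompactSupport g → HasCompactSupport g') := by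
  borelize X
  let φ : ContDiffBump (0 : X) := ⟨r / 2, r, half_pos hr, half_lt_self hr⟩
  let μ : Measure X := Measure.addHaar
  let B : ℝ →L[ℝ] F →L[ℝ] F := ContinuousLinearMap.lsmul ℝ ℝ
  have hφ : ContDiff ℝ ∞ (φ.normed μ) := φ.contDiff_normed
  have hφ1 : ContDiff ℝ 1 (φ.normed μ) := φ.contDiff_normed
  have hφ_supp : HasCompactSupport (φ.normed μ) := φ.hasCompactSupport_normed
  have hφ_norm : ∫ t, ‖φ.normed μ t‖ ∂μ ≤ (1 : ℝ≥0) := by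
    simp only [Real.norm_of_nonneg (φ.nonneg_normed _), φ.integral_normed, NNReal.coe_one, le_rfl]
  refine ⟨‖B.precompL X‖₊ * (∫ t, ‖fderiv ℝ (φ.normed μ) t‖ ∂μ).toNNReal, fun g δ hg => ?_⟩
  have hg_loc : LocallyIntegrable g μ := hg.continuous.locallyIntegrable
  refine ⟨φ.normed μ ⋆[B, μ] g, hφ_supp.contDiff_convolution_left B hφ hg_loc, fun x => ?_, ?_, ?_,
    fun hc => hφ_supp.convolution B hc⟩
  · refine φ.dist_normed_convolution_le hg.continuous.aestronglyMeasurable fun y hy => ?_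
    exact (hg.dist_le_mul y x).trans (by gcongr; exact (Metric.mem_ball.1 hy).le)
  · refine (lipschitzWith_convolution_right B hφ.continuous hφ_supp hφ_norm hg).weaken ?_
    rw [mul_one]
    exact mul_le_of_le_one_left zero_le ContinuousLinearMap.opNorm_lsmul_le
  · have hderiv : fderiv ℝ (φ.normed μ ⋆[B, μ] g) =
        fderiv ℝ (φ.normed μ) ⋆[B.precompL X, μ] g := funext fun x =>
      (hφ_supp.hasFDerivAt_convolution_left B hφ1 hg_loc x).fderiv
    rw [hderiv]
    exact lipschitzWith_convolution_right _ (hφ1.continuous_fderiv one_ne_zero)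
      (hφ_supp.fderiv ℝ) (Real.le_coe_toNNReal _) hg

theorem exists_truncation (X : Type*) [NormedAddCommGroup X] [NormedSpace ℝ X]
    [FiniteDimensional ℝ X] {R : ℝ} (hR : 0 < R) :
    ∃ (P : X → X) (C : ℝ≥0), LipschitzWith C P ∧ (∀ x, ‖x‖ ≤ R → P x = x) ∧
      (∀ x, ‖P x‖ ≤ ‖x‖) ∧ ∀ x, ‖P x‖ ≤ 2 * R := by
  let φ : ContDiffBump (0 : X) := ⟨R, 2 * R, hR, by linarith⟩
  have hle : ∀ x, ‖φ x • x‖ ≤ ‖x‖ := fun x => by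
    rw [norm_smul, Real.norm_of_nonneg φ.nonneg]
    exact mul_le_of_le_one_left (norm_nonneg _) φ.le_one
  have hsmooth : ContDiff ℝ 1 (fun x => φ x • x) := φ.contDiff.smul contDiff_id
  have hsupp : HasCompactSupport (fun x => φ x • x) := φ.hasCompactSupport.smul_right
  obtain ⟨C, hC⟩ := ContDiff.lipschitzWith_of_hasCompactSupport hsupp hsmooth one_ne_zero
  refine ⟨fun x => φ x • x, C, hC, fun x hx => ?_, hle, fun x => ?_⟩
  · simp only [φ.one_of_mem_closedBall (mem_closedBall_zero_iff.2 hx), one_smul]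
  · rcases lt_or_ge ‖x‖ (2 * R) with hx | hx
    · exact (hle x).trans hx.le
    · simp only [φ.zero_of_le_dist (hx.trans_eq (dist_zero_right x).symm), zero_smul, norm_zero]
      positivity

end Mollifier

section Caratheodory

variable {P F : Type*} [TopologicalSpace P] [TopologicalSpace.MetrizableSpace P]
  [SecondCountableTopology P] [MeasurableSpace P] [OpensMeasurableSpace P] [NormedAddCommGroup F]
  {g : ℝ → P → F} {lam : Measure ℝ}

theorem exists_stronglyMeasurable_uncurry (hc : ∀ᵐ s ∂lam, Continuous (g s))
    (hm : ∀ p, AEStronglyMeasurable (fun s => g s p) lam) :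
    ∃ g' : ℝ → P → F, StronglyMeasurable (Function.uncurry g') ∧
      ∀ᵐ s ∂lam, ∀ p, g s p = g' s p := by
  classical
  obtain ⟨D, hDc, hD⟩ := TopologicalSpace.exists_countable_dense P
  have hgood : ∀ᵐ s ∂lam, Continuous (g s) ∧ ∀ d ∈ D, g s d = (hm d).mk _ s :=
    hc.and ((ae_ball_iff hDc).2 fun d _ => (hm d).ae_eq_mk)
  obtain ⟨S, hS, hS_meas, hSg⟩ := hgood.exists_measurable_mem
  refine ⟨fun s p => S.indicator (fun s => g s p) s, ?_, ?_⟩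
  · have hu := stronglyMeasurable_uncurry_of_continuous_of_stronglyMeasurable
      (u := fun p s => S.indicator (fun s => g s p) s) (fun s => ?_) (fun p => ?_)
    · exact hu.comp_measurable measurable_swap
    · by_cases hs : s ∈ S
      · simpa [hs] using (hSg s hs).1
      · simpa [hs] using continuous_const
    · obtain ⟨d, hd, hlim⟩ := mem_closure_iff_seq_limit.1 (hD p)
      refine stronglyMeasurable_of_tendsto atTop
        (f := fun n s => S.indicator ((hm (d n)).mk _) s)
        (fun n => (hm (d n)).stronglyMeasurable_mk.indicator hS_meas)
        (tendsto_pi_nhds.2 fun s => ?_)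
      by_cases hs : s ∈ S
      · simp only [hs, indicator_of_mem]
        exact (((hSg s hs).1.tendsto p).comp hlim).congr fun n => (hSg s hs).2 (d n) (hd n)
      · simp [hs]
  · filter_upwards [hS] with s hs p
    simp [hs]

theorem aestronglyMeasurable_comp_caratheodory (hc : ∀ᵐ s ∂lam, Continuous (g s))
    (hm : ∀ p, AEStronglyMeasurable (fun s => g s p) lam) {x : ℝ → P} (hx : AEMeasurable x lam) :
    AEStronglyMeasurable (fun s => g s (x s)) lam := by
  obtain ⟨g', hg', heq⟩ := exists_stronglyMeasurable_uncurry hc hm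
  refine ⟨fun s => g' s (hx.mk x s),
    hg'.comp_measurable (measurable_id.prodMk hx.measurable_mk), ?_⟩
  filter_upwards [heq, hx.ae_eq_mk] with s hs hxs
  rw [hs, ← hxs]

theorem aestronglyMeasurable_uncurry_comp_caratheodory (hc : ∀ᵐ s ∂lam, Continuous (g s))
    (hm : ∀ p, AEStronglyMeasurable (fun s => g s p) lam) {Y : Type*} [MeasurableSpace Y]
    (κ : Measure Y) [SFinite κ] {x : ℝ → Y → P} (hx : Measurable (Function.uncurry x)) :
    AEStronglyMeasurable (fun z : ℝ × Y => g z.1 (x z.1 z.2)) (lam.prod κ) := by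
  obtain ⟨g', hg', heq⟩ := exists_stronglyMeasurable_uncurry hc hm
  refine ⟨fun z => g' z.1 (x z.1 z.2), hg'.comp_measurable (measurable_fst.prodMk hx), ?_⟩
  filter_upwards [Measure.quasiMeasurePreserving_fst.ae heq] with z hz
  rw [hz]

end Caratheodory

section Volterra

theorem intervalIntegrable_of_integrableOn_Icc {F : Type*} [NormedAddCommGroup F] {f : ℝ → F}
    {a b s t : ℝ} (hf : IntegrableOn f (Icc a b)) (hs : s ∈ Icc a b) (ht : t ∈ Icc a b) :
    IntervalIntegrable f volume s t :=
  intervalIntegrable_iff.2 (hf.mono_set (uIoc_subset_uIcc.trans (uIcc_subset_Icc hs ht)))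

theorem norm_intervalIntegral_le_of_ae_le {F : Type*} [NormedAddCommGroup F] [NormedSpace ℝ F]
    {f : ℝ → F} {m : ℝ → ℝ} {a b s t : ℝ} (hs : a ≤ s) (hst : s ≤ t) (ht : t ≤ b)
    (hf : ∀ᵐ r ∂volume.restrict (Icc a b), ‖f r‖ ≤ m r) (hm : IntegrableOn m (Icc a b)) :
    ‖∫ r in s..t, f r‖ ≤ ∫ r in s..t, m r := by
  refine intervalIntegral.norm_integral_le_of_norm_le hst ?_
    (intervalIntegrable_of_integrableOn_Icc hm ⟨hs, hst.trans ht⟩ ⟨hs.trans hst, ht⟩)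
  filter_upwards [(ae_restrict_iff' measurableSet_Icc).1 hf] with r hr hr'
  exact hr ⟨hs.trans hr'.1.le, hr'.2.trans ht⟩

variable {a b : ℝ} {m : ℝ → ℝ}

/-- The weight `exp (2 ∫ m)` makes each application of the Volterra operator gain a factor
`1 / 2`. -/
theorem dist_iterate_le_of_dist_le_integral {B : Type*} [PseudoMetricSpace B] (hab : a ≤ b)
    (hm : Integrable m) (hm0 : ∀ t, 0 ≤ m t) {Φ : C(Icc a b, B) → C(Icc a b, B)}
    (hΦ : ∀ Y Y' t, dist (Φ Y t) (Φ Y' t) ≤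
      ∫ s in a..t, m s * dist (IccExtend hab Y s) (IccExtend hab Y' s))
    (Y Y' : C(Icc a b, B)) (n : ℕ) (t : Icc a b) :
    dist (Φ^[n] Y t) (Φ^[n] Y' t) ≤
      (1 / 2) ^ n * Real.exp (2 * ∫ s in a..t, m s) * dist Y Y' := by
  induction n generalizing t with
  | zero =>
    rw [pow_zero, one_mul]
    refine (ContinuousMap.dist_apply_le_dist t).trans (le_mul_of_one_le_left dist_nonneg ?_)
    exact Real.one_le_exp (mul_nonneg zero_le_two (primitive_nonneg hm0 t.2.1))
  | succ n ih =>
    rw [Function.iterate_succ_apply', Function.iterate_succ_apply']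
    set e : ℝ → ℝ := fun s => Real.exp (2 * ∫ r in a..s, m r)
    have he : Continuous e := Real.continuous_exp.comp (continuous_const.mul
      (intervalIntegral.continuous_primitive (fun _ _ => hm.intervalIntegrable) a))
    have hdist : Continuous fun s =>
        dist (IccExtend hab (Φ^[n] Y) s) (IccExtend hab (Φ^[n] Y') s) :=
      (Φ^[n] Y).continuous.Icc_extend'.dist (Φ^[n] Y').continuous.Icc_extend'
    calc dist (Φ (Φ^[n] Y) t) (Φ (Φ^[n] Y') t)
        ≤ ∫ s in a..t, m s * dist (IccExtend hab (Φ^[n] Y) s) (IccExtend hab (Φ^[n] Y') s) :=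
          hΦ _ _ t
      _ ≤ ∫ s in a..t, (1 / 2) ^ (n + 1) * dist Y Y' * (e s * (2 * m s)) := by
          refine intervalIntegral.integral_mono_on t.2.1
            (hm.intervalIntegrable.mul_continuousOn hdist.continuousOn)
            (((hm.const_mul 2).intervalIntegrable.continuousOn_mul he.continuousOn).const_mul _)
            fun s hs => ?_
          have hs' : s ∈ Icc a b := ⟨hs.1, hs.2.trans t.2.2⟩
          rw [IccExtend_of_mem hab _ hs', IccExtend_of_mem hab _ hs']
          calc m s * dist (Φ^[n] Y ⟨s, hs'⟩) (Φ^[n] Y' ⟨s, hs'⟩)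
              ≤ m s * ((1 / 2) ^ n * e s * dist Y Y') := by
                gcongr
                exacts [hm0 s, ih ⟨s, hs'⟩]
            _ = (1 / 2) ^ (n + 1) * dist Y Y' * (e s * (2 * m s)) := by ring
      _ = (1 / 2) ^ (n + 1) * dist Y Y' * (e t - 1) := by
          rw [intervalIntegral.integral_const_mul, integral_mul_exp_primitive hm t.2.1]
      _ ≤ (1 / 2) ^ (n + 1) * e t * dist Y Y' := by
          rw [mul_right_comm]
          gcongr
          exact sub_le_self _ zero_le_one

theorem exists_isFixedPt_of_dist_le_integral {B : Type*} [MetricSpace B] [CompleteSpace B]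
    [Nonempty B] (hab : a ≤ b) (hm : Integrable m) (hm0 : ∀ t, 0 ≤ m t)
    {Φ : C(Icc a b, B) → C(Icc a b, B)}
    (hΦ : ∀ Y Y' t, dist (Φ Y t) (Φ Y' t) ≤
      ∫ s in a..t, m s * dist (IccExtend hab Y s) (IccExtend hab Y' s)) :
    ∃ Y, Function.IsFixedPt Φ Y := by
  set e := Real.exp (2 * ∫ s in a..b, m s) with he
  have hlim : Tendsto (fun n : ℕ => (1 / 2 : ℝ) ^ n * e) atTop (𝓝 0) := by
    simpa using (tendsto_pow_atTop_nhds_zero_of_lt_one (r := (1 / 2 : ℝ)) (by norm_num)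
      (by norm_num)).mul_const e
  obtain ⟨n, hn⟩ := (hlim.eventually_lt_const (u := 1 / 2) (by norm_num)).exists
  have hcontr : ContractingWith (1 / 2) Φ^[n] := by
    refine ⟨by norm_num [← NNReal.coe_lt_coe], LipschitzWith.of_dist_le_mul fun Y Y' => ?_⟩
    rw [ContinuousMap.dist_le (by positivity)]
    refine fun t => (dist_iterate_le_of_dist_le_integral hab hm hm0 hΦ Y Y' n t).trans ?_
    gcongr
    refine le_trans ?_ (hn.le.trans_eq (by norm_num))
    rw [he]
    gcongr
    exact primitive_mono hm hm0 t.2.2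
  have : Nonempty C(Icc a b, B) := ⟨ContinuousMap.const _ (Classical.arbitrary B)⟩
  exact ⟨_, hcontr.isFixedPt_fixedPoint_iterate⟩

end Volterra

section Caratheodory

variable {α F : Type*} [TopologicalSpace α] [NormedAddCommGroup F]
  {a b : ℝ} {m : ℝ → ℝ} {H : ℝ → (α →ᵇ F) → α → F}

/-- Carathéodory's conditions, with integrable rate `m`, on the right-hand side of the equation
`∂ₜ Y(t, x) = H(t, Y(t), x)` for a curve of bounded continuous functions `Y t`. The equation is read
pointwise in `x`, because `s ↦ H s (Y s)` is in general not strongly measurable as a map into the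
nonseparable space `α →ᵇ F`. -/
structure IsCaratheodoryField (a b : ℝ) (m : ℝ → ℝ) (H : ℝ → (α →ᵇ F) → α → F) : Prop where
  aestronglyMeasurable : ∀ Y : ℝ → (α →ᵇ F), Continuous Y → ∀ x,
    AEStronglyMeasurable (fun s => H s (Y s) x) (volume.restrict (Icc a b))
  continuous : ∀ᵐ s ∂volume.restrict (Icc a b), ∀ Y, Continuous (H s Y)
  norm_le : ∀ᵐ s ∂volume.restrict (Icc a b), ∀ Y x, ‖H s Y x‖ ≤ m s
  norm_sub_le : ∀ᵐ s ∂volume.restrict (Icc a b), ∀ Y Y' x,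
    ‖H s Y x - H s Y' x‖ ≤ m s * dist Y Y'

namespace IsCaratheodoryField

theorem integrableOn (hH : IsCaratheodoryField a b m H) (hm : Integrable m) {Y : ℝ → (α →ᵇ F)}
    (hY : Continuous Y) (x : α) : IntegrableOn (fun s => H s (Y s) x) (Icc a b) :=
  Integrable.mono' hm.integrableOn (hH.aestronglyMeasurable Y hY x)
    (hH.norm_le.mono fun s hs => hs (Y s) x)

variable [NormedSpace ℝ F]

theorem norm_integral_le (hH : IsCaratheodoryField a b m H) (hm : Integrable m)
    (Y : ℝ → (α →ᵇ F)) (x : α) {s t : ℝ} (hs : a ≤ s) (hst : s ≤ t) (ht : t ≤ b) :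
    ‖∫ r in s..t, H r (Y r) x‖ ≤ ∫ r in s..t, m r :=
  norm_intervalIntegral_le_of_ae_le hs hst ht (hH.norm_le.mono fun r hr => hr (Y r) x)
    hm.integrableOn

theorem continuous_integral [FirstCountableTopology α] (hH : IsCaratheodoryField a b m H)
    (hm : Integrable m) {Y : ℝ → (α →ᵇ F)} (hY : Continuous Y) {t : ℝ} (ht : t ∈ Icc a b) :
    Continuous fun x => ∫ s in a..t, H s (Y s) x := by
  have hsub : uIoc a t ⊆ Icc a b := by
    rw [uIoc_of_le ht.1]
    exact Ioc_subset_Icc_self.trans (Icc_subset_Icc_right ht.2)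
  refine intervalIntegral.continuous_of_dominated_interval (bound := m) (fun x => ?_)
    (fun x => ?_) hm.intervalIntegrable ?_
  · exact (hH.aestronglyMeasurable Y hY x).mono_measure (Measure.restrict_mono hsub le_rfl)
  · filter_upwards [(ae_restrict_iff' measurableSet_Icc).1 hH.norm_le] with s hs hs'
    exact hs (hsub hs') (Y s) x
  · filter_upwards [(ae_restrict_iff' measurableSet_Icc).1 hH.continuous] with s hs hs'
    exact hs (hsub hs') (Y s)

theorem dist_integral_le (hH : IsCaratheodoryField a b m H) (hm : Integrable m)
    {Y : ℝ → (α →ᵇ F)} (hY : Continuous Y) (x : α) {s t : ℝ} (hs : s ∈ Icc a b)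
    (ht : t ∈ Icc a b) :
    dist (∫ r in a..s, H r (Y r) x) (∫ r in a..t, H r (Y r) x) ≤
      dist (∫ r in a..s, m r) (∫ r in a..t, m r) := by
  wlog hst : s ≤ t generalizing s t
  · rw [dist_comm, dist_comm (∫ r in a..s, m r)]
    exact this ht hs (le_of_not_ge hst)
  have hint : ∀ r ∈ Icc a b, IntervalIntegrable (fun s => H s (Y s) x) volume a r := fun r hr =>
    intervalIntegrable_of_integrableOn_Icc (hH.integrableOn hm hY x)
      (left_mem_Icc.2 (hr.1.trans hr.2)) hr
  rw [dist_comm, dist_comm (∫ r in a..s, m r), dist_eq_norm, dist_eq_norm,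
    intervalIntegral.integral_interval_sub_left (hint t ht) (hint s hs),
    integral_primitive_sub hm]
  exact (hH.norm_integral_le hm Y x hs.1 hst ht.2).trans (Real.le_norm_self _)

theorem exists_picard_map [FirstCountableTopology α] (hH : IsCaratheodoryField a b m H)
    (hab : a ≤ b) (hm : Integrable m) (hm0 : ∀ t, 0 ≤ m t) (X₀ : α →ᵇ F)
    (Y : C(Icc a b, α →ᵇ F)) : ∃ Z : C(Icc a b, α →ᵇ F),
      ∀ (t : Icc a b) x, Z t x = X₀ x + ∫ s in a..t, H s (IccExtend hab Y s) x := by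
  have hY : Continuous (IccExtend hab Y) := Y.continuous.Icc_extend'
  let Z : Icc a b → (α →ᵇ F) := fun t => BoundedContinuousFunction.ofNormedAddCommGroup
    (fun x => X₀ x + ∫ s in a..t, H s (IccExtend hab Y s) x)
    (X₀.continuous.add (hH.continuous_integral hm hY t.2)) (‖X₀‖ + ∫ s in a..b, m s)
    fun x => (norm_add_le _ _).trans (add_le_add (X₀.norm_coe_le_norm x)
      ((hH.norm_integral_le hm _ x le_rfl t.2.1 t.2.2).trans (primitive_mono hm hm0 t.2.2)))
  refine ⟨⟨Z, continuous_iff_continuousAt.2 fun t => ?_⟩, fun t x => rfl⟩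
  have hM : Continuous fun s : Icc a b => ∫ r in a..s, m r :=
    (intervalIntegral.continuous_primitive (fun _ _ => hm.intervalIntegrable) a).comp
      continuous_subtype_val
  refine tendsto_iff_dist_tendsto_zero.2 (squeeze_zero (fun _ => dist_nonneg) (fun s => ?_)
    (tendsto_iff_dist_tendsto_zero.1 (hM.tendsto t)))
  refine (BoundedContinuousFunction.dist_le dist_nonneg).2 fun x => ?_
  simpa only [Z, BoundedContinuousFunction.coe_ofNormedAddCommGroup, dist_add_left] using
    hH.dist_integral_le hm hY x s.2 t.2

theorem exists_integral_curve [FirstCountableTopology α] [CompleteSpace F]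
    (hH : IsCaratheodoryField a b m H) (hab : a ≤ b) (hm : Integrable m) (hm0 : ∀ t, 0 ≤ m t)
    (X₀ : α →ᵇ F) : ∃ Y : ℝ → (α →ᵇ F), Continuous Y ∧
      ∀ t ∈ Icc a b, ∀ x, Y t x = X₀ x + ∫ s in a..t, H s (Y s) x := by
  choose Φ hΦ using hH.exists_picard_map hab hm hm0 X₀
  have hΦ_dist : ∀ Y Y' t, dist (Φ Y t) (Φ Y' t) ≤
      ∫ s in a..t, m s * dist (IccExtend hab Y s) (IccExtend hab Y' s) := by
    intro Y Y' t
    have hY : Continuous (IccExtend hab Y) := Y.continuous.Icc_extend'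
    have hY' : Continuous (IccExtend hab Y') := Y'.continuous.Icc_extend'
    have ha := left_mem_Icc.2 hab
    refine (BoundedContinuousFunction.dist_le
      (intervalIntegral.integral_nonneg t.2.1 fun s _ => mul_nonneg (hm0 s) dist_nonneg)).2
      fun x => ?_
    rw [hΦ, hΦ, dist_add_left, dist_eq_norm, ← intervalIntegral.integral_sub
      (intervalIntegrable_of_integrableOn_Icc (hH.integrableOn hm hY x) ha t.2)
      (intervalIntegrable_of_integrableOn_Icc (hH.integrableOn hm hY' x) ha t.2)]
    exact norm_intervalIntegral_le_of_ae_le le_rfl t.2.1 t.2.2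
      (hH.norm_sub_le.mono fun s hs => hs _ _ x)
      (hm.integrableOn.mul_continuousOn (hY.dist hY').continuousOn isCompact_Icc)
  obtain ⟨Y, hY⟩ := exists_isFixedPt_of_dist_le_integral hab hm hm0 hΦ_dist
  refine ⟨IccExtend hab Y, Y.continuous.Icc_extend', fun t ht x => ?_⟩
  rw [← hΦ Y ⟨t, ht⟩ x, hY, IccExtend_of_mem hab Y ht]

end IsCaratheodoryField

theorem one_add_norm_le_mul_exp [NormedSpace ℝ F] {Y : ℝ → (α →ᵇ F)} (hY : Continuous Y)
    (hm : Integrable m) (hm0 : ∀ t, 0 ≤ m t) {f : ℝ → α → F}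
    (hYf : ∀ t ∈ Icc a b, ∀ x, Y t x = Y a x + ∫ s in a..t, f s x)
    (hf : ∀ᵐ s ∂volume.restrict (Icc a b), ∀ x, ‖f s x‖ ≤ m s * (1 + ‖Y s‖)) {t : ℝ}
    (ht : t ∈ Icc a b) : 1 + ‖Y t‖ ≤ (1 + ‖Y a‖) * Real.exp (∫ s in a..t, m s) := by
  have hcont : Continuous fun s => 1 + ‖Y s‖ := by fun_prop
  refine le_mul_exp_of_le_add_integral hm hm0 ht.1 hcont.continuousOn fun s hs => ?_
  have hint : Integrable (fun r => m r * (1 + ‖Y r‖)) (volume.restrict (Icc a b)) :=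
      hm.integrableOn.mul_continuousOn hcont.continuousOn isCompact_Icc
  have hnonneg : 0 ≤ ∫ r in a..s, m r * (1 + ‖Y r‖) :=
    intervalIntegral.integral_nonneg hs.1 fun r _ => mul_nonneg (hm0 r) (by positivity)
  rw [add_assoc, add_le_add_iff_left, BoundedContinuousFunction.norm_le (by positivity)]
  intro x
  rw [hYf s ⟨hs.1, hs.2.trans ht.2⟩ x]
  exact (norm_add_le _ _).trans (add_le_add ((Y a).norm_coe_le_norm x)
    (norm_intervalIntegral_le_of_ae_le le_rfl hs.1 (hs.2.trans ht.2)
      (hf.mono fun r hr => hr x) hint))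

end Caratheodory

section TestFunctions

variable {X : Type*} [NormedAddCommGroup X] [NormedSpace ℝ X]

/-- A smooth compactly supported function whose first and second derivatives are bounded by `A` and
`B`; the second bound is expressed as a Lipschitz constant of the first derivative. -/
structure IsTestFunction (A B : ℝ≥0) (f : X → ℝ) : Prop where
  contDiff : ContDiff ℝ ∞ f
  hasCompactSupport : HasCompactSupport f
  lipschitzWith : LipschitzWith A f
  lipschitzWith_fderiv : LipschitzWith B (fderiv ℝ f)

theorem exists_isTestFunction {f : X → ℝ} (hf : ContDiff ℝ ∞ f) (hc : HasCompactSupport f) :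
    ∃ A B, IsTestFunction A B f := by
  obtain ⟨A, hA⟩ := ContDiff.lipschitzWith_of_hasCompactSupport hc hf (by simp)
  have hf' : ContDiff ℝ 1 (fderiv ℝ f) := (contDiff_infty.1 hf 2).fderiv_right (by norm_num)
  obtain ⟨B, hB⟩ := ContDiff.lipschitzWith_of_hasCompactSupport (hc.fderiv ℝ) hf' one_ne_zero
  exact ⟨A, B, hf, hc, hA, hB⟩

namespace IsTestFunction

variable {A B : ℝ≥0} {f : X → ℝ}

theorem norm_fderiv_le (hf : IsTestFunction A B f) (x : X) : ‖fderiv ℝ f x‖ ≤ A :=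
  norm_fderiv_le_of_lipschitz ℝ hf.lipschitzWith

theorem continuous_fderiv (hf : IsTestFunction A B f) : Continuous (fderiv ℝ f) :=
  hf.lipschitzWith_fderiv.continuous

theorem hasFDerivAt (hf : IsTestFunction A B f) (x : X) : HasFDerivAt f (fderiv ℝ f x) x :=
  (hf.contDiff.differentiable (by simp) x).hasFDerivAt

theorem norm_fderiv_apply_le (hf : IsTestFunction A B f) (x y : X) :
    ‖fderiv ℝ f x y‖ ≤ A * ‖y‖ :=
  ContinuousLinearMap.le_of_opNorm_le _ (hf.norm_fderiv_le x) y

end IsTestFunction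

end TestFunctions

section Flow

theorem intervalIntegral_integral_swap {Y F : Type*} [MeasurableSpace Y] [NormedAddCommGroup F]
    [NormedSpace ℝ F] {κ : Measure Y} [SFinite κ] {k : ℝ → Y → F} {a b s t : ℝ} (hs : a ≤ s)
    (hst : s ≤ t) (ht : t ≤ b)
    (hk : Integrable (Function.uncurry k) ((volume.restrict (Icc a b)).prod κ)) :
    (∫ r in s..t, (∫ y, k r y ∂κ)) = ∫ y, (∫ r in s..t, k r y) ∂κ := by
  have hsub : Ioc s t ⊆ Icc a b := Ioc_subset_Icc_self.trans (Icc_subset_Icc hs ht)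
  simp only [intervalIntegral.integral_of_le hst]
  exact integral_integral_swap (hk.mono_measure
    (Measure.prod_mono (Measure.restrict_mono hsub le_rfl) le_rfl))

theorem Pc.integral_map {X Y F : Type*} [TopologicalSpace X] [HereditarilyLindelofSpace X]
    [MeasurableSpace X] [OpensMeasurableSpace X] [TopologicalSpace Y] [T2Space Y]
    [MeasurableSpace Y] [BorelSpace Y] [TopologicalSpace.PseudoMetrizableSpace Y]
    [NormedAddCommGroup F] [NormedSpace ℝ F] [SecondCountableTopology F] (μ : Pc X) {f : X → Y}
    (hf : Continuous f) {g : Y → F} (hg : Continuous g) :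
    ∫ y, g y ∂(μ.map f hf).toMeasure = ∫ x, g (f x) ∂μ.toMeasure :=
  MeasureTheory.integral_map hf.measurable.aemeasurable hg.aestronglyMeasurable

variable {X : Type*} [NormedAddCommGroup X]

/-- A vector field that is measurable in time, bounded and Lipschitz in space with rate `m`. -/
structure IsLipschitzField (a b : ℝ) (m : ℝ → ℝ) (w : ℝ → X → X) : Prop where
  aestronglyMeasurable : ∀ x, AEStronglyMeasurable (fun t => w t x) (volume.restrict (Icc a b))
  norm_le : ∀ᵐ t ∂volume.restrict (Icc a b), ∀ x, ‖w t x‖ ≤ m t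
  norm_sub_le : ∀ᵐ t ∂volume.restrict (Icc a b), ∀ x y, ‖w t x - w t y‖ ≤ m t * ‖x - y‖

/-- `Y` is the flow of `w` on `[a, b]`, in integrated form. -/
structure IsFlow [NormedSpace ℝ X] (a b : ℝ) (w : ℝ → X → X) (Y : ℝ → (X →ᵇ X)) : Prop where
  continuous : Continuous Y
  eq_add_integral : ∀ t ∈ Icc a b, ∀ x, Y t x = Y a x + ∫ s in a..t, w s (Y s x)

variable {a b : ℝ} {m : ℝ → ℝ} {w : ℝ → X → X}

namespace IsLipschitzField

theorem ae_lipschitzWith (hw : IsLipschitzField a b m w) :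
    ∀ᵐ t ∂volume.restrict (Icc a b), LipschitzWith (m t).toNNReal (w t) :=
  hw.norm_sub_le.mono fun _ ht =>
    LipschitzWith.of_dist_le' fun x y => by simpa only [dist_eq_norm] using ht x y

theorem ae_continuous (hw : IsLipschitzField a b m w) :
    ∀ᵐ t ∂volume.restrict (Icc a b), Continuous (w t) :=
  hw.ae_lipschitzWith.mono fun _ ht => ht.continuous

theorem integrableOn (hw : IsLipschitzField a b m w) (hm : Integrable m) (x : X) :
    IntegrableOn (fun t => w t x) (Icc a b) :=
  Integrable.mono' hm.integrableOn (hw.aestronglyMeasurable x) (hw.norm_le.mono fun _ ht => ht x)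

variable [NormedSpace ℝ X] [FiniteDimensional ℝ X]

theorem exists_isFlow (hw : IsLipschitzField a b m w) (hab : a ≤ b) (hm : Integrable m)
    (hm0 : ∀ t, 0 ≤ m t) (X₀ : X →ᵇ X) : ∃ Y, IsFlow a b w Y ∧ Y a = X₀ := by
  borelize X
  have hH : IsCaratheodoryField a b m fun t (Y : X →ᵇ X) x => w t (Y x) :=
    { aestronglyMeasurable := fun Y hY x => aestronglyMeasurable_comp_caratheodory
        hw.ae_continuous hw.aestronglyMeasurable ((continuous_eval_const x).comp hY).aemeasurable
      continuous := hw.ae_continuous.mono fun _ ht Y => ht.comp Y.continuous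
      norm_le := hw.norm_le.mono fun _ ht Y x => ht (Y x)
      norm_sub_le := hw.norm_sub_le.mono fun t ht Y Y' x => (ht (Y x) (Y' x)).trans <| by
        rw [← dist_eq_norm]
        exact mul_le_mul_of_nonneg_left (BoundedContinuousFunction.dist_coe_le_dist x) (hm0 t) }
  obtain ⟨Y, hY, hY_eq⟩ := hH.exists_integral_curve hab hm hm0 X₀
  have hYa : Y a = X₀ := by
    ext1 x
    simpa using hY_eq a (left_mem_Icc.2 hab) x
  exact ⟨Y, ⟨hY, fun t ht x => by rw [hYa, hY_eq t ht x]⟩, hYa⟩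

variable [MeasurableSpace X] [BorelSpace X]

theorem integrable_fderiv_comp (hw : IsLipschitzField a b m w) (hm : Integrable m) {A B : ℝ≥0}
    {ψ : X → ℝ} (hψ : IsTestFunction A B ψ) {Y : Type*} [MeasurableSpace Y] (κ : Measure Y)
    [IsFiniteMeasure κ] {x : ℝ → Y → X} (hx : Measurable (Function.uncurry x)) :
    Integrable (Function.uncurry fun t y => fderiv ℝ ψ (x t y) (w t (x t y)))
      ((volume.restrict (Icc a b)).prod κ) := by
  refine Integrable.mono' (((hm.integrableOn (s := Icc a b)).const_mul (A : ℝ)).comp_fst κ) ?_ ?_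
  · exact aestronglyMeasurable_uncurry_comp_caratheodory (g := fun t y => fderiv ℝ ψ y (w t y))
      (hw.ae_continuous.mono fun t ht => hψ.continuous_fderiv.clm_apply ht)
      (fun y => (fderiv ℝ ψ y).continuous.comp_aestronglyMeasurable (hw.aestronglyMeasurable y))
      κ hx
  · filter_upwards [Measure.quasiMeasurePreserving_fst.ae hw.norm_le] with z hz
    exact (hψ.norm_fderiv_apply_le _ _).trans (by gcongr; exact hz _)

end IsLipschitzField

namespace IsFlow

variable [NormedSpace ℝ X] {Y : ℝ → (X →ᵇ X)}

theorem continuous_apply (hY : IsFlow a b w Y) (x : X) : Continuous fun t => Y t x :=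
  (continuous_eval_const x).comp hY.continuous

theorem continuous_uncurry (hY : IsFlow a b w Y) : Continuous fun z : ℝ × X => Y z.1 z.2 :=
  continuous_eval.comp (hY.continuous.prodMap continuous_id)

variable [FiniteDimensional ℝ X]

theorem integrableOn (hY : IsFlow a b w Y) (hm : Integrable m) (hw : IsLipschitzField a b m w)
    (x : X) : IntegrableOn (fun s => w s (Y s x)) (Icc a b) := by
  borelize X
  exact Integrable.mono' hm.integrableOn (aestronglyMeasurable_comp_caratheodory
    hw.ae_continuous hw.aestronglyMeasurable (hY.continuous_apply x).aemeasurable)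
    (hw.norm_le.mono fun _ hs => hs _)

theorem sub_eq_integral (hY : IsFlow a b w Y) (hm : Integrable m) (hw : IsLipschitzField a b m w)
    (x : X) {s t : ℝ} (hs : s ∈ Icc a b) (ht : t ∈ Icc a b) :
    Y t x - Y s x = ∫ r in s..t, w r (Y r x) := by
  have hint : ∀ r ∈ Icc a b, IntervalIntegrable (fun s => w s (Y s x)) volume a r := fun r hr =>
    intervalIntegrable_of_integrableOn_Icc (hY.integrableOn hm hw x)
      (left_mem_Icc.2 (hr.1.trans hr.2)) hr
  rw [hY.eq_add_integral t ht, hY.eq_add_integral s hs, add_sub_add_left_eq_sub,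
    intervalIntegral.integral_interval_sub_left (hint t ht) (hint s hs)]

theorem norm_sub_le (hY : IsFlow a b w Y) (hm : Integrable m) (hw : IsLipschitzField a b m w)
    (x : X) {s t : ℝ} (hs : a ≤ s) (hst : s ≤ t) (ht : t ≤ b) :
    ‖Y t x - Y s x‖ ≤ ∫ r in s..t, m r := by
  rw [hY.sub_eq_integral hm hw x ⟨hs, hst.trans ht⟩ ⟨hs.trans hst, ht⟩]
  exact norm_intervalIntegral_le_of_ae_le hs hst ht (hw.norm_le.mono fun s hs => hs _)
    hm.integrableOn

theorem ae_hasDerivAt (hY : IsFlow a b w Y) (hab : a ≤ b) (hm : Integrable m)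
    (hw : IsLipschitzField a b m w) (x : X) :
    ∀ᵐ t ∂volume.restrict (Icc a b), HasDerivAt (fun t => Y t x) (w t (Y t x)) t := by
  rw [← restrict_Ioo_eq_restrict_Icc]
  filter_upwards [ae_restrict_of_ae_restrict_of_subset Ioo_subset_Icc_self
    (ae_hasDerivAt_primitive hab (hY.integrableOn hm hw x)), ae_restrict_mem measurableSet_Ioo]
    with t ht hmem
  refine (ht.const_add (Y a x)).congr_of_eventuallyEq ?_
  filter_upwards [Icc_mem_nhds hmem.1 hmem.2] with s hs using hY.eq_add_integral s hs x

theorem comp_sub_eq_integral (hY : IsFlow a b w Y) (hm : Integrable m)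
    (hw : IsLipschitzField a b m w) {A B : ℝ≥0} {ψ : X → ℝ} (hψ : IsTestFunction A B ψ) {t : ℝ}
    (ht : t ∈ Icc a b) (x : X) :
    ψ (Y t x) - ψ (Y a x) = ∫ s in a..t, fderiv ℝ ψ (Y s x) (w s (Y s x)) := by
  refine (integral_eq_sub_of_ae_hasDerivAt (f := fun s => ψ (Y s x)) ht.1
    (absolutelyContinuousOnInterval_of_norm_sub_le_integral ht.1
      (hm.intervalIntegrable.const_mul A) fun s s' hs hss' hs' => ?_) ?_).symm
  · rw [intervalIntegral.integral_const_mul]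
    exact (hψ.lipschitzWith.norm_sub_le _ _).trans
      (by gcongr; exact hY.norm_sub_le hm hw x hs hss' (hs'.trans ht.2))
  · filter_upwards [ae_restrict_of_ae_restrict_of_subset (Icc_subset_Icc_right ht.2)
      (hY.ae_hasDerivAt (ht.1.trans ht.2) hm hw x)] with s hs
    exact (hψ.hasFDerivAt (Y s x)).comp_hasDerivAt s hs

variable [MeasurableSpace X] [BorelSpace X]

theorem tendsto_wass_map (hY : Continuous Y) (ρ : Pc X) (t : ℝ) :
    Tendsto (fun s => wass 1 (ρ.map (Y s) (Y s).continuous) (ρ.map (Y t) (Y t).continuous))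
      (𝓝 t) (𝓝 0) := by
  refine squeeze_zero (fun _ => wass_nonneg _ _ _) (fun s => ?_)
    (tendsto_iff_dist_tendsto_zero.1 (hY.tendsto t))
  refine (wass_one_map_le ρ (Y s).continuous (Y t).continuous).trans ?_
  refine (integral_mono (ρ.integrable_of_continuous ((Y s).continuous.dist (Y t).continuous))
    (integrable_const _) fun x => BoundedContinuousFunction.dist_coe_le_dist x).trans ?_
  simp

theorem solvesCE (hY : IsFlow a b w Y) (hm : Integrable m) (hw : IsLipschitzField a b m w)
    (ρ : Pc X) : SolvesCE a b w (fun t => ρ.map (Y t) (Y t).continuous) := by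
  refine ⟨fun t _ => (tendsto_wass_map hY.continuous ρ t).mono_left nhdsWithin_le_nhds, ?_,
    fun ψ hψ hc => ?_⟩
  · filter_upwards [hw.ae_continuous] with t ht
    exact Pc.integrable_of_continuous _ ht
  obtain ⟨A, B, hψ⟩ := exists_isTestFunction hψ hc
  have hk := hw.integrable_fderiv_comp hm hψ ρ.toMeasure (x := fun s x => Y s x)
    hY.continuous_uncurry.measurable
  have hk_map : ∀ᵐ s ∂volume.restrict (Icc a b),
      ∫ x, fderiv ℝ ψ (Y s x) (w s (Y s x)) ∂ρ.toMeasure =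
        ∫ x, fderiv ℝ ψ x (w s x) ∂(ρ.map (Y s) (Y s).continuous).toMeasure := by
    filter_upwards [hw.ae_continuous] with s hs
    rw [ρ.integral_map (Y s).continuous (hψ.continuous_fderiv.clm_apply hs)]
  refine ⟨hk.integral_prod_left.congr hk_map, fun t ht => ?_⟩
  have hψY : ∀ s, Integrable (fun x => ψ (Y s x)) ρ.toMeasure := fun s =>
    ρ.integrable_of_continuous (hψ.contDiff.continuous.comp (Y s).continuous)
  rw [ρ.integral_map _ hψ.contDiff.continuous, ρ.integral_map _ hψ.contDiff.continuous,
    ← sub_eq_iff_eq_add', ← integral_sub (hψY t) (hψY a)]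
  simp only [hY.comp_sub_eq_integral hm hw hψ ht]
  rw [← intervalIntegral_integral_swap le_rfl ht.1 ht.2 hk]
  refine intervalIntegral.integral_congr_ae_restrict ?_
  rw [uIoc_of_le ht.1]
  exact ae_restrict_of_ae_restrict_of_subset
    (Ioc_subset_Icc_self.trans (Icc_subset_Icc_right ht.2)) hk_map

end IsFlow

end Flow

section EulerScheme

variable {X : Type*} [NormedAddCommGroup X] [NormedSpace ℝ X]

theorem exists_contDiff_dist_le_of_hasCompactSupport [FiniteDimensional ℝ X] {g : X → ℝ}
    (hg : Continuous g) (hc : HasCompactSupport g) {ε : ℝ} (hε : 0 < ε) :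
    ∃ f : X → ℝ, ContDiff ℝ ∞ f ∧ HasCompactSupport f ∧ ∀ x, dist (f x) (g x) ≤ ε := by
  obtain ⟨R, hR⟩ := hc.isCompact.isBounded.subset_closedBall (0 : X)
  let χ : ContDiffBump (0 : X) := ⟨max R 1, max R 1 + 1, by positivity, by linarith⟩
  have hχg : ∀ x, χ x * g x = g x := fun x => by
    by_cases hx : x ∈ tsupport g
    · rw [χ.one_of_mem_closedBall (Metric.closedBall_subset_closedBall (le_max_left _ _) (hR hx)),
        one_mul]
    · rw [image_eq_zero_of_notMem_tsupport hx, mul_zero]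
  obtain ⟨k, hk, hkg⟩ := (hc.uniformContinuous_of_continuous hg).exists_contDiff_dist_le hε
  refine ⟨fun x => χ x * k x, χ.contDiff.mul hk, χ.hasCompactSupport.mul_right, fun x => ?_⟩
  rw [← hχg, dist_eq_norm, ← mul_sub, norm_mul, Real.norm_of_nonneg χ.nonneg, ← dist_eq_norm]
  exact (mul_le_of_le_one_left dist_nonneg χ.le_one).trans (hkg x).le

namespace IsTestFunction

variable {A B : ℝ≥0} {f : X → ℝ}

theorem abs_taylor_le (hf : IsTestFunction A B f) (x v : X) :
    |f (x + v) - f x - fderiv ℝ f x v| ≤ B * ‖v‖ ^ 2 := by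
  have hx : x ∈ Metric.closedBall x ‖v‖ := Metric.mem_closedBall_self (norm_nonneg v)
  have hxv : x + v ∈ Metric.closedBall x ‖v‖ := by simp
  have := (convex_closedBall x ‖v‖).norm_image_sub_le_of_norm_fderiv_le' (𝕜 := ℝ) (f := f)
    (φ := fderiv ℝ f x) (C := B * ‖v‖) (fun z _ => (hf.hasFDerivAt z).differentiableAt)
    (fun z hz => (hf.lipschitzWith_fderiv.norm_sub_le z x).trans ?_) hx hxv
  · simpa [pow_two, mul_assoc] using this
  · gcongr
    simpa [dist_eq_norm] using hz

theorem hasCompactSupport_fderiv_apply (hf : IsTestFunction A B f) (u : X → X) :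
    HasCompactSupport fun x => fderiv ℝ f x (u x) := by
  refine (hf.hasCompactSupport.fderiv ℝ).mono fun x hx hfx => hx ?_
  simp only [hfx, zero_apply]

theorem lipschitzWith_fderiv_apply (hf : IsTestFunction A B f) {c : ℝ≥0} {u : X → X}
    (hu : ∀ x, ‖u x‖ ≤ c) (hu' : LipschitzWith c u) :
    LipschitzWith ((A + B) * c) fun x => fderiv ℝ f x (u x) := by
  refine LipschitzWith.of_dist_le_mul fun x y => ?_
  calc dist (fderiv ℝ f x (u x)) (fderiv ℝ f y (u y))
      = ‖(fderiv ℝ f x - fderiv ℝ f y) (u x) + fderiv ℝ f y (u x - u y)‖ := by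
        rw [dist_eq_norm, sub_apply, map_sub, sub_add_sub_cancel]
    _ ≤ ‖fderiv ℝ f x - fderiv ℝ f y‖ * ‖u x‖ + A * ‖u x - u y‖ :=
        (norm_add_le _ _).trans
          (add_le_add (ContinuousLinearMap.le_opNorm _ _) (hf.norm_fderiv_apply_le _ _))
    _ ≤ (B * ‖x - y‖) * c + A * (c * ‖x - y‖) := by
        gcongr
        · exact hf.lipschitzWith_fderiv.norm_sub_le x y
        · exact hu x
        · exact hu'.norm_sub_le x y
    _ = ((A + B) * c : ℝ≥0) * dist x y := by
        rw [dist_eq_norm]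
        push_cast
        ring

theorem hasCompactSupport_comp_add [FiniteDimensional ℝ X] (hf : IsTestFunction A B f) {D : X → X}
    {K : ℝ} (hDK : ∀ x, ‖D x‖ ≤ K) : HasCompactSupport fun x => f (x + D x) := by
  obtain ⟨R, hR⟩ := hf.hasCompactSupport.isCompact.isBounded.subset_closedBall (0 : X)
  refine HasCompactSupport.intro (isCompact_closedBall (0 : X) (R + K)) fun x hx => ?_
  refine image_eq_zero_of_notMem_tsupport fun h => hx ?_
  have hxD := hR h
  rw [mem_closedBall_zero_iff] at hxD ⊢
  have hx_le := norm_sub_le (x + D x) (D x)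
  rw [add_sub_cancel_right] at hx_le
  exact hx_le.trans (add_le_add hxD (hDK x))

theorem comp_add [FiniteDimensional ℝ X] (hf : IsTestFunction A B f) {D : X → X} {δ c : ℝ≥0}
    {K : ℝ} (hD : ContDiff ℝ ∞ D) (hDK : ∀ x, ‖D x‖ ≤ K) (hDδ : LipschitzWith δ D)
    (hDc : LipschitzWith c (fderiv ℝ D)) :
    IsTestFunction (A * (1 + δ)) (B * (1 + δ) ^ 2 + A * c) fun x => f (x + D x) := by
  have hid : LipschitzWith (1 + δ) fun x => x + D x := LipschitzWith.id.add hDδ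
  have hderiv : ∀ x, fderiv ℝ (fun x => f (x + D x)) x =
      (fderiv ℝ f (x + D x)).comp (ContinuousLinearMap.id ℝ X + fderiv ℝ D x) := fun x =>
    ((hf.hasFDerivAt (x + D x)).comp x
      ((hasFDerivAt_id x).add ((hD.differentiable (by simp)) x).hasFDerivAt)).fderiv
  have hid_deriv : ∀ x, ‖ContinuousLinearMap.id ℝ X + fderiv ℝ D x‖ ≤ 1 + δ := fun x =>
    (norm_add_le _ _).trans (add_le_add ContinuousLinearMap.norm_id_le
      (norm_fderiv_le_of_lipschitz ℝ hDδ))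
  refine ⟨hf.contDiff.comp (contDiff_id.add hD), hf.hasCompactSupport_comp_add hDK,
    hf.lipschitzWith.comp hid, LipschitzWith.of_dist_le_mul fun x y => ?_⟩
  have hsplit : fderiv ℝ (fun x => f (x + D x)) x - fderiv ℝ (fun x => f (x + D x)) y =
      (fderiv ℝ f (x + D x) - fderiv ℝ f (y + D y)).comp
        (ContinuousLinearMap.id ℝ X + fderiv ℝ D x) +
      (fderiv ℝ f (y + D y)).comp (fderiv ℝ D x - fderiv ℝ D y) := by
    simp only [hderiv, ContinuousLinearMap.sub_comp, ContinuousLinearMap.comp_sub,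
      ContinuousLinearMap.comp_add]
    abel
  rw [dist_eq_norm, hsplit]
  calc _ ≤ ‖fderiv ℝ f (x + D x) - fderiv ℝ f (y + D y)‖ *
        ‖ContinuousLinearMap.id ℝ X + fderiv ℝ D x‖ +
        ‖fderiv ℝ f (y + D y)‖ * ‖fderiv ℝ D x - fderiv ℝ D y‖ :=
      (norm_add_le _ _).trans (add_le_add (ContinuousLinearMap.opNorm_comp_le _ _)
        (ContinuousLinearMap.opNorm_comp_le _ _))
    _ ≤ (B * (1 + δ) : ℝ≥0) * ‖x - y‖ * (1 + δ) + A * (c * ‖x - y‖) := by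
      gcongr
      · exact (hf.lipschitzWith_fderiv.comp hid).norm_sub_le x y
      · exact hid_deriv x
      · exact hf.norm_fderiv_le _
      · exact hDc.norm_sub_le x y
    _ = (B * (1 + δ) ^ 2 + A * c : ℝ≥0) * dist x y := by
      rw [dist_eq_norm]
      push_cast
      ring

end IsTestFunction

/-- The displacement produced by the field `w` over `[s, t]` when it is evaluated at the initial
point instead of along the flow. -/
noncomputable def displacement (w : ℝ → X → X) (s t : ℝ) (x : X) : X :=
  ∫ r in s..t, w r x

namespace IsLipschitzField

variable {a b s t : ℝ} {m : ℝ → ℝ} {w : ℝ → X → X} {δ : ℝ≥0}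

theorem norm_displacement_le (hw : IsLipschitzField a b m w) (hm : Integrable m) (hs : a ≤ s)
    (hst : s ≤ t) (ht : t ≤ b) (hδ : ∫ r in s..t, m r ≤ δ) (x : X) :
    ‖displacement w s t x‖ ≤ δ :=
  (norm_intervalIntegral_le_of_ae_le hs hst ht (hw.norm_le.mono fun _ hr => hr x)
    hm.integrableOn).trans hδ

theorem lipschitzWith_displacement (hw : IsLipschitzField a b m w) (hm : Integrable m) (hs : a ≤ s)
    (hst : s ≤ t) (ht : t ≤ b) (hδ : ∫ r in s..t, m r ≤ δ) :
    LipschitzWith δ (displacement w s t) := by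
  have hw_int : ∀ x, IntervalIntegrable (fun r => w r x) volume s t := fun x =>
    intervalIntegrable_of_integrableOn_Icc (hw.integrableOn hm x) ⟨hs, hst.trans ht⟩
      ⟨hs.trans hst, ht⟩
  refine LipschitzWith.of_dist_le_mul fun x y => ?_
  rw [dist_eq_norm, dist_eq_norm, displacement, displacement,
    ← intervalIntegral.integral_sub (hw_int x) (hw_int y)]
  refine (norm_intervalIntegral_le_of_ae_le hs hst ht (hw.norm_sub_le.mono fun r hr => hr x y)
    (hm.integrableOn.mul_const _)).trans ?_
  rw [intervalIntegral.integral_mul_const]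
  gcongr

variable [FiniteDimensional ℝ X] [MeasurableSpace X] [BorelSpace X]

theorem integral_fderiv_displacement (hw : IsLipschitzField a b m w) (hm : Integrable m)
    {A B : ℝ≥0} {f : X → ℝ} (hf : IsTestFunction A B f) (κ : Measure X) [IsFiniteMeasure κ]
    (hs : a ≤ s) (hst : s ≤ t) (ht : t ≤ b) :
    (∫ r in s..t, (∫ x, fderiv ℝ f x (w r x) ∂κ)) =
      ∫ x, fderiv ℝ f x (displacement w s t x) ∂κ := by
  rw [intervalIntegral_integral_swap hs hst ht
    (hw.integrable_fderiv_comp hm hf κ (x := fun _ x => x) measurable_snd)]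
  refine integral_congr_ae (Eventually.of_forall fun x => ?_)
  exact ContinuousLinearMap.intervalIntegral_comp_comm _
    (intervalIntegrable_of_integrableOn_Icc (hw.integrableOn hm x) ⟨hs, hst.trans ht⟩
      ⟨hs.trans hst, ht⟩)

end IsLipschitzField

end EulerScheme

section Uniqueness

variable {X : Type*} [NormedAddCommGroup X] [NormedSpace ℝ X] [MeasurableSpace X]
  {a b : ℝ} {m : ℝ → ℝ} {w : ℝ → X → X} {μ μ' : ℝ → Pc X}

namespace SolvesCE

theorem sub_eq_integral (h : SolvesCE a b w μ) {ψ : X → ℝ} (hψ : ContDiff ℝ ∞ ψ)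
    (hc : HasCompactSupport ψ) {s t : ℝ} (hs : s ∈ Icc a b) (ht : t ∈ Icc a b) :
    ∫ x, ψ x ∂(μ t).toMeasure - ∫ x, ψ x ∂(μ s).toMeasure =
      ∫ r in s..t, ∫ x, fderiv ℝ ψ x (w r x) ∂(μ r).toMeasure := by
  obtain ⟨hint, heq⟩ := h.2.2 ψ hψ hc
  have ha : a ∈ Icc a b := ⟨le_rfl, hs.1.trans hs.2⟩
  rw [heq t ht, heq s hs, add_sub_add_left_eq_sub]
  exact intervalIntegral.integral_interval_sub_left
    (intervalIntegrable_of_integrableOn_Icc hint ha ht)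
    (intervalIntegrable_of_integrableOn_Icc hint ha hs)

theorem mono (h : SolvesCE a b w μ) {c e : ℝ} (hce : Icc c e ⊆ Icc a b) :
    SolvesCE c e w μ := by
  refine ⟨fun t ht => (h.1 t (hce ht)).mono_left (nhdsWithin_mono _ hce),
    ae_restrict_of_ae_restrict_of_subset hce h.2.1, fun ψ hψ hc =>
      ⟨(h.2.2 ψ hψ hc).1.mono_set hce, fun t ht => ?_⟩⟩
  rw [← h.sub_eq_integral hψ hc (hce ⟨le_rfl, ht.1.trans ht.2⟩) (hce ht), add_sub_cancel]

theorem congr_field (h : SolvesCE a b w μ) {w' : ℝ → X → X}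
    (hw : ∀ᵐ t ∂volume.restrict (Icc a b), ∀ᵐ x ∂(μ t).toMeasure, w t x = w' t x) :
    SolvesCE a b w' μ := by
  have hψw : ∀ ψ : X → ℝ, ∀ᵐ t ∂volume.restrict (Icc a b),
      ∫ x, fderiv ℝ ψ x (w t x) ∂(μ t).toMeasure =
        ∫ x, fderiv ℝ ψ x (w' t x) ∂(μ t).toMeasure := fun ψ =>
    hw.mono fun t ht => integral_congr_ae (ht.mono fun x hx => congrArg (fderiv ℝ ψ x) hx)
  refine ⟨h.1, ?_, fun ψ hψ hc => ?_⟩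
  · filter_upwards [h.2.1, hw] with t hint ht using hint.congr ht
  · obtain ⟨hint, heq⟩ := h.2.2 ψ hψ hc
    refine ⟨hint.congr (hψw ψ), fun t ht => ?_⟩
    rw [heq t ht]
    congr 1
    refine intervalIntegral.integral_congr_ae_restrict ?_
    rw [uIoc_of_le ht.1]
    exact ae_restrict_of_ae_restrict_of_subset
      (Ioc_subset_Icc_self.trans (Icc_subset_Icc_right ht.2)) (hψw ψ)

theorem abs_sub_le_of_isTestFunction (h : SolvesCE a b w μ) (hm : Integrable m)
    (hw : IsLipschitzField a b m w) {A B : ℝ≥0} {f : X → ℝ} (hf : IsTestFunction A B f) {s t : ℝ}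
    (hs : a ≤ s) (hst : s ≤ t) (ht : t ≤ b) :
    |∫ x, f x ∂(μ t).toMeasure - ∫ x, f x ∂(μ s).toMeasure| ≤ A * ∫ r in s..t, m r := by
  rw [h.sub_eq_integral hf.contDiff hf.hasCompactSupport ⟨hs, hst.trans ht⟩ ⟨hs.trans hst, ht⟩,
    ← intervalIntegral.integral_const_mul, ← Real.norm_eq_abs]
  refine norm_intervalIntegral_le_of_ae_le hs hst ht ?_ (hm.integrableOn.const_mul _)
  filter_upwards [hw.norm_le] with r hr
  simpa using norm_integral_le_of_norm_le_const (μ := (μ r).toMeasure) (C := A * m r)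
    (Eventually.of_forall fun x => (hf.norm_fderiv_apply_le x (w r x)).trans
      (by gcongr; exact hr x))

variable [FiniteDimensional ℝ X] [BorelSpace X]

theorem abs_sub_le_of_lipschitzWith (h : SolvesCE a b w μ) (hm : Integrable m)
    (hw : IsLipschitzField a b m w) {A : ℝ≥0} {g : X → ℝ} (hc : HasCompactSupport g)
    (hg : LipschitzWith A g) {s t : ℝ} (hs : a ≤ s) (hst : s ≤ t) (ht : t ≤ b) :
    |∫ x, g x ∂(μ t).toMeasure - ∫ x, g x ∂(μ s).toMeasure| ≤ A * ∫ r in s..t, m r := by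
  have hr : ∀ r > 0, |∫ x, g x ∂(μ t).toMeasure - ∫ x, g x ∂(μ s).toMeasure| ≤
      A * (∫ r in s..t, m r) + 2 * A * r := fun r hr => by
    obtain ⟨C, hC⟩ := exists_mollification X ℝ hr
    obtain ⟨g', hg', hg'g, hlip, hlip', hc'⟩ := hC g A hg
    have hsmooth := abs_le.1
      (h.abs_sub_le_of_isTestFunction hm hw ⟨hg', hc' hc, hlip, hlip'⟩ hs hst ht)
    have ht := abs_le.1 ((μ t).abs_integral_sub_le hlip.continuous hg.continuous hg'g)
    have hs := abs_le.1 ((μ s).abs_integral_sub_le hlip.continuous hg.continuous hg'g)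
    exact abs_le.2 ⟨by linarith, by linarith⟩
  have hlim : Tendsto (fun r : ℝ => A * (∫ r in s..t, m r) + 2 * A * r) (𝓝[>] 0)
      (𝓝 (A * (∫ r in s..t, m r) + 2 * A * 0)) :=
    ((continuous_const.add (continuous_const.mul continuous_id)).tendsto 0).mono_left
      nhdsWithin_le_nhds
  rw [mul_zero, add_zero] at hlim
  exact ge_of_tendsto hlim (eventually_mem_nhdsWithin.mono hr)

theorem abs_sub_sub_integral_fderiv_le (h : SolvesCE a b w μ) (hm : Integrable m)
    (hm0 : ∀ t, 0 ≤ m t) (hw : IsLipschitzField a b m w) {A B : ℝ≥0} {f : X → ℝ}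
    (hf : IsTestFunction A B f) {s t : ℝ} (hs : a ≤ s) (hst : s ≤ t) (ht : t ≤ b) {δ : ℝ≥0}
    (hδ : ∫ r in s..t, m r ≤ δ) :
    |∫ x, f x ∂(μ t).toMeasure - ∫ x, f x ∂(μ s).toMeasure -
      ∫ x, fderiv ℝ f x (displacement w s t x) ∂(μ s).toMeasure| ≤ (A + B) * δ ^ 2 := by
  have hs_mem : s ∈ Icc a b := ⟨hs, hst.trans ht⟩
  have ht_mem : t ∈ Icc a b := ⟨hs.trans hst, ht⟩
  have hint_moving := intervalIntegrable_of_integrableOn_Icc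
    (h.2.2 f hf.contDiff hf.hasCompactSupport).1 hs_mem ht_mem
  have hint_frozen : IntervalIntegrable
      (fun r => ∫ x, fderiv ℝ f x (w r x) ∂(μ s).toMeasure) volume s t :=
    intervalIntegrable_of_integrableOn_Icc (hw.integrable_fderiv_comp hm hf (μ s).toMeasure
      (x := fun _ x => x) measurable_snd).integral_prod_left hs_mem ht_mem
  rw [h.sub_eq_integral hf.contDiff hf.hasCompactSupport hs_mem ht_mem,
    ← hw.integral_fderiv_displacement hm hf _ hs hst ht,
    ← intervalIntegral.integral_sub hint_moving hint_frozen, ← Real.norm_eq_abs]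
  have hdiff : ∀ᵐ r ∂volume.restrict (Icc s t), ‖∫ x, fderiv ℝ f x (w r x) ∂(μ r).toMeasure -
      ∫ x, fderiv ℝ f x (w r x) ∂(μ s).toMeasure‖ ≤ (A + B) * δ * m r := by
    have hsub : Icc s t ⊆ Icc a b := Icc_subset_Icc hs ht
    filter_upwards [ae_restrict_of_ae_restrict_of_subset hsub hw.norm_le,
      ae_restrict_of_ae_restrict_of_subset hsub hw.ae_lipschitzWith,
      ae_restrict_mem measurableSet_Icc] with r hr hr_lip hr_mem
    have hlip := hf.lipschitzWith_fderiv_apply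
      (fun x => (hr x).trans (Real.le_coe_toNNReal (m r))) hr_lip
    have hle := h.abs_sub_le_of_lipschitzWith hm hw
      (hf.hasCompactSupport_fderiv_apply (w r)) hlip hs hr_mem.1 (hr_mem.2.trans ht)
    have hδr : ∫ r in s..r, m r ≤ δ := (primitive_mono hm hm0 hr_mem.2).trans hδ
    have hmr := hm0 r
    rw [NNReal.coe_mul, Real.coe_toNNReal _ hmr] at hle
    exact hle.trans (by rw [mul_right_comm]; push_cast; gcongr)
  refine (norm_intervalIntegral_le_of_ae_le le_rfl hst le_rfl hdiff
    (hm.integrableOn.const_mul _)).trans ?_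
  rw [intervalIntegral.integral_const_mul, pow_two, ← mul_assoc]
  gcongr

theorem abs_sub_integral_comp_le (h : SolvesCE a b w μ) (hm : Integrable m)
    (hm0 : ∀ t, 0 ≤ m t) (hw : IsLipschitzField a b m w) {A B : ℝ≥0} {f : X → ℝ}
    (hf : IsTestFunction A B f) {s t : ℝ} (hs : a ≤ s) (hst : s ≤ t) (ht : t ≤ b) {δ : ℝ≥0}
    (hδ : ∫ r in s..t, m r ≤ δ) {D : X → X} (hD : Continuous D) {η : ℝ}
    (hDη : ∀ x, dist (D x) (displacement w s t x) ≤ η) :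
    |∫ x, f x ∂(μ t).toMeasure - ∫ x, f (x + D x) ∂(μ s).toMeasure| ≤
      A * η + (A + 2 * B) * δ ^ 2 := by
  have hpointwise : ∀ x, ‖f x + fderiv ℝ f x (displacement w s t x) - f (x + D x)‖ ≤
      A * η + B * δ ^ 2 := fun x => by
    have htaylor := hf.abs_taylor_le x (displacement w s t x)
    have hlip := hf.lipschitzWith.norm_sub_le (x + D x) (x + displacement w s t x)
    rw [add_sub_add_left_eq_sub, ← dist_eq_norm (D x)] at hlip
    have hη : A * dist (D x) (displacement w s t x) ≤ A * η := by gcongr; exact hDη x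
    have hquad : B * ‖displacement w s t x‖ ^ 2 ≤ B * δ ^ 2 := by
      gcongr
      exact hw.norm_displacement_le hm hs hst ht hδ x
    rw [Real.norm_eq_abs, abs_le] at hlip ⊢
    rw [abs_le] at htaylor
    exact ⟨by linarith, by linarith⟩
  have hint_f : Integrable f (μ s).toMeasure :=
    (μ s).integrable_of_continuous hf.contDiff.continuous
  have hint_df : Integrable (fun x => fderiv ℝ f x (displacement w s t x)) (μ s).toMeasure :=
    (μ s).integrable_of_continuous (hf.continuous_fderiv.clm_apply
      (hw.lipschitzWith_displacement hm hs hst ht hδ).continuous)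
  have hint_comp : Integrable (fun x => f (x + D x)) (μ s).toMeasure :=
    (μ s).integrable_of_continuous (hf.contDiff.continuous.comp (continuous_id.add hD))
  have hint_add : Integrable (fun x => f x + fderiv ℝ f x (displacement w s t x)) (μ s).toMeasure :=
    hint_f.add hint_df
  have hfrozen := norm_integral_le_of_norm_le_const (μ := (μ s).toMeasure)
    (Eventually.of_forall hpointwise)
  rw [integral_sub hint_add hint_comp, integral_add hint_f hint_df, probReal_univ,
    mul_one, Real.norm_eq_abs] at hfrozen
  have hmoving := h.abs_sub_sub_integral_fderiv_le hm hm0 hw hf hs hst ht hδ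
  rw [abs_le] at hfrozen hmoving ⊢
  exact ⟨by linarith, by linarith⟩

end SolvesCE

variable [FiniteDimensional ℝ X] [BorelSpace X]

/-- The regularity constant `C` of the Euler map depends on `r` only, so that the losses of
regularity of the test functions stay summable along a partition. -/
theorem IsLipschitzField.exists_euler_map (hw : IsLipschitzField a b m w) (hm : Integrable m)
    (hm0 : ∀ t, 0 ≤ m t) {r : ℝ} (hr : 0 < r) :
    ∃ C : ℝ≥0, 1 ≤ C ∧ ∀ {s t : ℝ} {δ : ℝ≥0}, a ≤ s → s ≤ t → t ≤ b → ∫ r in s..t, m r ≤ δ →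
      ∃ Φ : X → X, ∀ {A B : ℝ≥0} {f : X → ℝ}, IsTestFunction A B f →
        IsTestFunction (A * (1 + δ)) (B * (1 + δ) ^ 2 + A * (C * δ)) (fun x => f (Φ x)) ∧
        ∀ {μ : ℝ → Pc X}, SolvesCE a b w μ →
          |∫ x, f x ∂(μ t).toMeasure - ∫ x, f (Φ x) ∂(μ s).toMeasure| ≤
            A * (δ * r) + (A + 2 * B) * δ ^ 2 := by
  obtain ⟨C, hC⟩ := exists_mollification X X hr
  refine ⟨max C 1, le_max_right _ _, fun {s t δ} hs hst ht hδ => ?_⟩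
  obtain ⟨D, hD, hD_close, hDδ, hDC, -⟩ :=
    hC _ δ (hw.lipschitzWith_displacement hm hs hst ht hδ)
  have hD_bdd : ∀ x, ‖D x‖ ≤ δ + δ * r := fun x => by
    have hclose := hD_close x
    rw [dist_eq_norm] at hclose
    exact (norm_le_norm_add_norm_sub' _ _).trans
      (add_le_add (hw.norm_displacement_le hm hs hst ht hδ x) hclose)
  exact ⟨fun x => x + D x, fun hf => ⟨hf.comp_add hD hD_bdd hDδ
    (hDC.weaken (by gcongr; exact le_max_left _ _)), fun h =>
      h.abs_sub_integral_comp_le hm hm0 hw hf hs hst ht hδ hD.continuous hD_close⟩⟩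

/-- A bound for the discrepancy between two solutions, tested against a test function with
constants `A` and `B`, that is created by one Euler step of size `δ`. -/
def eulerError (C δ A B : ℝ≥0) (r : ℝ) : ℝ :=
  2 * (A * (δ * r) + 2 * (B + C * A) * δ ^ 2)

section EulerError

variable {C δ A B : ℝ≥0} {r : ℝ}

theorem eulerError_nonneg (hr : 0 ≤ r) : 0 ≤ eulerError C δ A B r := by
  unfold eulerError
  positivity

theorem le_eulerError (hC : 1 ≤ C) :
    2 * (A * (δ * r) + (A + 2 * B) * δ ^ 2) ≤ eulerError C δ A B r := by
  have hA : (A : ℝ) ≤ C * A := le_mul_of_one_le_left A.coe_nonneg hC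
  unfold eulerError
  gcongr
  linarith [A.coe_nonneg]

theorem eulerError_comp_le (hr : 0 ≤ r) :
    eulerError C δ (A * (1 + δ)) (B * (1 + δ) ^ 2 + A * (C * δ)) r ≤
      (1 + δ) ^ 2 * eulerError C δ A B r := by
  rw [← sub_nonneg]
  have : 0 ≤ 2 * A * (1 + δ) * δ * (δ * r) + 4 * (C * A * δ ^ 2) * (δ : ℝ) ^ 2 := by positivity
  refine this.trans_eq ?_
  unfold eulerError
  push_cast
  ring

end EulerError

namespace SolvesCE

theorem abs_sub_le_of_steps (hm : Integrable m) (hm0 : ∀ t, 0 ≤ m t)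
    (hw : IsLipschitzField a b m w) {r : ℝ} (hr : 0 < r) :
    ∃ C : ℝ≥0, ∀ {μ μ' : ℝ → Pc X}, SolvesCE a b w μ → SolvesCE a b w μ' → μ a = μ' a →
      ∀ (δ : ℝ≥0) (n : ℕ), ∀ t ∈ Icc a b, ∫ s in a..t, m s ≤ n * δ →
        ∀ {A B : ℝ≥0} {f : X → ℝ}, IsTestFunction A B f →
          |∫ x, f x ∂(μ t).toMeasure - ∫ x, f x ∂(μ' t).toMeasure| ≤
            n * (((1 + δ) ^ 2) ^ n * eulerError C δ A B r) := by
  obtain ⟨C, hC1, hC⟩ := hw.exists_euler_map hm hm0 hr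
  refine ⟨C, fun {μ μ'} h h' h0 δ n => ?_⟩
  induction n with
  | zero =>
    intro t ht hM A B f hf
    have hμ := h.abs_sub_le_of_isTestFunction hm hw hf le_rfl ht.1 ht.2
    have hμ' := h'.abs_sub_le_of_isTestFunction hm hw hf le_rfl ht.1 ht.2
    have hA : A * ∫ s in a..t, m s ≤ 0 :=
      mul_nonpos_of_nonneg_of_nonpos A.coe_nonneg (by simpa using hM)
    rw [← h0] at hμ'
    rw [Nat.cast_zero, zero_mul]
    rw [abs_le] at hμ hμ' ⊢
    exact ⟨by linarith, by linarith⟩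
  | succ n ih =>
    intro t ht hM A B f hf
    obtain ⟨s, hs, hs_le, hst_le⟩ := exists_primitive_split hm hm0 (p := n * δ) (q := δ) ht.1
      (by positivity) δ.coe_nonneg (by push_cast at hM; linarith)
    obtain ⟨Φ, hΦ⟩ := hC hs.1 hs.2 ht.2 hst_le
    obtain ⟨hfΦ, hstep⟩ := hΦ hf
    have hμ := hstep h
    have hμ' := hstep h'
    have hs' := ih s ⟨hs.1, hs.2.trans ht.2⟩ hs_le hfΦ
    have hstep_le : 2 * (A * (δ * r) + (A + 2 * B) * δ ^ 2) ≤
        ((1 + (δ : ℝ)) ^ 2) ^ (n + 1) * eulerError C δ A B r :=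
      (le_eulerError hC1).trans (le_mul_of_one_le_left (eulerError_nonneg hr.le)
        (one_le_pow₀ (one_le_pow₀ (by simp))))
    calc |∫ x, f x ∂(μ t).toMeasure - ∫ x, f x ∂(μ' t).toMeasure|
        ≤ n * (((1 + δ) ^ 2) ^ n *
            eulerError C δ (A * (1 + δ)) (B * (1 + δ) ^ 2 + A * (C * δ)) r) +
          2 * (A * (δ * r) + (A + 2 * B) * δ ^ 2) := by
          rw [abs_le] at hμ hμ' hs' ⊢
          exact ⟨by linarith, by linarith⟩
      _ ≤ n * (((1 + δ) ^ 2) ^ n * ((1 + δ) ^ 2 * eulerError C δ A B r)) +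
          ((1 + (δ : ℝ)) ^ 2) ^ (n + 1) * eulerError C δ A B r :=
          add_le_add (by gcongr; exact eulerError_comp_le hr.le) hstep_le
      _ = (n + 1 : ℕ) * (((1 + δ) ^ 2) ^ (n + 1) * eulerError C δ A B r) := by
          push_cast
          ring

theorem integral_eq_of_eq_left (h : SolvesCE a b w μ) (h' : SolvesCE a b w μ')
    (hm : Integrable m) (hm0 : ∀ t, 0 ≤ m t) (hw : IsLipschitzField a b m w) (h0 : μ a = μ' a)
    {t : ℝ} (ht : t ∈ Icc a b) {f : X → ℝ} (hf : ContDiff ℝ ∞ f) (hc : HasCompactSupport f) :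
    ∫ x, f x ∂(μ t).toMeasure = ∫ x, f x ∂(μ' t).toMeasure := by
  obtain ⟨A, B, hf⟩ := exists_isTestFunction hf hc
  lift ∫ s in a..t, m s to ℝ≥0 using primitive_nonneg hm0 ht.1 with M hM
  have hr : ∀ r > 0, |∫ x, f x ∂(μ t).toMeasure - ∫ x, f x ∂(μ' t).toMeasure| ≤
      Real.exp M ^ 2 * (2 * (A * (M * r))) := by
    intro r hr
    obtain ⟨C, hC⟩ := abs_sub_le_of_steps hm hm0 hw hr
    have hlim : Tendsto (fun n : ℕ => Real.exp M ^ 2 *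
        (2 * (A * (M * r) + 2 * (B + C * A) * (M ^ 2 / ((n : ℝ) + 1))))) atTop
        (𝓝 (Real.exp M ^ 2 * (2 * (A * (M * r) + 2 * (B + C * A) * 0)))) :=
      ((tendsto_const_nhds.div_atTop (tendsto_atTop_add_const_right _ _
        tendsto_natCast_atTop_atTop)).const_mul _ |>.const_add _ |>.const_mul _).const_mul _
    rw [mul_zero, add_zero] at hlim
    refine ge_of_tendsto' hlim fun n => ?_
    have hMn : ((n + 1 : ℕ) : ℝ) * (M / (n + 1 : ℕ) : ℝ≥0) = M := by
      push_cast
      field_simp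
    have hexp : (1 + ((M / (n + 1 : ℕ) : ℝ≥0) : ℝ)) ^ (n + 1) ≤ Real.exp M := by
      rw [← hMn, Real.exp_nat_mul, add_comm]
      gcongr
      exact Real.add_one_le_exp _
    have hsteps := hC h h' h0 (M / (n + 1 : ℕ)) (n + 1) t ht (by rw [hMn, ← hM]) hf
    rw [pow_right_comm, eulerError] at hsteps
    refine hsteps.trans ?_
    calc _ ≤ ((n + 1 : ℕ) : ℝ) * (Real.exp M ^ 2 * (2 * (A * ((M / (n + 1 : ℕ) : ℝ≥0) * r) +
            2 * (B + C * A) * (M / (n + 1 : ℕ) : ℝ≥0) ^ 2))) := by gcongr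
      _ = _ := by
        push_cast
        field_simp
  have hlim : Tendsto (fun r : ℝ => Real.exp M ^ 2 * (2 * (A * (M * r)))) (𝓝[>] 0)
      (𝓝 (Real.exp M ^ 2 * (2 * (A * (M * 0))))) := by
    have : Continuous fun r : ℝ => Real.exp M ^ 2 * (2 * (A * (M * r))) := by fun_prop
    exact (this.tendsto 0).mono_left nhdsWithin_le_nhds
  rw [mul_zero, mul_zero, mul_zero, mul_zero] at hlim
  have hle := ge_of_tendsto hlim (eventually_mem_nhdsWithin.mono hr)
  exact sub_eq_zero.1 (abs_nonpos_iff.1 hle)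

end SolvesCE

theorem Pc.ext_of_integral_smooth {μ ν : Pc X} (h : ∀ f : X → ℝ, ContDiff ℝ ∞ f →
    HasCompactSupport f → ∫ x, f x ∂μ.toMeasure = ∫ x, f x ∂ν.toMeasure) : μ = ν := by
  have hcont : ∀ g : X → ℝ, Continuous g → HasCompactSupport g →
      ∫ x, g x ∂μ.toMeasure = ∫ x, g x ∂ν.toMeasure := fun g hg hgc =>
    eq_of_forall_dist_le fun ε hε => by
      obtain ⟨f, hf, hc, hfg⟩ :=
        exists_contDiff_dist_le_of_hasCompactSupport hg hgc (half_pos hε)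
      have hμ := abs_le.1 (μ.abs_integral_sub_le hf.continuous hg hfg)
      have hν := abs_le.1 (ν.abs_integral_sub_le hf.continuous hg hfg)
      rw [h f hf hc] at hμ
      exact abs_le.2 ⟨by linarith, by linarith⟩
  exact Pc.ext_of_toMeasure (Measure.ext_of_integral_eq_on_compactlySupported fun g =>
    hcont g g.continuous g.hasCompactSupport)

theorem SolvesCE.eq_of_eq_left (h : SolvesCE a b w μ) (h' : SolvesCE a b w μ')
    (hm : Integrable m) (hm0 : ∀ t, 0 ≤ m t) (hw : IsLipschitzField a b m w) (h0 : μ a = μ' a)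
    {t : ℝ} (ht : t ∈ Icc a b) : μ t = μ' t :=
  Pc.ext_of_integral_smooth fun _ hf hc => h.integral_eq_of_eq_left h' hm hm0 hw h0 ht hf hc

end Uniqueness

section Support

theorem exists_smooth_plateau : ∃ (q : ℝ → ℝ) (C : ℝ), 0 ≤ C ∧ ContDiff ℝ ∞ q ∧
    (∀ y ≤ 0, q y = y) ∧ (∀ y ≥ 1, q y = 1) ∧ ∀ y, |deriv q y| ≤ C := by
  set q : ℝ → ℝ := fun y => y * (1 - Real.smoothTransition y) + Real.smoothTransition y
  have hq : ContDiff ℝ ∞ q :=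
    (contDiff_id.mul (contDiff_const.sub Real.smoothTransition.contDiff)).add
      Real.smoothTransition.contDiff
  have h_nonpos : ∀ y ≤ 0, q y = y := fun y hy => by
    simp [q, Real.smoothTransition.zero_of_nonpos hy]
  have h_one_le : ∀ y ≥ 1, q y = 1 := fun y hy => by
    simp [q, Real.smoothTransition.one_of_one_le hy]
  obtain ⟨C, hC⟩ := (isCompact_Icc (a := (0 : ℝ)) (b := 1)).exists_bound_of_continuousOn
    (hq.continuous_deriv (by simp)).continuousOn
  refine ⟨q, max C 1, by positivity, hq, h_nonpos, h_one_le, fun y => ?_⟩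
  rcases lt_or_ge y 0 with hy | hy
  · have hy_eq : q =ᶠ[𝓝 y] id := by
      filter_upwards [Iio_mem_nhds hy] with z hz using h_nonpos z (le_of_lt hz)
    simp [hy_eq.deriv_eq]
  rcases le_or_gt y 1 with hy' | hy'
  · exact (hC y ⟨hy, hy'⟩).trans (le_max_left _ _)
  · have hy_eq : q =ᶠ[𝓝 y] fun _ => 1 := by
      filter_upwards [Ioi_mem_nhds hy'] with z hz using h_one_le z (le_of_lt hz)
    simp [hy_eq.deriv_eq]

variable {X : Type*} [NormedAddCommGroup X] [InnerProductSpace ℝ X]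

/-- A smooth truncation `ψ` of the power `(1 + ‖x‖²) ^ p`: it coincides with it on the ball of
radius `S` and is constant at infinity. The bound on the derivative is the one of the power itself,
up to a constant `C` that is meant to be independent of `p` and `S`. -/
structure IsTruncatedPower (C p S : ℝ) (ψ : X → ℝ) : Prop where
  contDiff : ContDiff ℝ ∞ ψ
  pos : ∀ x, 0 < ψ x
  hasCompactSupport_sub_const : ∃ c : ℝ, HasCompactSupport fun x => ψ x - c
  eq_rpow : ∀ x, ‖x‖ ≤ S → ψ x = (1 + ‖x‖ ^ 2) ^ p
  abs_fderiv_le : ∀ x v, |fderiv ℝ ψ x v| ≤ C * p * ψ x * (‖x‖ * ‖v‖ / (1 + ‖x‖ ^ 2))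

theorem exists_isTruncatedPower (X : Type*) [NormedAddCommGroup X] [InnerProductSpace ℝ X]
    [FiniteDimensional ℝ X] :
    ∃ C : ℝ, 0 ≤ C ∧ ∀ p S : ℝ, 0 ≤ p → ∃ ψ : X → ℝ, IsTruncatedPower C p S ψ := by
  obtain ⟨q, C, hC, hq, hq_nonpos, hq_one_le, hqC⟩ := exists_smooth_plateau
  refine ⟨2 * C, by positivity, fun p S hp => ?_⟩
  have hpos : ∀ x : X, 0 < 1 + ‖x‖ ^ 2 := fun x => by positivity
  set n := Real.log (1 + S ^ 2)
  set g : X → ℝ := fun x => Real.log (1 + ‖x‖ ^ 2)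
  have hg : ContDiff ℝ ∞ g :=
    (contDiff_const.add (contDiff_norm_sq ℝ)).log fun x => (hpos x).ne'
  set ψ : X → ℝ := fun x => Real.exp (p * (n + q (g x - n)))
  have hψ_pos : ∀ x, 0 < ψ x := fun x => Real.exp_pos _
  refine ⟨ψ, ?_, hψ_pos, ⟨Real.exp (p * (n + 1)), ?_⟩, fun x hx => ?_, fun x v => ?_⟩
  · exact (contDiff_const.mul (contDiff_const.add (hq.comp (hg.sub contDiff_const)))).exp
  · refine HasCompactSupport.intro (isCompact_closedBall (0 : X) (Real.exp (n + 1))) fun x hx => ?_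
    rw [mem_closedBall_zero_iff, not_le] at hx
    have hgx : n + 1 ≤ g x := by
      rw [Real.le_log_iff_exp_le (hpos x)]
      nlinarith [norm_nonneg x]
    simp only [ψ, hq_one_le _ (le_sub_iff_add_le'.2 hgx), sub_self]
  · have hgx : g x ≤ n := Real.log_le_log (hpos x) (by gcongr)
    simp only [ψ, hq_nonpos _ (sub_nonpos.2 hgx), add_sub_cancel]
    rw [Real.rpow_def_of_pos (hpos x), mul_comm]
  · have hgd : HasFDerivAt g ((1 + ‖x‖ ^ 2)⁻¹ • (2 • (innerSL ℝ x))) x :=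
      ((hasStrictFDerivAt_norm_sq x).hasFDerivAt.const_add 1).log (hpos x).ne'
    have hqd : HasDerivAt q (deriv q (g x - n)) (g x - n) :=
      (hq.differentiable (by simp) _).hasDerivAt
    have hψd : HasFDerivAt ψ _ x :=
      (((hqd.comp_hasFDerivAt x (hgd.sub_const n)).const_add n).const_mul p).exp
    have hfderiv : fderiv ℝ ψ x v = ψ x * (p * (deriv q (g x - n) *
        ((1 + ‖x‖ ^ 2)⁻¹ * (2 * inner ℝ x v)))) := by
      rw [hψd.fderiv]
      simp [ψ]
    calc |fderiv ℝ ψ x v|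
        = ψ x * (p * (|deriv q (g x - n)| * ((1 + ‖x‖ ^ 2)⁻¹ * (2 * |inner ℝ x v|)))) := by
          rw [hfderiv, abs_mul, abs_mul, abs_mul, abs_mul, abs_mul, abs_of_pos (hψ_pos x),
            abs_of_nonneg hp, abs_of_pos (inv_pos.2 (hpos x)), abs_two]
      _ ≤ ψ x * (p * (C * ((1 + ‖x‖ ^ 2)⁻¹ * (2 * (‖x‖ * ‖v‖))))) := by
          have := (hψ_pos x).le
          have := (hpos x).le
          gcongr
          exacts [hqC _, abs_real_inner_le_norm x v]
      _ = 2 * C * p * ψ x * (‖x‖ * ‖v‖ / (1 + ‖x‖ ^ 2)) := by rw [div_eq_mul_inv]; ring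

namespace IsTruncatedPower

variable {C p S : ℝ} {ψ : X → ℝ}

theorem mono (hψ : IsTruncatedPower C p S ψ) {S' : ℝ} (hS : S' ≤ S) : IsTruncatedPower C p S' ψ :=
  { hψ with eq_rpow := fun x hx => hψ.eq_rpow x (hx.trans hS) }

theorem eq_sqrt (hψ : IsTruncatedPower C (1 / 2) S ψ) {x : X} (hx : ‖x‖ ≤ S) :
    ψ x = √(1 + ‖x‖ ^ 2) := by
  rw [hψ.eq_rpow x hx, Real.sqrt_eq_rpow]

variable [FiniteDimensional ℝ X] [MeasurableSpace X] [BorelSpace X]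

theorem integrable (hψ : IsTruncatedPower C p S ψ) (μ : Pc X) : Integrable ψ μ.toMeasure :=
  μ.integrable_of_continuous hψ.contDiff.continuous

theorem integral_fderiv_le (hψ : IsTruncatedPower C p S ψ) (hC : 0 ≤ C) (hp : 0 ≤ p) (μ : Pc X)
    {w : X → X} {r : ℝ} (hr : 0 ≤ r) (hw : ∀ x, ‖w x‖ ≤ r * (1 + ‖x‖)) :
    ∫ x, fderiv ℝ ψ x (w x) ∂μ.toMeasure ≤ 2 * C * p * r * ∫ x, ψ x ∂μ.toMeasure := by
  rw [← integral_const_mul]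
  refine (Real.le_norm_self _).trans (norm_integral_le_of_norm_le ((hψ.integrable μ).const_mul _)
    (Eventually.of_forall fun x => (hψ.abs_fderiv_le x _).trans ?_))
  have hdiv : ‖x‖ * ‖w x‖ / (1 + ‖x‖ ^ 2) ≤ 2 * r := by
    rw [div_le_iff₀ (by positivity)]
    calc ‖x‖ * ‖w x‖ ≤ ‖x‖ * (r * (1 + ‖x‖)) := by gcongr; exact hw x
      _ = r * (‖x‖ * (1 + ‖x‖)) := by ring
      _ ≤ r * (2 * (1 + ‖x‖ ^ 2)) := by gcongr ?_ * ?_; nlinarith [sq_nonneg (‖x‖ - 1)]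
      _ = 2 * r * (1 + ‖x‖ ^ 2) := by ring
  have hψx := (hψ.pos x).le
  calc C * p * ψ x * (‖x‖ * ‖w x‖ / (1 + ‖x‖ ^ 2)) ≤ C * p * ψ x * (2 * r) := by gcongr
    _ = 2 * C * p * r * ψ x := by ring

theorem integral_le (hψ : IsTruncatedPower C p S ψ) (hp : 0 ≤ p) {μ : Pc X} {R : ℝ}
    (hμ : μ ∈ POn (Metric.closedBall 0 R)) (hRS : R ≤ S) :
    ∫ x, ψ x ∂μ.toMeasure ≤ (1 + R ^ 2) ^ p := by
  refine (integral_mono_ae (hψ.integrable μ) (integrable_const ((1 + R ^ 2) ^ p)) ?_).trans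
    (by simp)
  filter_upwards [mem_POn_closedBall_iff.1 hμ] with x hx
  rw [hψ.eq_rpow x (hx.trans hRS)]
  gcongr

theorem measure_tail_le (hψ : IsTruncatedPower C p S ψ) (hp : 0 ≤ p) {μ : Pc X}
    (hμ : μ ∈ POn (Metric.closedBall 0 S)) {ρ : ℝ} (hρ : 0 ≤ ρ) :
    (1 + ρ ^ 2) ^ p * μ.toMeasure.real {x | ρ ≤ ‖x‖} ≤ ∫ x, ψ x ∂μ.toMeasure := by
  refine le_trans ?_ (mul_meas_ge_le_integral_of_nonneg
    (Eventually.of_forall fun x => (hψ.pos x).le) (hψ.integrable μ) ((1 + ρ ^ 2) ^ p))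
  refine mul_le_mul_of_nonneg_left (ENNReal.toReal_mono (measure_ne_top _ _)
    (measure_mono_ae ?_)) (by positivity)
  filter_upwards [mem_POn_closedBall_iff.1 hμ] with x hx hρx
  change (1 + ρ ^ 2) ^ p ≤ ψ x
  rw [hψ.eq_rpow x hx]
  gcongr
  exact hρx

variable {μ : Pc X}

theorem integral_norm_le (hψ : IsTruncatedPower C (1 / 2) S ψ)
    (hμ : μ ∈ POn (Metric.closedBall 0 S)) : ∫ x, ‖x‖ ∂μ.toMeasure ≤ ∫ x, ψ x ∂μ.toMeasure := by
  refine integral_mono_ae (μ.integrable_of_continuous continuous_norm) (hψ.integrable μ) ?_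
  filter_upwards [mem_POn_closedBall_iff.1 hμ] with x hx
  rw [hψ.eq_sqrt hx]
  exact Real.le_sqrt_of_sq_le (le_add_of_nonneg_left zero_le_one)

theorem one_le_integral (hψ : IsTruncatedPower C (1 / 2) S ψ)
    (hμ : μ ∈ POn (Metric.closedBall 0 S)) : 1 ≤ ∫ x, ψ x ∂μ.toMeasure := by
  suffices hae : ∀ᵐ x ∂μ.toMeasure, 1 ≤ ψ x by
    simpa using integral_mono_ae (integrable_const (1 : ℝ)) (hψ.integrable μ) hae
  filter_upwards [mem_POn_closedBall_iff.1 hμ] with x hx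
  rw [hψ.eq_sqrt hx]
  exact Real.one_le_sqrt.2 (le_add_of_nonneg_right (sq_nonneg _))

theorem integral_fderiv_le_of_le_moment (hψ : IsTruncatedPower C (1 / 2) S ψ) (hC : 0 ≤ C)
    (hμ : μ ∈ POn (Metric.closedBall 0 S)) {w : X → X} {r : ℝ} (hr : 0 ≤ r)
    (hw : ∀ x, ‖w x‖ ≤ r * (1 + ‖x‖ + ∫ y, ‖y‖ ∂μ.toMeasure)) :
    ∫ x, fderiv ℝ ψ x (w x) ∂μ.toMeasure ≤ 3 / 2 * C * r * ∫ x, ψ x ∂μ.toMeasure := by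
  set K := ∫ y, ‖y‖ ∂μ.toMeasure
  have hnorm : Integrable (fun y => ‖y‖) μ.toMeasure := μ.integrable_of_continuous continuous_norm
  have hint : Integrable (fun y => 1 + ‖y‖ + K) μ.toMeasure :=
    μ.integrable_of_continuous (by fun_prop)
  have hpointwise : ∀ᵐ x ∂μ.toMeasure, ‖fderiv ℝ ψ x (w x)‖ ≤ C / 2 * r * (1 + ‖x‖ + K) := by
    filter_upwards [mem_POn_closedBall_iff.1 hμ] with x hx
    have hψx := hψ.pos x
    have hψ_sq : ψ x ^ 2 = 1 + ‖x‖ ^ 2 := by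
      rw [hψ.eq_sqrt hx, Real.sq_sqrt (by positivity)]
    have hx_le : ‖x‖ ≤ ψ x := abs_le_of_sq_le_sq' (by linarith) hψx.le |>.2
    calc ‖fderiv ℝ ψ x (w x)‖ ≤ C * (1 / 2) * ψ x * (‖x‖ * ‖w x‖ / (1 + ‖x‖ ^ 2)) :=
          hψ.abs_fderiv_le x _
      _ ≤ C * (1 / 2) * ψ x * (ψ x * (r * (1 + ‖x‖ + K)) / ψ x ^ 2) := by
          rw [hψ_sq]
          gcongr
          exact hw x
      _ = C / 2 * r * (1 + ‖x‖ + K) := by field_simp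
  calc ∫ x, fderiv ℝ ψ x (w x) ∂μ.toMeasure
      ≤ ∫ x, C / 2 * r * (1 + ‖x‖ + K) ∂μ.toMeasure :=
        (Real.le_norm_self _).trans (norm_integral_le_of_norm_le (hint.const_mul _) hpointwise)
    _ = C / 2 * r * (1 + K + K) := by
        rw [integral_const_mul, integral_add (by fun_prop) (integrable_const K),
          integral_add (integrable_const 1) hnorm]
        simp [K]
    _ ≤ C / 2 * r * (3 * ∫ x, ψ x ∂μ.toMeasure) := by
        gcongr
        linarith [hψ.one_le_integral hμ, hψ.integral_norm_le hμ]
    _ = 3 / 2 * C * r * ∫ x, ψ x ∂μ.toMeasure := by ring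

end IsTruncatedPower

namespace SolvesCE

variable [FiniteDimensional ℝ X] [MeasurableSpace X] [BorelSpace X]
variable {a b : ℝ} {m : ℝ → ℝ} {w : ℝ → X → X} {μ : ℝ → Pc X}

theorem integral_le_mul_exp (h : SolvesCE a b w μ) (hm : Integrable m) (hm0 : ∀ t, 0 ≤ m t)
    {ψ : X → ℝ} (hψ : ContDiff ℝ ∞ ψ) (hc : ∃ c : ℝ, HasCompactSupport fun x => ψ x - c)
    (hψw : ∀ᵐ t ∂volume.restrict (Icc a b),
      ∫ x, fderiv ℝ ψ x (w t x) ∂(μ t).toMeasure ≤ m t * ∫ x, ψ x ∂(μ t).toMeasure)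
    {t : ℝ} (ht : t ∈ Icc a b) :
    ∫ x, ψ x ∂(μ t).toMeasure ≤ (∫ x, ψ x ∂(μ a).toMeasure) * Real.exp (∫ s in a..t, m s) := by
  obtain ⟨c, hc⟩ := hc
  have hψc : ContDiff ℝ ∞ fun x => ψ x - c := hψ.sub contDiff_const
  have hsub : ∀ s, ∫ x, (ψ x - c) ∂(μ s).toMeasure = ∫ x, ψ x ∂(μ s).toMeasure - c := fun s => by
    rw [integral_sub ((μ s).integrable_of_continuous hψ.continuous) (integrable_const c)]
    simp
  obtain ⟨hint, heq⟩ := h.2.2 _ hψc hc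
  simp only [fderiv_sub_const, hsub] at hint heq
  have heq' : ∀ s ∈ Icc a b, ∫ x, ψ x ∂(μ s).toMeasure = ∫ x, ψ x ∂(μ a).toMeasure +
      ∫ r in a..s, ∫ x, fderiv ℝ ψ x (w r x) ∂(μ r).toMeasure := fun s hs => by
    linarith [heq s hs]
  have hab : a ≤ b := ht.1.trans ht.2
  have hcont : ContinuousOn (fun s => ∫ x, ψ x ∂(μ s).toMeasure) (Icc a b) := by
    refine ContinuousOn.congr (continuousOn_const.add ?_) heq'
    have hprim := intervalIntegral.continuousOn_primitive_interval
      (f := fun r => ∫ x, fderiv ℝ ψ x (w r x) ∂(μ r).toMeasure) (μ := volume) (a := a) (b := b)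
      (by rwa [uIcc_of_le hab])
    rwa [uIcc_of_le hab] at hprim
  have hIcc : Icc a t ⊆ Icc a b := Icc_subset_Icc_right ht.2
  refine le_mul_exp_of_le_add_integral hm hm0 ht.1 (hcont.mono hIcc) fun s hs => ?_
  rw [heq' s (hIcc hs)]
  refine add_le_add le_rfl (intervalIntegral.integral_mono_ae_restrict hs.1
    (intervalIntegrable_of_integrableOn_Icc hint ⟨le_rfl, hab⟩ (hIcc hs)) ?_
    (ae_restrict_of_ae_restrict_of_subset (Icc_subset_Icc_right (hIcc hs).2) hψw))
  refine hm.intervalIntegrable.mul_continuousOn ?_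
  rw [uIcc_of_le hs.1]
  exact hcont.mono (Icc_subset_Icc_right (hIcc hs).2)

/-- Chebyshev's inequality for the moments of order `2p`, whose growth rate is linear in `p`: as
`p → ∞` the tails beyond the asserted radius vanish. -/
theorem exists_support_bound (X : Type*) [NormedAddCommGroup X] [InnerProductSpace ℝ X]
    [FiniteDimensional ℝ X] [MeasurableSpace X] [BorelSpace X] :
    ∃ C : ℝ, 0 ≤ C ∧ ∀ {a b : ℝ} {m : ℝ → ℝ} {w : ℝ → X → X} {μ : ℝ → Pc X}, SolvesCE a b w μ →
      Integrable m → (∀ t, 0 ≤ m t) →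
      (∀ᵐ t ∂volume.restrict (Icc a b), ∀ x, ‖w t x‖ ≤ m t * (1 + ‖x‖)) →
      ∀ {R : ℝ}, μ a ∈ POn (Metric.closedBall 0 R) → ∀ t ∈ Icc a b,
      μ t ∈ POn (Metric.closedBall 0 (√(1 + R ^ 2) * Real.exp (C * ∫ s in a..t, m s))) := by
  obtain ⟨C, hC, hpow⟩ := exists_isTruncatedPower X
  refine ⟨C, hC, fun {a b m w μ} h hm hm0 hw {R} hR t ht => ?_⟩
  set M := ∫ s in a..t, m s
  set ρ := √(1 + R ^ 2) * Real.exp (C * M)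
  have hρ : ρ ^ 2 = (1 + R ^ 2) * Real.exp (2 * C * M) := by
    rw [mul_pow, Real.sq_sqrt (by positivity), ← Real.exp_nat_mul]
    push_cast
    ring_nf
  obtain ⟨S, -, hS⟩ := (μ t).exists_mem_POn_closedBall
  have htail : ∀ p : ℕ,
      (μ t).toMeasure.real {x | ρ ≤ ‖x‖} ≤ (ρ ^ 2 / (1 + ρ ^ 2)) ^ p := fun p => by
    have hp : (0 : ℝ) ≤ p := p.cast_nonneg
    obtain ⟨ψ, hψ⟩ := hpow p (max R S) hp
    have hgrowth := h.integral_le_mul_exp (m := fun t => 2 * C * p * m t) (hm.const_mul _)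
      (fun t => by have := hm0 t; positivity) hψ.contDiff hψ.hasCompactSupport_sub_const
      (hw.mono fun s hs => hψ.integral_fderiv_le hC hp (μ s) (hm0 s) hs) ht
    rw [div_pow, le_div_iff₀ (by positivity), mul_comm, ← Real.rpow_natCast (1 + ρ ^ 2)]
    calc (1 + ρ ^ 2) ^ (p : ℝ) * (μ t).toMeasure.real {x | ρ ≤ ‖x‖}
        ≤ ∫ x, ψ x ∂(μ t).toMeasure :=
          hψ.measure_tail_le hp (POn_mono (Metric.closedBall_subset_closedBall (le_max_right _ _))
            hS) (by positivity)
      _ ≤ (1 + R ^ 2) ^ (p : ℝ) * Real.exp (∫ s in a..t, 2 * C * p * m s) :=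
          hgrowth.trans (by gcongr; exact hψ.integral_le hp hR (le_max_left _ _))
      _ = (ρ ^ 2) ^ p := by
          rw [hρ, mul_pow, ← Real.exp_nat_mul, Real.rpow_natCast,
            intervalIntegral.integral_const_mul]
          simp only [M]
          ring_nf
  have hzero : (μ t).toMeasure.real {x | ρ ≤ ‖x‖} = 0 :=
    le_antisymm (ge_of_tendsto' (tendsto_pow_atTop_nhds_zero_of_lt_one (by positivity)
      ((div_lt_one (by positivity)).2 (lt_one_add _))) htail) measureReal_nonneg
  rw [measureReal_eq_zero_iff] at hzero
  refine mem_POn_closedBall_iff.2 ?_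
  filter_upwards [measure_eq_zero_iff_ae_notMem.1 hzero] with x hx using (not_le.1 hx).le

theorem exists_moment_bound (X : Type*) [NormedAddCommGroup X] [InnerProductSpace ℝ X]
    [FiniteDimensional ℝ X] [MeasurableSpace X] [BorelSpace X] :
    ∃ C : ℝ, 0 ≤ C ∧ ∀ {a b : ℝ} {m : ℝ → ℝ} {w : ℝ → X → X} {μ : ℝ → Pc X}, SolvesCE a b w μ →
      Integrable m → (∀ t, 0 ≤ m t) →
      (∀ᵐ t ∂volume.restrict (Icc a b), ∀ x,
        ‖w t x‖ ≤ m t * (1 + ‖x‖ + ∫ y, ‖y‖ ∂(μ t).toMeasure)) →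
      ∀ {R S : ℝ}, μ a ∈ POn (Metric.closedBall 0 R) →
      (∀ t ∈ Icc a b, μ t ∈ POn (Metric.closedBall 0 S)) → ∀ t ∈ Icc a b,
      ∫ y, ‖y‖ ∂(μ t).toMeasure ≤ √(1 + R ^ 2) * Real.exp (C * ∫ s in a..t, m s) := by
  obtain ⟨C, hC, hpow⟩ := exists_isTruncatedPower X
  refine ⟨3 / 2 * C, by positivity, fun {a b m w μ} h hm hm0 hw {R S} hR hS t ht => ?_⟩
  obtain ⟨ψ, hψ⟩ := hpow (1 / 2) (max R S) (by norm_num)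
  have hψS : IsTruncatedPower C (1 / 2) S ψ := hψ.mono (le_max_right _ _)
  have hgrowth := h.integral_le_mul_exp (m := fun t => 3 / 2 * C * m t) (hm.const_mul _)
    (fun t => by have := hm0 t; positivity) hψ.contDiff hψ.hasCompactSupport_sub_const (by
      filter_upwards [hw, ae_restrict_mem measurableSet_Icc] with s hws hs
      exact hψS.integral_fderiv_le_of_le_moment hC (hS s hs) (hm0 s) hws) ht
  rw [intervalIntegral.integral_const_mul] at hgrowth
  refine ((hψS.integral_norm_le (hS t ht)).trans hgrowth).trans ?_
  gcongr
  rw [Real.sqrt_eq_rpow]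
  exact hψ.integral_le (by norm_num) hR (le_max_left _ _)

end SolvesCE

end Support

section Laws

theorem wass_one_self {X : Type*} [MetricSpace X] [SecondCountableTopology X] [MeasurableSpace X]
    [BorelSpace X] (μ : Pc X) : wass 1 μ μ = 0 := by
  refine le_antisymm ?_ (wass_nonneg 1 μ μ)
  simpa using wass_one_le_integral_dist (P := μ.toMeasure) (f := id) (g := id) aemeasurable_id
    aemeasurable_id Measure.map_id Measure.map_id (by simp)

theorem Pc.map_eq_self {X : Type*} [TopologicalSpace X] [HereditarilyLindelofSpace X] [T2Space X]
    [MeasurableSpace X] [BorelSpace X] {μ : Pc X} {f : X → X} {hf : Continuous f}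
    (h : ∀ᵐ x ∂μ.toMeasure, f x = x) : μ.map f hf = μ :=
  Pc.ext_of_toMeasure ((Measure.map_congr (g := id) h).trans Measure.map_id)

variable {X : Type*} [NormedAddCommGroup X] [MeasurableSpace X] [BorelSpace X]

theorem Pc.map_mem_POn_closedBall {Y : Type*} [TopologicalSpace Y] [HereditarilyLindelofSpace Y]
    [MeasurableSpace Y] [OpensMeasurableSpace Y] {μ : Pc Y} {f : Y → X} {hf : Continuous f} {R : ℝ}
    (h : ∀ᵐ x ∂μ.toMeasure, ‖f x‖ ≤ R) : μ.map f hf ∈ POn (Metric.closedBall (0 : X) R) :=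
  mem_POn_closedBall_iff.2 <| (ae_map_iff hf.measurable.aemeasurable
    (measurableSet_le measurable_norm measurable_const)).2 h

variable [SecondCountableTopology X]

/-- The law of `P ∘ Y` under `ρ`, for a truncation `P` and a flow map `Y`. -/
noncomputable def truncatedLaw (ρ : Pc X) (P Y : X →ᵇ X) : Pc X :=
  ρ.map (fun x => P (Y x)) (P.continuous.comp Y.continuous)

theorem wass_truncatedLaw_le (ρ : Pc X) {P : X →ᵇ X} {C : ℝ≥0} (hP : LipschitzWith C P)
    (Y Y' : X →ᵇ X) : wass 1 (truncatedLaw ρ P Y) (truncatedLaw ρ P Y') ≤ C * dist Y Y' := by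
  refine (wass_one_map_le ρ _ _).trans ((integral_mono
    (ρ.integrable_of_continuous (by fun_prop)) (integrable_const (C * dist Y Y')) fun x => ?_).trans
    (by simp))
  exact (hP.dist_le_mul _ _).trans (by gcongr; exact BoundedContinuousFunction.dist_coe_le_dist x)

theorem tendsto_wass_truncatedLaw (ρ : Pc X) {P : X →ᵇ X} {C : ℝ≥0} (hP : LipschitzWith C P)
    {Y : ℝ → (X →ᵇ X)} (hY : Continuous Y) (t : ℝ) :
    Tendsto (fun s => wass 1 (truncatedLaw ρ P (Y s)) (truncatedLaw ρ P (Y t))) (𝓝 t) (𝓝 0) := by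
  refine squeeze_zero (fun _ => wass_nonneg _ _ _) (fun s => wass_truncatedLaw_le ρ hP _ _) ?_
  have hcont : Continuous fun s => C * dist (Y s) (Y t) := by fun_prop
  simpa using hcont.tendsto t

theorem integral_norm_truncatedLaw_le (ρ : Pc X) {P : X →ᵇ X} (hP : ∀ x, ‖P x‖ ≤ ‖x‖)
    (Y : X →ᵇ X) : ∫ y, ‖y‖ ∂(truncatedLaw ρ P Y).toMeasure ≤ ‖Y‖ := by
  rw [truncatedLaw, ρ.integral_map _ continuous_norm]
  exact (integral_mono (ρ.integrable_of_continuous (by fun_prop)) (integrable_const ‖Y‖)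
    fun x => (hP _).trans (Y.norm_coe_le_norm x)).trans (by simp)

end Laws

section Trajectories

/-- The part of the standing hypotheses on the dynamics that does not involve derivatives. -/
structure RegularDynamics {d : ℕ} {U : Type*} [TopologicalSpace U] (T : ℝ)
    (v : ℝ → Pc (E d) → U → E d → E d) : Prop where
  measurable_time : ∀ μ u x,
    AEStronglyMeasurable (fun t => v t μ u x) (volume.restrict (Icc 0 T))
  sublinear : ∃ m : ℝ → ℝ, (∀ t, 0 ≤ m t) ∧ IntegrableOn m (Icc 0 T) ∧
    ∀ᵐ t ∂volume.restrict (Icc 0 T), ∀ u μ x,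
      ‖v t μ u x‖ ≤ m t * (1 + ‖x‖ + ∫ y, ‖y‖ ∂μ.toMeasure)
  lipschitz : ∀ R > 0, ∃ l L : ℝ → ℝ, (∀ t, 0 ≤ l t) ∧ (∀ t, 0 ≤ L t) ∧
    IntegrableOn l (Icc 0 T) ∧ IntegrableOn L (Icc 0 T) ∧
    ∀ᵐ t ∂volume.restrict (Icc 0 T), ∀ u,
      ∀ μ ∈ POn (Metric.closedBall (0 : E d) R), ∀ ν ∈ POn (Metric.closedBall (0 : E d) R),
      ∀ x ∈ Metric.closedBall (0 : E d) R, ∀ y ∈ Metric.closedBall (0 : E d) R,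
        ‖v t μ u x - v t μ u y‖ ≤ l t * ‖x - y‖ ∧ ‖v t μ u x - v t ν u x‖ ≤ L t * wass 1 μ ν
  continuous_control : ∀ᵐ t ∂volume.restrict (Icc 0 T), ∀ μ x, Continuous (fun u => v t μ u x)

theorem Hypotheses.regularDynamics {d : ℕ} {U : Type*} [TopologicalSpace U] {T : ℝ}
    {v : ℝ → Pc (E d) → U → E d → E d} {φ : Pc (E d) → ℝ} (hyp : Hypotheses T v φ) :
    RegularDynamics T v :=
  ⟨hyp.measurable_time, hyp.sublinear, hyp.lipschitz, hyp.continuous_control⟩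

variable {d : ℕ} {U : Type*} {T : ℝ} {v : ℝ → Pc (E d) → U → E d → E d}

/-- `P` is a bounded `C`-Lipschitz truncation that is the identity on the ball of radius `S`, and
`m` is a rate for the truncated velocity `v(t, μ, u, P x)` with `μ` in the ball of radius `2 * S`,
which contains the range of `P`. -/
structure IsTruncation (T : ℝ) (v : ℝ → Pc (E d) → U → E d → E d) (S : ℝ) (P : E d →ᵇ E d)
    (C : ℝ≥0) (m : ℝ → ℝ) : Prop where
  integrable : Integrable m
  nonneg : ∀ t, 0 ≤ m t
  lipschitzWith : LipschitzWith C P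
  eq_self : ∀ x, ‖x‖ ≤ S → P x = x
  norm_le_norm : ∀ x, ‖P x‖ ≤ ‖x‖
  norm_le : ∀ x, ‖P x‖ ≤ 2 * S
  norm_velocity_le : ∀ᵐ t ∂volume.restrict (Icc 0 T), ∀ u,
    ∀ μ ∈ POn (Metric.closedBall (0 : E d) (2 * S)), ∀ x, ‖v t μ u (P x)‖ ≤ m t
  norm_velocity_sub_le : ∀ᵐ t ∂volume.restrict (Icc 0 T), ∀ u,
    ∀ μ ∈ POn (Metric.closedBall (0 : E d) (2 * S)),
    ∀ ν ∈ POn (Metric.closedBall (0 : E d) (2 * S)), ∀ x y,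
      ‖v t μ u (P x) - v t ν u (P y)‖ ≤ m t * (‖x - y‖ + wass 1 μ ν)

namespace RegularDynamics

variable [TopologicalSpace U]

theorem exists_growth_rate (hv : RegularDynamics T v) :
    ∃ m : ℝ → ℝ, Integrable m ∧ (∀ t, 0 ≤ m t) ∧
      ∀ᵐ t ∂volume.restrict (Icc 0 T), ∀ u μ x,
        ‖v t μ u x‖ ≤ m t * (1 + ‖x‖ + ∫ y, ‖y‖ ∂μ.toMeasure) := by
  obtain ⟨m, hm0, hm, hle⟩ := hv.sublinear
  refine ⟨(Icc 0 T).indicator m, hm.integrable_indicator measurableSet_Icc,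
    indicator_nonneg fun t _ => hm0 t, ?_⟩
  filter_upwards [hle, ae_restrict_mem measurableSet_Icc] with t ht hmem
  simpa only [indicator_of_mem hmem] using ht

theorem exists_lipschitz_rate (hv : RegularDynamics T v) {R : ℝ} (hR : 0 < R) :
    ∃ l : ℝ → ℝ, Integrable l ∧ (∀ t, 0 ≤ l t) ∧ ∀ᵐ t ∂volume.restrict (Icc 0 T), ∀ u,
      ∀ μ ∈ POn (Metric.closedBall (0 : E d) R), ∀ ν ∈ POn (Metric.closedBall (0 : E d) R),
      ∀ x ∈ Metric.closedBall (0 : E d) R, ∀ y ∈ Metric.closedBall (0 : E d) R,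
        ‖v t μ u x - v t ν u y‖ ≤ l t * (‖x - y‖ + wass 1 μ ν) := by
  obtain ⟨l, L, hl0, hL0, hl, hL, hle⟩ := hv.lipschitz R hR
  refine ⟨(Icc 0 T).indicator (l + L), (hl.add hL).integrable_indicator measurableSet_Icc,
    indicator_nonneg fun t _ => add_nonneg (hl0 t) (hL0 t), ?_⟩
  filter_upwards [hle, ae_restrict_mem measurableSet_Icc] with t ht hmem u μ hμ ν hν x hx y hy
  rw [indicator_of_mem hmem, Pi.add_apply]
  have hlt := hl0 t
  have hLt := hL0 t
  have hwass := wass_nonneg 1 μ ν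
  calc ‖v t μ u x - v t ν u y‖ ≤ ‖v t μ u x - v t μ u y‖ + ‖v t μ u y - v t ν u y‖ :=
        norm_sub_le_norm_sub_add_norm_sub _ _ _
    _ ≤ l t * ‖x - y‖ + L t * wass 1 μ ν :=
        add_le_add (ht u μ hμ ν hν x hx y hy).1 (ht u μ hμ ν hν y hy y hy).2
    _ ≤ (l t + L t) * (‖x - y‖ + wass 1 μ ν) := by
        nlinarith [mul_nonneg hlt hwass, mul_nonneg hLt (norm_nonneg (x - y))]

theorem exists_isTruncation (hv : RegularDynamics T v) {S : ℝ} (hS : 0 < S) :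
    ∃ P C m, IsTruncation T v S P C m := by
  obtain ⟨P, C, hPC, hP_self, hP_norm, hP_le⟩ := exists_truncation (E d) hS
  obtain ⟨m, hm, hm0, hgrowth⟩ := hv.exists_growth_rate
  obtain ⟨l, hl, hl0, hlip⟩ := hv.exists_lipschitz_rate (R := 2 * S) (by positivity)
  refine ⟨BoundedContinuousFunction.ofNormedAddCommGroup P hPC.continuous _ hP_le, C,
    fun t => (1 + 4 * S) * m t + (C + 1) * l t, (hm.const_mul _).add (hl.const_mul _),
    fun t => ?_, hPC, hP_self, hP_norm, hP_le, ?_, ?_⟩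
  · have := hm0 t
    have := hl0 t
    positivity
  · filter_upwards [hgrowth] with t ht u μ hμ x
    have hmoment : ∫ y, ‖y‖ ∂μ.toMeasure ≤ 2 * S :=
      (integral_mono_ae (μ.integrable_of_continuous continuous_norm) (integrable_const (2 * S))
        (mem_POn_closedBall_iff.1 hμ)).trans (by simp)
    have hmt := hm0 t
    have hlt := mul_nonneg (add_nonneg C.coe_nonneg zero_le_one) (hl0 t)
    calc ‖v t μ u (P x)‖ ≤ m t * (1 + ‖P x‖ + ∫ y, ‖y‖ ∂μ.toMeasure) := ht u μ _
      _ ≤ m t * (1 + 2 * S + 2 * S) := by gcongr; exact hP_le x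
      _ ≤ (1 + 4 * S) * m t + (C + 1) * l t := by linarith
  · filter_upwards [hlip] with t ht u μ hμ ν hν x y
    have hPball : ∀ x, P x ∈ Metric.closedBall (0 : E d) (2 * S) := fun x => by simpa using hP_le x
    have hmt := mul_nonneg (by positivity : 0 ≤ 1 + 4 * S) (hm0 t)
    have hlt := hl0 t
    have hwass := wass_nonneg 1 μ ν
    calc ‖v t μ u (P x) - v t ν u (P y)‖ ≤ l t * (‖P x - P y‖ + wass 1 μ ν) :=
          ht u μ hμ ν hν _ (hPball x) _ (hPball y)
      _ ≤ l t * (C * ‖x - y‖ + wass 1 μ ν) := by gcongr; exact hPC.norm_sub_le x y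
      _ ≤ l t * ((C + 1) * (‖x - y‖ + wass 1 μ ν)) := by
          gcongr
          nlinarith [norm_nonneg (x - y), mul_nonneg C.coe_nonneg hwass]
      _ ≤ ((1 + 4 * S) * m t + (C + 1) * l t) * (‖x - y‖ + wass 1 μ ν) := by
          nlinarith [mul_nonneg hmt (add_nonneg (norm_nonneg (x - y)) hwass)]

end RegularDynamics

variable {S : ℝ} {P : E d →ᵇ E d} {C : ℝ≥0} {m : ℝ → ℝ} {a : ℝ}

theorem IsTruncation.ae_norm_velocity_sub_le_mul (hP : IsTruncation T v S P C m) :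
    ∀ᵐ t ∂volume.restrict (Icc 0 T), ∀ u, ∀ μ ∈ POn (Metric.closedBall (0 : E d) (2 * S)),
      ∀ x y, ‖v t μ u (P x) - v t μ u (P y)‖ ≤ m t * ‖x - y‖ := by
  filter_upwards [hP.norm_velocity_sub_le] with t ht u μ hμ x y
  simpa only [wass_one_self, add_zero] using ht u μ hμ μ hμ x y

theorem IsTruncation.truncatedLaw_mem_POn (hP : IsTruncation T v S P C m) (ρ : Pc (E d))
    (Y : E d →ᵇ E d) : truncatedLaw ρ P Y ∈ POn (Metric.closedBall (0 : E d) (2 * S)) :=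
  Pc.map_mem_POn_closedBall (Eventually.of_forall fun _ => hP.norm_le _)

theorem IsTruncation.norm_le_of_eq_add_integral (hP : IsTruncation T v S P C m) (ha : a ∈ Icc 0 T)
    (ρ : Pc (E d)) {u : ℝ → U} {k : ℝ → ℝ} (hk : Integrable k) (hk0 : ∀ t, 0 ≤ k t)
    (hgrowth : ∀ᵐ t ∂volume.restrict (Icc 0 T), ∀ u μ x,
      ‖v t μ u x‖ ≤ k t * (1 + ‖x‖ + ∫ y, ‖y‖ ∂μ.toMeasure))
    {Y : ℝ → (E d →ᵇ E d)} (hY : Continuous Y) (hYeq : ∀ t ∈ Icc a T, ∀ x,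
      Y t x = Y a x + ∫ s in a..t, v s (truncatedLaw ρ P (Y s)) (u s) (P (Y s x)))
    {t : ℝ} (ht : t ∈ Icc a T) :
    ‖Y t‖ ≤ (1 + ‖Y a‖) * Real.exp (∫ s in a..T, 2 * k s) := by
  have hle : ∀ᵐ s ∂volume.restrict (Icc a T), ∀ x,
      ‖v s (truncatedLaw ρ P (Y s)) (u s) (P (Y s x))‖ ≤ 2 * k s * (1 + ‖Y s‖) := by
    filter_upwards [ae_restrict_of_ae_restrict_of_subset (Icc_subset_Icc_left ha.1) hgrowth]
      with s hs x
    have hks := hk0 s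
    have hx := (hP.norm_le_norm _).trans ((Y s).norm_coe_le_norm x)
    have hmoment := integral_norm_truncatedLaw_le ρ hP.norm_le_norm (Y s)
    calc _ ≤ k s * (1 + ‖P (Y s x)‖ + ∫ y, ‖y‖ ∂(truncatedLaw ρ P (Y s)).toMeasure) := hs _ _ _
      _ ≤ k s * (2 * (1 + ‖Y s‖)) := by gcongr; linarith
      _ = 2 * k s * (1 + ‖Y s‖) := by ring
  have hk2 : ∀ s, 0 ≤ 2 * k s := fun s => mul_nonneg zero_le_two (hk0 s)
  calc ‖Y t‖ ≤ 1 + ‖Y t‖ := le_add_of_nonneg_left zero_le_one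
    _ ≤ (1 + ‖Y a‖) * Real.exp (∫ s in a..t, 2 * k s) :=
        one_add_norm_le_mul_exp hY (hk.const_mul 2) hk2 hYeq hle ht
    _ ≤ (1 + ‖Y a‖) * Real.exp (∫ s in a..T, 2 * k s) := by
        gcongr
        exact primitive_mono (hk.const_mul 2) hk2 ht.2

variable [TopologicalSpace U]

theorem IsTruncation.ae_continuous_velocity (hP : IsTruncation T v S P C m)
    (hv : RegularDynamics T v) {α : Type*} [TopologicalSpace α] {σ : α → Pc (E d)}
    (hσ : ∀ p, σ p ∈ POn (Metric.closedBall (0 : E d) (2 * S)))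
    (hσ_cont : ∀ p, Tendsto (fun q => wass 1 (σ q) (σ p)) (𝓝 p) (𝓝 0)) (x : E d) :
    ∀ᵐ t ∂volume.restrict (Icc 0 T), Continuous fun q : α × U => v t (σ q.1) q.2 (P x) := by
  filter_upwards [hP.norm_velocity_sub_le, hv.continuous_control] with t hlip hcont
  refine continuous_iff_continuousAt.2 fun p => tendsto_iff_norm_sub_tendsto_zero.2 ?_
  have hwass : Tendsto (fun q : α × U => m t * wass 1 (σ q.1) (σ p.1)) (𝓝 p) (𝓝 0) := by
    simpa using ((hσ_cont p.1).comp (continuous_fst.tendsto p)).const_mul (m t)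
  have hcontrol : Tendsto (fun q : α × U => ‖v t (σ p.1) q.2 (P x) - v t (σ p.1) p.2 (P x)‖)
      (𝓝 p) (𝓝 0) :=
    tendsto_iff_norm_sub_tendsto_zero.1 (((hcont (σ p.1) (P x)).comp continuous_snd).tendsto p)
  refine squeeze_zero (fun _ => norm_nonneg _) (fun q => ?_) (by simpa using hwass.add hcontrol)
  refine (norm_sub_le_norm_sub_add_norm_sub _ (v t (σ p.1) q.2 (P x)) _).trans
    (add_le_add_left ?_ _)
  simpa using hlip q.2 _ (hσ q.1) _ (hσ p.1) x x

variable [TopologicalSpace.MetrizableSpace U] [SecondCountableTopology U] [MeasurableSpace U]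
  [BorelSpace U] {b : ℝ} {u : ℝ → U}

theorem IsTruncation.isLipschitzField (hP : IsTruncation T v S P C m) (hv : RegularDynamics T v)
    (hab : a ≤ b) (hsub : Icc a b ⊆ Icc 0 T) {μ : ℝ → Pc (E d)}
    (hμ : ∀ t ∈ Icc a b, μ t ∈ POn (Metric.closedBall (0 : E d) (2 * S)))
    (hμ_cont : ∀ t ∈ Icc a b, Tendsto (fun s => wass 1 (μ s) (μ t)) (𝓝[Icc a b] t) (𝓝 0))
    (hu : u ∈ controls U T) : IsLipschitzField a b m (fun t x => v t (μ t) (u t) (P x)) := by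
  have hrestrict : volume.restrict (Icc a b) ≤ volume.restrict (Icc 0 T) :=
    Measure.restrict_mono hsub le_rfl
  refine ⟨fun x => ?_, ?_, ?_⟩
  · have hcont : ∀ᵐ t ∂volume.restrict (Icc a b),
        Continuous fun q : Icc a b × U => v t (μ q.1) q.2 (P x) :=
      ae_mono hrestrict (hP.ae_continuous_velocity hv (σ := fun p : Icc a b => μ p)
        (fun p => hμ p p.2) (fun p => (hμ_cont p p.2).comp
          (by rw [← map_nhds_subtype_val p]; exact tendsto_map)) x)
    have hmeas := aestronglyMeasurable_comp_caratheodory (lam := volume.restrict (Icc a b))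
      (x := fun s => (projIcc a b hab s, u s)) hcont
      (fun p => (hv.measurable_time _ _ _).mono_measure hrestrict)
      (continuous_projIcc.aemeasurable.prodMk (AEMeasurable.mono_measure hu hrestrict))
    refine hmeas.congr ?_
    filter_upwards [ae_restrict_mem measurableSet_Icc] with s hs
    simp only [projIcc_of_mem hab hs]
  · filter_upwards [ae_mono hrestrict hP.norm_velocity_le, ae_restrict_mem measurableSet_Icc]
      with t ht hmem x using ht _ _ (hμ t hmem) x
  · filter_upwards [ae_mono hrestrict hP.ae_norm_velocity_sub_le_mul,
      ae_restrict_mem measurableSet_Icc] with t ht hmem x y using ht _ _ (hμ t hmem) x y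

section MeanField

variable (hP : IsTruncation T v S P C m) (hv : RegularDynamics T v) (ha : a ∈ Icc 0 T)
  (ρ : Pc (E d)) (hu : u ∈ controls U T)

include hP hv ha hu

theorem IsTruncation.isLipschitzField_truncatedLaw {Y : ℝ → (E d →ᵇ E d)} (hY : Continuous Y) :
    IsLipschitzField a T m (fun t x => v t (truncatedLaw ρ P (Y t)) (u t) (P x)) :=
  hP.isLipschitzField hv ha.2 (Icc_subset_Icc_left ha.1)
    (fun t _ => hP.truncatedLaw_mem_POn ρ (Y t)) (fun t _ =>
      (tendsto_wass_truncatedLaw ρ hP.lipschitzWith hY t).mono_left nhdsWithin_le_nhds) hu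

theorem IsTruncation.isCaratheodoryField : IsCaratheodoryField a T (fun t => (1 + C) * m t)
    (fun t Y x => v t (truncatedLaw ρ P Y) (u t) (P (Y x))) := by
  have hrestrict : volume.restrict (Icc a T) ≤ volume.restrict (Icc 0 T) :=
    Measure.restrict_mono (Icc_subset_Icc_left ha.1) le_rfl
  refine ⟨fun Y hY x => ?_, ?_, ?_, ?_⟩
  · have hw := hP.isLipschitzField_truncatedLaw hv ha ρ hu hY
    exact aestronglyMeasurable_comp_caratheodory hw.ae_continuous hw.aestronglyMeasurable
      (x := fun s => Y s x) ((continuous_eval_const x).comp hY).aemeasurable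
  · filter_upwards [ae_mono hrestrict hP.ae_norm_velocity_sub_le_mul] with t ht Y
    have hlip : LipschitzWith (m t).toNNReal fun z => v t (truncatedLaw ρ P Y) (u t) (P z) :=
      LipschitzWith.of_dist_le_mul fun x y => by
        rw [dist_eq_norm, dist_eq_norm, Real.coe_toNNReal _ (hP.nonneg t)]
        exact ht _ _ (hP.truncatedLaw_mem_POn ρ Y) x y
    exact hlip.continuous.comp Y.continuous
  · filter_upwards [ae_mono hrestrict hP.norm_velocity_le] with t ht Y x
    refine (ht _ _ (hP.truncatedLaw_mem_POn ρ Y) _).trans ?_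
    exact le_mul_of_one_le_left (hP.nonneg t) (le_add_of_nonneg_right C.coe_nonneg)
  · filter_upwards [ae_mono hrestrict hP.norm_velocity_sub_le] with t ht Y Y' x
    have hmt := hP.nonneg t
    calc _ ≤ m t * (‖Y x - Y' x‖ + wass 1 (truncatedLaw ρ P Y) (truncatedLaw ρ P Y')) :=
          ht _ _ (hP.truncatedLaw_mem_POn ρ Y) _ (hP.truncatedLaw_mem_POn ρ Y') _ _
      _ ≤ m t * (dist Y Y' + C * dist Y Y') := by
          gcongr
          · exact (dist_eq_norm (Y x) (Y' x)).symm.trans_le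
              (BoundedContinuousFunction.dist_coe_le_dist x)
          · exact wass_truncatedLaw_le ρ hP.lipschitzWith Y Y'
      _ = (1 + C) * m t * dist Y Y' := by ring

end MeanField

/-- The sup norm of the flow of the truncated velocity is bounded by the growth rate alone, so a
large enough truncation radius is never reached. -/
theorem RegularDynamics.exists_isTrajectory (hv : RegularDynamics T v) (ha : a ∈ Icc 0 T)
    (ρ : Pc (E d)) (hu : u ∈ controls U T) : ∃ μ, IsTrajectory T v a ρ μ u := by
  obtain ⟨R, hR, hρ⟩ := ρ.exists_mem_POn_closedBall
  obtain ⟨X₀, _, _, hX₀⟩ := hv.exists_isTruncation hR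
  obtain ⟨k, hk, hk0, hgrowth⟩ := hv.exists_growth_rate
  set S : ℝ := (1 + ‖X₀‖) * Real.exp (∫ s in a..T, 2 * k s)
  obtain ⟨P, C, m, hP⟩ := hv.exists_isTruncation (S := S) (by positivity)
  obtain ⟨Y, hY, hYeq⟩ := (hP.isCaratheodoryField hv ha ρ hu).exists_integral_curve ha.2
    (hP.integrable.const_mul _) (fun t => mul_nonneg (by positivity) (hP.nonneg t)) X₀
  have hYa : Y a = X₀ := by
    ext1 x
    simpa using hYeq a ⟨le_rfl, ha.2⟩ x
  rw [← hYa] at hYeq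
  have hnorm : ∀ t ∈ Icc a T, ‖Y t‖ ≤ S := fun t ht => by
    simpa only [hYa] using hP.norm_le_of_eq_add_integral ha ρ hk hk0 hgrowth hY hYeq ht
  have hlaw : ∀ t ∈ Icc a T, truncatedLaw ρ P (Y t) = ρ.map (Y t) (Y t).continuous := fun t ht =>
    Pc.ext_of_toMeasure (Measure.map_congr (Eventually.of_forall fun x =>
      hP.eq_self _ (((Y t).norm_coe_le_norm x).trans (hnorm t ht))))
  refine ⟨fun t => ρ.map (Y t) (Y t).continuous, ?_, ?_⟩
  · have hflow : IsFlow a T (fun t x => v t (truncatedLaw ρ P (Y t)) (u t) (P x)) Y := ⟨hY, hYeq⟩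
    refine (hflow.solvesCE hP.integrable
      (hP.isLipschitzField_truncatedLaw hv ha ρ hu hY) ρ).congr_field ?_
    filter_upwards [ae_restrict_mem measurableSet_Icc] with t ht
    have hmem : ρ.map (Y t) (Y t).continuous ∈ POn (Metric.closedBall (0 : E d) S) :=
      Pc.map_mem_POn_closedBall (Eventually.of_forall fun x =>
        ((Y t).norm_coe_le_norm x).trans (hnorm t ht))
    filter_upwards [mem_POn_closedBall_iff.1 hmem] with x hx
    rw [hP.eq_self x hx, hlaw t ht]
  · refine Pc.map_eq_self ?_
    filter_upwards [mem_POn_closedBall_iff.1 hρ] with x hx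
    rw [hYa, hX₀.eq_self x hx]

end Trajectories

section Stability

theorem SolvesCE.continuousOn_integral_of_lipschitzWith {X : Type*} [NormedAddCommGroup X]
    [NormedSpace ℝ X] [SecondCountableTopology X] [MeasurableSpace X] [BorelSpace X] {a b : ℝ}
    {w : ℝ → X → X} {μ : ℝ → Pc X} (h : SolvesCE a b w μ) {f : X → ℝ} {K : ℝ≥0}
    (hf : LipschitzWith K f) : ContinuousOn (fun t => ∫ x, f x ∂(μ t).toMeasure) (Icc a b) :=
  fun t ht => tendsto_iff_norm_sub_tendsto_zero.2 <| squeeze_zero (fun _ => norm_nonneg _)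
    (fun s => abs_integral_sub_le_mul_wass_one hf (μ s) (μ t))
    (by simpa using (h.1 t ht).const_mul (K : ℝ))

theorem wass_one_le_of_mem_POn_closedBall {X : Type*} [NormedAddCommGroup X]
    [SecondCountableTopology X] [MeasurableSpace X] [BorelSpace X] {R : ℝ} {μ ν : Pc X}
    (hμ : μ ∈ POn (Metric.closedBall (0 : X) R)) (hν : ν ∈ POn (Metric.closedBall (0 : X) R)) :
    wass 1 μ ν ≤ 2 * R := by
  have hdist : ∀ᵐ z ∂μ.toMeasure.prod ν.toMeasure, dist z.1 z.2 ≤ 2 * R := by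
    filter_upwards [Measure.quasiMeasurePreserving_fst.ae (mem_POn_closedBall_iff.1 hμ),
      Measure.quasiMeasurePreserving_snd.ae (mem_POn_closedBall_iff.1 hν)] with z hz₁ hz₂
    linarith [dist_le_norm_add_norm z.1 z.2]
  have hint : Integrable (fun z : X × X => dist z.1 z.2) (μ.toMeasure.prod ν.toMeasure) :=
    Integrable.of_bound continuous_dist.aestronglyMeasurable (2 * R) (by simpa using hdist)
  refine (wass_one_le_integral_dist (P := μ.toMeasure.prod ν.toMeasure) (f := Prod.fst)
    (g := Prod.snd) measurable_fst.aemeasurable measurable_snd.aemeasurable (by simp) (by simp)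
    hint).trans ?_
  exact (integral_mono_ae hint (integrable_const _) hdist).trans (by simp)

theorem wass_one_map_le_of_mem_plans {X Y : Type*} [MetricSpace X] [SecondCountableTopology X]
    [MeasurableSpace X] [BorelSpace X] [MetricSpace Y] [SecondCountableTopology Y]
    [MeasurableSpace Y] [BorelSpace Y] {μ ν : Pc X} {γ : Measure (X × X)}
    (hγ : γ ∈ plans μ.toMeasure ν.toMeasure) {f g : X → Y} (hf : Continuous f) (hg : Continuous g)
    (hfg : Integrable (fun z : X × X => dist (f z.1) (g z.2)) γ) :
    wass 1 (μ.map f hf) (ν.map g hg) ≤ ∫ z, dist (f z.1) (g z.2) ∂γ := by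
  obtain ⟨hprob, hfst, hsnd⟩ := hγ
  refine wass_one_le_integral_dist (hf.measurable.comp measurable_fst).aemeasurable
    (hg.measurable.comp measurable_snd).aemeasurable ?_ ?_ hfg
  · rw [← Measure.map_map hf.measurable measurable_fst, hfst]
    rfl
  · rw [← Measure.map_map hg.measurable measurable_snd, hsnd]
    rfl

section Coupling

variable {α X : Type*} [TopologicalSpace α] [SecondCountableTopology α] [MeasurableSpace α]
  [OpensMeasurableSpace α] [NormedAddCommGroup X] {γ : Measure (α × α)}

theorem integrable_dist_comp_fst_snd [IsFiniteMeasure γ] (Y Y' : α →ᵇ X) :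
    Integrable (fun z : α × α => dist (Y z.1) (Y' z.2)) γ := by
  refine Integrable.of_bound (Continuous.aestronglyMeasurable ((Y.continuous.comp
    continuous_fst).dist (Y'.continuous.comp continuous_snd))) (‖Y‖ + ‖Y'‖)
    (Eventually.of_forall fun z => ?_)
  rw [Real.norm_of_nonneg dist_nonneg]
  exact (dist_le_norm_add_norm _ _).trans
    (add_le_add (Y.norm_coe_le_norm z.1) (Y'.norm_coe_le_norm z.2))

theorem continuous_integral_dist_comp_fst_snd [IsProbabilityMeasure γ] {Y Y' : ℝ → (α →ᵇ X)}
    (hY : Continuous Y) (hY' : Continuous Y') :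
    Continuous fun t => ∫ z, dist (Y t z.1) (Y' t z.2) ∂γ := by
  refine continuous_iff_continuousAt.2 fun t => tendsto_iff_dist_tendsto_zero.2 ?_
  have hcont : Continuous fun s => dist (Y s) (Y t) + dist (Y' s) (Y' t) := by fun_prop
  refine squeeze_zero (fun _ => dist_nonneg) (fun s => ?_) (by simpa using hcont.tendsto t)
  have hdiff : ∀ z : α × α, ‖dist (Y s z.1) (Y' s z.2) - dist (Y t z.1) (Y' t z.2)‖ ≤
      dist (Y s) (Y t) + dist (Y' s) (Y' t) := fun z =>
    (dist_dist_dist_le _ _ _ _).trans (add_le_add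
      (BoundedContinuousFunction.dist_coe_le_dist z.1)
      (BoundedContinuousFunction.dist_coe_le_dist z.2))
  rw [Real.dist_eq, ← integral_sub (integrable_dist_comp_fst_snd _ _)
    (integrable_dist_comp_fst_snd _ _), ← Real.norm_eq_abs]
  exact (norm_integral_le_of_norm_le_const (Eventually.of_forall hdiff)).trans_eq
    (by rw [probReal_univ, mul_one])

end Coupling

variable {X : Type*} [NormedAddCommGroup X] [NormedSpace ℝ X] [FiniteDimensional ℝ X]
  {a b : ℝ} {m : ℝ → ℝ} {w₁ w₂ : ℝ → X → X} {Y₁ Y₂ : ℝ → (X →ᵇ X)}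

theorem IsFlow.norm_sub_le_mul_exp (hY₁ : IsFlow a b w₁ Y₁) (hY₂ : IsFlow a b w₂ Y₂)
    (hw₁ : IsLipschitzField a b m w₁) (hw₂ : IsLipschitzField a b m w₂) (hm : Integrable m)
    (hm0 : ∀ t, 0 ≤ m t) {g : ℝ → ℝ} (hg : Continuous g) (hg0 : ∀ t, 0 ≤ g t)
    (hw : ∀ᵐ t ∂volume.restrict (Icc a b), ∀ x y,
      ‖w₁ t x - w₂ t y‖ ≤ m t * (‖x - y‖ + g t)) {t : ℝ} (ht : t ∈ Icc a b) (x y : X) :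
    ‖Y₁ t x - Y₂ t y‖ ≤
      (‖Y₁ a x - Y₂ a y‖ + ∫ s in a..t, m s * g s) * Real.exp (∫ s in a..t, m s) := by
  have hcont : Continuous fun s => ‖Y₁ s x - Y₂ s y‖ :=
    ((hY₁.continuous_apply x).sub (hY₂.continuous_apply y)).norm
  have hmul : ∀ {f : ℝ → ℝ}, Continuous f → ∀ s s', IntervalIntegrable (fun r => m r * f r)
      volume s s' := fun hf s s' => hm.intervalIntegrable.mul_continuousOn hf.continuousOn
  refine le_mul_exp_of_le_add_integral hm hm0 ht.1 hcont.continuousOn fun s hs => ?_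
  have hsb : s ∈ Icc a b := ⟨hs.1, hs.2.trans ht.2⟩
  have ha : a ∈ Icc a b := ⟨le_rfl, ht.1.trans ht.2⟩
  have hg_le : ∫ r in a..s, m r * g r ≤ ∫ r in a..t, m r * g r :=
    intervalIntegral.integral_mono_interval le_rfl hs.1 hs.2
      (Eventually.of_forall fun r => mul_nonneg (hm0 r) (hg0 r)) (hmul hg a t)
  have hincr : ‖∫ r in a..s, (w₁ r (Y₁ r x) - w₂ r (Y₂ r y))‖ ≤
      ∫ r in a..s, (m r * ‖Y₁ r x - Y₂ r y‖ + m r * g r) :=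
    norm_intervalIntegral_le_of_ae_le le_rfl hs.1 hsb.2
      (hw.mono fun r hr => (hr _ _).trans_eq (mul_add _ _ _))
      (((hm.integrableOn (s := Icc a b)).mul_continuousOn hcont.continuousOn isCompact_Icc).add
        (hm.integrableOn.mul_continuousOn hg.continuousOn isCompact_Icc))
  rw [intervalIntegral.integral_add (hmul hcont a s) (hmul hg a s),
    intervalIntegral.integral_sub
      (intervalIntegrable_of_integrableOn_Icc (hY₁.integrableOn hm hw₁ x) ha hsb)
      (intervalIntegrable_of_integrableOn_Icc (hY₂.integrableOn hm hw₂ y) ha hsb)] at hincr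
  rw [hY₁.eq_add_integral s hsb x, hY₂.eq_add_integral s hsb y, add_sub_add_comm]
  linarith [norm_add_le (Y₁ a x - Y₂ a y)
    ((∫ r in a..s, w₁ r (Y₁ r x)) - ∫ r in a..s, w₂ r (Y₂ r y))]

variable [MeasurableSpace X] [BorelSpace X]

theorem IsFlow.integral_dist_le (hab : a ≤ b) (hY₁ : IsFlow a b w₁ Y₁) (hY₂ : IsFlow a b w₂ Y₂)
    (hw₁ : IsLipschitzField a b m w₁) (hw₂ : IsLipschitzField a b m w₂) (hm : Integrable m)
    (hm0 : ∀ t, 0 ≤ m t) {M : ℝ} (hM : ∫ s in a..b, m s ≤ M) {C : ℝ≥0}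
    (hC : ∀ x y, dist (Y₁ a x) (Y₂ a y) ≤ C * dist x y) {γ : Measure (X × X)}
    [IsProbabilityMeasure γ] (hγ : Integrable (fun z : X × X => dist z.1 z.2) γ)
    (hw : ∀ᵐ t ∂volume.restrict (Icc a b), ∀ x y, ‖w₁ t x - w₂ t y‖ ≤
      m t * (‖x - y‖ + ∫ z, dist (Y₁ t z.1) (Y₂ t z.2) ∂γ)) :
    ∫ z, dist (Y₁ b z.1) (Y₂ b z.2) ∂γ ≤
      C * Real.exp M * Real.exp (Real.exp M * M) * ∫ z, dist z.1 z.2 ∂γ := by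
  set D : ℝ → ℝ := fun t => ∫ z, dist (Y₁ t z.1) (Y₂ t z.2) ∂γ
  set I : ℝ := ∫ z, dist z.1 z.2 ∂γ
  have hD : Continuous D := continuous_integral_dist_comp_fst_snd hY₁.continuous hY₂.continuous
  have hD0 : ∀ t, 0 ≤ D t := fun t => integral_nonneg fun _ => dist_nonneg
  have : 0 ≤ I := integral_nonneg fun _ => dist_nonneg
  have hle : ∀ t ∈ Icc a b, D t ≤ C * Real.exp M * I + ∫ s in a..t, Real.exp M * m s * D s := by
    intro t ht
    set J : ℝ := ∫ s in a..t, m s * D s with hJ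
    have hJ0 : 0 ≤ J := intervalIntegral.integral_nonneg ht.1 fun s _ => mul_nonneg (hm0 s) (hD0 s)
    have hpoint : ∀ z : X × X, dist (Y₁ t z.1) (Y₂ t z.2) ≤
        (C * dist z.1 z.2 + J) * Real.exp M := fun z => by
      rw [dist_eq_norm]
      refine (hY₁.norm_sub_le_mul_exp hY₂ hw₁ hw₂ hm hm0 hD hD0 hw ht z.1 z.2).trans ?_
      gcongr
      · exact (dist_eq_norm _ _).symm.trans_le (hC z.1 z.2)
      · exact (primitive_mono hm hm0 ht.2).trans hM
    calc D t ≤ ∫ z, (C * dist z.1 z.2 + J) * Real.exp M ∂γ :=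
          integral_mono (integrable_dist_comp_fst_snd _ _)
            (((hγ.const_mul _).add (integrable_const J)).mul_const _) hpoint
      _ = (C * I + J) * Real.exp M := by
          rw [integral_mul_const, integral_add (hγ.const_mul _) (integrable_const J),
            integral_const_mul, integral_const, probReal_univ, one_smul]
      _ = C * Real.exp M * I + ∫ s in a..t, Real.exp M * m s * D s := by
          simp only [mul_assoc, intervalIntegral.integral_const_mul, ← hJ]
          ring
  calc D b ≤ C * Real.exp M * I * Real.exp (∫ s in a..b, Real.exp M * m s) :=
        le_mul_exp_of_le_add_integral (hm.const_mul _)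
          (fun s => mul_nonneg (Real.exp_pos M).le (hm0 s)) hab hD.continuousOn hle
    _ ≤ C * Real.exp M * I * Real.exp (Real.exp M * M) := by
        rw [intervalIntegral.integral_const_mul]
        gcongr
    _ = C * Real.exp M * Real.exp (Real.exp M * M) * I := by ring

theorem IsFlow.wass_map_le (hab : a ≤ b) (hY₁ : IsFlow a b w₁ Y₁) (hY₂ : IsFlow a b w₂ Y₂)
    (hw₁ : IsLipschitzField a b m w₁) (hw₂ : IsLipschitzField a b m w₂) (hm : Integrable m)
    (hm0 : ∀ t, 0 ≤ m t) {M : ℝ} (hM : ∫ s in a..b, m s ≤ M) {C : ℝ≥0}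
    (hC : ∀ x y, dist (Y₁ a x) (Y₂ a y) ≤ C * dist x y) {ρ₁ ρ₂ : Pc X}
    (hw : ∀ᵐ t ∂volume.restrict (Icc a b), ∀ x y, ‖w₁ t x - w₂ t y‖ ≤ m t * (‖x - y‖ +
      wass 1 (ρ₁.map (Y₁ t) (Y₁ t).continuous) (ρ₂.map (Y₂ t) (Y₂ t).continuous))) :
    wass 1 (ρ₁.map (Y₁ b) (Y₁ b).continuous) (ρ₂.map (Y₂ b) (Y₂ b).continuous) ≤
      C * Real.exp M * Real.exp (Real.exp M * M) * wass 1 ρ₁ ρ₂ := by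
  set K : ℝ := C * Real.exp M * Real.exp (Real.exp M * M)
  have hK : 0 ≤ K := by positivity
  have hplan : ∀ ε > 0, wass 1 (ρ₁.map (Y₁ b) (Y₁ b).continuous)
      (ρ₂.map (Y₂ b) (Y₂ b).continuous) ≤ K * (wass 1 ρ₁ ρ₂ + ε) := by
    intro ε hε
    obtain ⟨γ, hγ, hγ_le⟩ := exists_plan_integral_dist_le ρ₁ ρ₂ hε
    have := hγ.1
    have hwass : ∀ t, wass 1 (ρ₁.map (Y₁ t) (Y₁ t).continuous)
        (ρ₂.map (Y₂ t) (Y₂ t).continuous) ≤ ∫ z, dist (Y₁ t z.1) (Y₂ t z.2) ∂γ := fun t =>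
      wass_one_map_le_of_mem_plans hγ _ _ (integrable_dist_comp_fst_snd _ _)
    refine (hwass b).trans ((IsFlow.integral_dist_le hab hY₁ hY₂ hw₁ hw₂ hm hm0 hM hC
      (integrable_dist_of_mem_plans hγ) ?_).trans (mul_le_mul_of_nonneg_left hγ_le hK))
    filter_upwards [hw] with t ht x y
    exact (ht x y).trans (mul_le_mul_of_nonneg_left (add_le_add_right (hwass t) _) (hm0 t))
  have hlim : Tendsto (fun ε => K * (wass 1 ρ₁ ρ₂ + ε)) (𝓝[>] 0) (𝓝 (K * wass 1 ρ₁ ρ₂)) := by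
    have hcont : Continuous fun ε => K * (wass 1 ρ₁ ρ₂ + ε) := by fun_prop
    simpa using (hcont.tendsto 0).mono_left nhdsWithin_le_nhds
  exact ge_of_tendsto hlim (eventually_mem_nhdsWithin.mono hplan)

end Stability

section Value

variable {d : ℕ} {U : Type*} {T : ℝ} {v : ℝ → Pc (E d) → U → E d → E d} {φ : Pc (E d) → ℝ}
  {a : ℝ} {ρ : Pc (E d)} {μ : ℝ → Pc (E d)} {u : ℝ → U}

theorem IsTrajectory.mono {b : ℝ} (h : IsTrajectory T v a ρ μ u) (hab : a ≤ b) :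
    IsTrajectory T v b (μ b) μ u :=
  ⟨h.1.mono (Icc_subset_Icc_left hab), rfl⟩

/-- `φ` is Lipschitz for the distance `W₁` on the measures concentrated on a given ball. -/
def IsLipschitzOnBalls (φ : Pc (E d) → ℝ) : Prop :=
  ∀ R > 0, ∃ L : ℝ, ∀ μ ∈ POn (Metric.closedBall (0 : E d) R),
    ∀ ν ∈ POn (Metric.closedBall (0 : E d) R), |φ μ - φ ν| ≤ L * wass 1 μ ν

theorem IsLipschitzOnBalls.exists_nonneg (hφ : IsLipschitzOnBalls φ) {R : ℝ} (hR : 0 < R) :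
    ∃ L, 0 ≤ L ∧ ∀ μ ∈ POn (Metric.closedBall (0 : E d) R),
      ∀ ν ∈ POn (Metric.closedBall (0 : E d) R), |φ μ - φ ν| ≤ L * wass 1 μ ν := by
  obtain ⟨L, hL⟩ := hφ R hR
  exact ⟨|L|, abs_nonneg L, fun μ hμ ν hν => (hL μ hμ ν hν).trans
    (mul_le_mul_of_nonneg_right (le_abs_self L) (wass_nonneg _ _ _))⟩

theorem IsTruncation.closedBall_subset {S : ℝ} {P : E d →ᵇ E d} {C : ℝ≥0} {m : ℝ → ℝ}
    (hP : IsTruncation T v S P C m) :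
    Metric.closedBall (0 : E d) S ⊆ Metric.closedBall 0 (2 * S) :=
  Metric.closedBall_subset_closedBall (by linarith [(norm_nonneg _).trans (hP.norm_le 0)])

variable [TopologicalSpace U]

namespace RegularDynamics

theorem exists_support_bound_of_moment_le (hv : RegularDynamics T v) (R L : ℝ) :
    ∃ S, ∀ a ∈ Icc 0 T, ∀ μ (u : ℝ → U), SolvesCE a T (fun t => v t (μ t) (u t)) μ →
      μ a ∈ POn (Metric.closedBall (0 : E d) R) →
      (∀ t ∈ Icc a T, ∫ y, ‖y‖ ∂(μ t).toMeasure ≤ L) →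
      ∀ t ∈ Icc a T, μ t ∈ POn (Metric.closedBall (0 : E d) S) := by
  obtain ⟨m, hm, hm0, hgrowth⟩ := hv.exists_growth_rate
  obtain ⟨C, hC, hsupp⟩ := SolvesCE.exists_support_bound (E d)
  refine ⟨√(1 + R ^ 2) * Real.exp (C * ((1 + L) * ∫ s in 0..T, m s)),
    fun a ha μ u h hR hL t ht => ?_⟩
  have hL0 : 0 ≤ L := (integral_nonneg fun _ => norm_nonneg _).trans (hL t ht)
  have hlinear : ∀ᵐ s ∂volume.restrict (Icc a T), ∀ x,
      ‖v s (μ s) (u s) x‖ ≤ (1 + L) * m s * (1 + ‖x‖) := by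
    filter_upwards [ae_restrict_of_ae_restrict_of_subset (Icc_subset_Icc_left ha.1) hgrowth,
      ae_restrict_mem measurableSet_Icc] with s hs hmem x
    calc ‖v s (μ s) (u s) x‖ ≤ m s * (1 + ‖x‖ + ∫ y, ‖y‖ ∂(μ s).toMeasure) := hs _ _ _
      _ ≤ m s * ((1 + L) * (1 + ‖x‖)) := by
          refine mul_le_mul_of_nonneg_left ?_ (hm0 s)
          linarith [hL s hmem, mul_nonneg hL0 (norm_nonneg x)]
      _ = (1 + L) * m s * (1 + ‖x‖) := by ring
  refine POn_mono (Metric.closedBall_subset_closedBall ?_) (hsupp h (hm.const_mul (1 + L))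
    (fun s => mul_nonneg (by positivity) (hm0 s)) hlinear hR t ht)
  rw [intervalIntegral.integral_const_mul]
  gcongr
  exact intervalIntegral.integral_mono_interval ha.1 ht.1 ht.2 (Eventually.of_forall hm0)
    hm.intervalIntegrable

theorem exists_uniform_moment_bound (hv : RegularDynamics T v) (R : ℝ) :
    ∃ L, ∀ a ∈ Icc 0 T, ∀ μ (u : ℝ → U), SolvesCE a T (fun t => v t (μ t) (u t)) μ →
      μ a ∈ POn (Metric.closedBall (0 : E d) R) →
      ∀ t ∈ Icc a T, ∫ y, ‖y‖ ∂(μ t).toMeasure ≤ L := by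
  obtain ⟨m, hm, hm0, hgrowth⟩ := hv.exists_growth_rate
  obtain ⟨C, hC, hmoment⟩ := SolvesCE.exists_moment_bound (E d)
  refine ⟨√(1 + R ^ 2) * Real.exp (C * ∫ s in 0..T, m s), fun a ha μ u h hR t ht => ?_⟩
  obtain ⟨L, hL⟩ := isCompact_Icc.exists_bound_of_continuousOn
    (h.continuousOn_integral_of_lipschitzWith (lipschitzWith_one_norm (E := E d)))
  obtain ⟨S, hS⟩ := hv.exists_support_bound_of_moment_le R L
  refine (hmoment h hm hm0 (ae_restrict_of_ae_restrict_of_subset (Icc_subset_Icc_left ha.1)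
    (hgrowth.mono fun s hs x => hs _ _ _)) hR
    (hS a ha μ u h hR fun s hs => (le_abs_self _).trans (hL s hs)) t ht).trans ?_
  gcongr
  exact intervalIntegral.integral_mono_interval ha.1 ht.1 ht.2 (Eventually.of_forall hm0)
    hm.intervalIntegrable

theorem exists_uniform_support (hv : RegularDynamics T v) (R : ℝ) :
    ∃ S, R ≤ S ∧ ∀ a ∈ Icc 0 T, ∀ ρ ∈ POn (Metric.closedBall (0 : E d) R), ∀ μ (u : ℝ → U),
      IsTrajectory T v a ρ μ u → ∀ t ∈ Icc a T, μ t ∈ POn (Metric.closedBall (0 : E d) S) := by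
  obtain ⟨L, hL⟩ := hv.exists_uniform_moment_bound R
  obtain ⟨S, hS⟩ := hv.exists_support_bound_of_moment_le R L
  refine ⟨max R S, le_max_left _ _, fun a ha ρ hρ μ u h t ht => ?_⟩
  obtain ⟨hCE, rfl⟩ := h
  exact POn_mono (Metric.closedBall_subset_closedBall (le_max_right _ _))
    (hS a ha μ u hCE hρ (hL a ha μ u hCE hρ) t ht)

theorem value_le [MeasurableSpace U] (hv : RegularDynamics T v) (hφ : IsLipschitzOnBalls φ)
    (ha : a ∈ Icc 0 T) (hu : u ∈ controls U T) (h : IsTrajectory T v a ρ μ u) :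
    value T v φ a ρ ≤ φ (μ T) := by
  refine csInf_le ?_ ⟨u, hu, μ, h, rfl⟩
  obtain ⟨R, hR, hρ⟩ := ρ.exists_mem_POn_closedBall
  obtain ⟨S, hRS, hS⟩ := hv.exists_uniform_support R
  obtain ⟨L, hL0, hL⟩ := hφ.exists_nonneg (hR.trans_le hRS)
  refine ⟨φ (μ T) - L * (2 * S), ?_⟩
  rintro c ⟨u', -, μ', h', rfl⟩
  have hμ := hS a ha ρ hρ μ u h T ⟨ha.2, le_rfl⟩
  have hμ' := hS a ha ρ hρ μ' u' h' T ⟨ha.2, le_rfl⟩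
  linarith [(le_abs_self _).trans (hL _ hμ _ hμ'),
    mul_le_mul_of_nonneg_left (wass_one_le_of_mem_POn_closedBall hμ hμ') hL0]

end RegularDynamics

variable [TopologicalSpace.MetrizableSpace U] [SecondCountableTopology U] [MeasurableSpace U]
  [BorelSpace U]

section Truncation

variable {S : ℝ} {P : E d →ᵇ E d} {C : ℝ≥0} {m : ℝ → ℝ}

theorem IsTrajectory.exists_flow (h : IsTrajectory T v a ρ μ u) (hv : RegularDynamics T v)
    (hP : IsTruncation T v S P C m) (ha : a ∈ Icc 0 T) (hu : u ∈ controls U T)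
    (hμ : ∀ t ∈ Icc a T, μ t ∈ POn (Metric.closedBall (0 : E d) S)) :
    IsLipschitzField a T m (fun t x => v t (μ t) (u t) (P x)) ∧
    ∃ Y : ℝ → (E d →ᵇ E d), IsFlow a T (fun t x => v t (μ t) (u t) (P x)) Y ∧ Y a = P ∧
      ∀ t ∈ Icc a T, μ t = ρ.map (Y t) (Y t).continuous := by
  have hw := hP.isLipschitzField hv ha.2 (Icc_subset_Icc_left ha.1)
    (fun t ht => POn_mono hP.closedBall_subset (hμ t ht)) h.1.1 hu
  obtain ⟨Y, hY, hYa⟩ := hw.exists_isFlow ha.2 hP.integrable hP.nonneg P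
  refine ⟨hw, Y, hY, hYa, fun t ht => (h.1.congr_field ?_).eq_of_eq_left
    (hY.solvesCE hP.integrable hw ρ) hP.integrable hP.nonneg hw ?_ ht⟩
  · filter_upwards [ae_restrict_mem measurableSet_Icc] with t ht
    filter_upwards [mem_POn_closedBall_iff.1 (hμ t ht)] with x hx
    rw [hP.eq_self x hx]
  · have hρ := hμ a ⟨le_rfl, ha.2⟩
    rw [h.2] at hρ ⊢
    refine (Pc.map_eq_self ?_).symm
    filter_upwards [mem_POn_closedBall_iff.1 hρ] with x hx
    rw [hYa, hP.eq_self x hx]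

theorem IsTruncation.wass_le (hP : IsTruncation T v S P C m) (hv : RegularDynamics T v)
    (ha : a ∈ Icc 0 T) (hu : u ∈ controls U T) {ρ₁ ρ₂ : Pc (E d)} {μ₁ μ₂ : ℝ → Pc (E d)}
    (h₁ : IsTrajectory T v a ρ₁ μ₁ u) (h₂ : IsTrajectory T v a ρ₂ μ₂ u)
    (hμ₁ : ∀ t ∈ Icc a T, μ₁ t ∈ POn (Metric.closedBall (0 : E d) S))
    (hμ₂ : ∀ t ∈ Icc a T, μ₂ t ∈ POn (Metric.closedBall (0 : E d) S)) :
    wass 1 (μ₁ T) (μ₂ T) ≤ C * Real.exp (∫ s in 0..T, m s) *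
      Real.exp (Real.exp (∫ s in 0..T, m s) * ∫ s in 0..T, m s) * wass 1 ρ₁ ρ₂ := by
  obtain ⟨hw₁, Y₁, hY₁, hY₁a, hYμ₁⟩ := h₁.exists_flow hv hP ha hu hμ₁
  obtain ⟨hw₂, Y₂, hY₂, hY₂a, hYμ₂⟩ := h₂.exists_flow hv hP ha hu hμ₂
  rw [hYμ₁ T ⟨ha.2, le_rfl⟩, hYμ₂ T ⟨ha.2, le_rfl⟩]
  refine IsFlow.wass_map_le ha.2 hY₁ hY₂ hw₁ hw₂ hP.integrable hP.nonneg
    (intervalIntegral.integral_mono_interval ha.1 ha.2 le_rfl (Eventually.of_forall hP.nonneg)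
      hP.integrable.intervalIntegrable) (fun x y => ?_) ?_
  · rw [hY₁a, hY₂a]
    exact hP.lipschitzWith.dist_le_mul x y
  · filter_upwards [ae_restrict_of_ae_restrict_of_subset (Icc_subset_Icc_left ha.1)
      hP.norm_velocity_sub_le, ae_restrict_mem measurableSet_Icc] with t hlip ht x y
    rw [← hYμ₁ t ht, ← hYμ₂ t ht]
    exact hlip _ _ (POn_mono hP.closedBall_subset (hμ₁ t ht)) _
      (POn_mono hP.closedBall_subset (hμ₂ t ht)) x y

end Truncation

namespace RegularDynamics

theorem exists_lt_value_add (hv : RegularDynamics T v) (ha : a ∈ Icc 0 T) (ρ : Pc (E d))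
    (hU : (controls U T).Nonempty) {ε : ℝ} (hε : 0 < ε) :
    ∃ u ∈ controls U T, ∃ μ, IsTrajectory T v a ρ μ u ∧ φ (μ T) < value T v φ a ρ + ε := by
  obtain ⟨u₀, hu₀⟩ := hU
  obtain ⟨μ₀, hμ₀⟩ := hv.exists_isTrajectory ha ρ hu₀
  obtain ⟨c, ⟨u, hu, μ, hμ, rfl⟩, hc⟩ := Real.lt_sInf_add_pos
    (s := {c | ∃ u ∈ controls U T, ∃ μ, IsTrajectory T v a ρ μ u ∧ c = φ (μ T)})
    ⟨_, u₀, hu₀, μ₀, hμ₀, rfl⟩ hε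
  exact ⟨u, hu, μ, hμ, hc⟩

theorem value_terminal (hv : RegularDynamics T v) (hT : 0 ≤ T) (φ : Pc (E d) → ℝ) (ρ : Pc (E d))
    (hU : (controls U T).Nonempty) : value T v φ T ρ = φ ρ := by
  obtain ⟨u, hu⟩ := hU
  obtain ⟨μ, hμ⟩ := hv.exists_isTrajectory ⟨hT, le_rfl⟩ ρ hu
  have hcosts : {c | ∃ u ∈ controls U T, ∃ μ, IsTrajectory T v T ρ μ u ∧ c = φ (μ T)} = {φ ρ} := by
    refine Subset.antisymm ?_ (singleton_subset_iff.2 ⟨u, hu, μ, hμ, by rw [hμ.2]⟩)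
    rintro c ⟨u', -, μ', h', rfl⟩
    rw [h'.2, mem_singleton_iff]
  rw [value, hcosts, csInf_singleton]

theorem exists_value_lipschitz (hv : RegularDynamics T v) (hφ : IsLipschitzOnBalls φ)
    (hU : (controls U T).Nonempty) {R : ℝ} (hR : 0 < R) :
    ∃ K, 0 ≤ K ∧ ∀ a ∈ Icc 0 T, ∀ ρ₁ ∈ POn (Metric.closedBall (0 : E d) R),
      ∀ ρ₂ ∈ POn (Metric.closedBall (0 : E d) R),
        value T v φ a ρ₂ ≤ value T v φ a ρ₁ + K * wass 1 ρ₁ ρ₂ := by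
  obtain ⟨S, hRS, hS⟩ := hv.exists_uniform_support R
  have hS0 := hR.trans_le hRS
  obtain ⟨L, hL0, hL⟩ := hφ.exists_nonneg hS0
  obtain ⟨P, C, m, hP⟩ := hv.exists_isTruncation hS0
  refine ⟨L * (C * Real.exp (∫ s in 0..T, m s) *
      Real.exp (Real.exp (∫ s in 0..T, m s) * ∫ s in 0..T, m s)), by positivity,
      fun a ha ρ₁ hρ₁ ρ₂ hρ₂ => le_of_forall_pos_le_add fun ε hε => ?_⟩
  obtain ⟨u, hu, μ₁, h₁, hlt⟩ := hv.exists_lt_value_add ha ρ₁ hU hε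
  obtain ⟨μ₂, h₂⟩ := hv.exists_isTrajectory ha ρ₂ hu
  have hμ₁ := hS a ha ρ₁ hρ₁ μ₁ u h₁
  have hμ₂ := hS a ha ρ₂ hρ₂ μ₂ u h₂
  have hvalue := hv.value_le hφ ha hu h₂
  have hcost := hL _ (hμ₁ T ⟨ha.2, le_rfl⟩) _ (hμ₂ T ⟨ha.2, le_rfl⟩)
  have hwass := mul_le_mul_of_nonneg_left (hP.wass_le hv ha hu h₁ h₂ hμ₁ hμ₂) hL0
  rw [← mul_assoc] at hwass
  linarith [(neg_le_abs _).trans hcost]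

theorem exists_wass_rate (hv : RegularDynamics T v) {S : ℝ} (hS : 0 < S) :
    ∃ m : ℝ → ℝ, Integrable m ∧ ∀ a ∈ Icc 0 T, ∀ ρ (μ μ' : ℝ → Pc (E d)),
      ∀ u ∈ controls U T, ∀ u' ∈ controls U T,
      IsTrajectory T v a ρ μ u → IsTrajectory T v a ρ μ' u' →
      (∀ t ∈ Icc a T, μ t ∈ POn (Metric.closedBall (0 : E d) S)) →
      (∀ t ∈ Icc a T, μ' t ∈ POn (Metric.closedBall (0 : E d) S)) →
      ∀ t ∈ Icc a T, wass 1 (μ t) (μ' t) ≤ ∫ s in a..t, m s := by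
  obtain ⟨P, C, m, hP⟩ := hv.exists_isTruncation hS
  refine ⟨fun t => 2 * m t, hP.integrable.const_mul 2,
    fun a ha ρ μ μ' u hu u' hu' h h' hμ hμ' t ht => ?_⟩
  obtain ⟨hw, Y, hY, hYa, hYμ⟩ := h.exists_flow hv hP ha hu hμ
  obtain ⟨hw', Y', hY', hYa', hYμ'⟩ := h'.exists_flow hv hP ha hu' hμ'
  rw [hYμ t ht, hYμ' t ht, intervalIntegral.integral_const_mul]
  refine (wass_one_map_le ρ _ _).trans ((integral_mono (ρ.integrable_of_continuous (by fun_prop))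
    (integrable_const (2 * ∫ s in a..t, m s)) fun x => ?_).trans (by simp))
  have hx := hY.norm_sub_le hP.integrable hw x le_rfl ht.1 ht.2
  have hx' := hY'.norm_sub_le hP.integrable hw' x le_rfl ht.1 ht.2
  rw [hYa, ← dist_eq_norm] at hx
  rw [hYa', ← dist_eq_norm] at hx'
  linarith [dist_triangle_right (Y t x) (Y' t x) (P x)]

/-- Switching to a nearly optimal control at time `s` shows that the value can only increase through
the gap between the two trajectories that leave `μ s`. -/
theorem exists_value_rate (hv : RegularDynamics T v) (hφ : IsLipschitzOnBalls φ)
    (hu : u ∈ controls U T) (hT : 0 ≤ T) (h : IsTrajectory T v 0 ρ μ u) :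
    ∃ m : ℝ → ℝ, Integrable m ∧ ∀ s t, 0 ≤ s → s ≤ t → t ≤ T →
      value T v φ t (μ t) - value T v φ s (μ s) ≤ ∫ r in s..t, m r := by
  obtain ⟨R₀, hR₀, hρ⟩ := ρ.exists_mem_POn_closedBall
  obtain ⟨R, hR, hμR⟩ := hv.exists_uniform_support R₀
  obtain ⟨S, hRS, hS⟩ := hv.exists_uniform_support R
  have hS0 := (hR₀.trans_le hR).trans_le hRS
  obtain ⟨m, hm, hwass⟩ := hv.exists_wass_rate hS0
  obtain ⟨K, hK, hV⟩ := hv.exists_value_lipschitz hφ ⟨u, hu⟩ hS0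
  have hμ : ∀ t ∈ Icc 0 T, μ t ∈ POn (Metric.closedBall (0 : E d) R) :=
    hμR 0 ⟨le_rfl, hT⟩ ρ hρ μ u h
  refine ⟨fun t => K * m t, hm.const_mul K,
    fun s t hs hst ht => le_of_forall_pos_le_add fun ε hε => ?_⟩
  have hsT : s ∈ Icc 0 T := ⟨hs, hst.trans ht⟩
  have hμS : ∀ r ∈ Icc s T, μ r ∈ POn (Metric.closedBall (0 : E d) S) := fun r hr =>
    POn_mono (Metric.closedBall_subset_closedBall hRS) (hμ r ⟨hs.trans hr.1, hr.2⟩)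
  obtain ⟨u', hu', μ', h', hlt⟩ := hv.exists_lt_value_add hsT (μ s) ⟨u, hu⟩ hε
  have hμ'S := hS s hsT _ (hμ s hsT) μ' u' h'
  have hvalue := hv.value_le hφ ⟨hs.trans hst, ht⟩ hu' (h'.mono hst)
  have hlip := hV t ⟨hs.trans hst, ht⟩ _ (hμ'S t ⟨hst, ht⟩) _ (hμS t ⟨hst, ht⟩)
  have hgap := mul_le_mul_of_nonneg_left (hwass s hsT (μ s) μ' μ u' hu' u hu h' (h.mono hs) hμ'S hμS
    t ⟨hst, ht⟩) hK
  rw [intervalIntegral.integral_const_mul]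
  linarith

end RegularDynamics

end Value

section FlowDerivative

theorem eventually_add_mem_Ioo {b t : ℝ} (ht : t < b) : ∀ᶠ ε in 𝓝[>] (0 : ℝ), t + ε ∈ Ioo t b := by
  filter_upwards [self_mem_nhdsWithin, nhdsWithin_le_nhds (Iio_mem_nhds (sub_pos.2 ht))]
    with ε hε hεb
  exact ⟨lt_add_of_pos_right t hε, lt_sub_iff_add_lt'.1 hεb⟩

theorem ae_tendsto_inv_mul_integral {m : ℝ → ℝ} (hm : Integrable m) {a b : ℝ} (hab : a ≤ b) :
    ∀ᵐ t ∂volume.restrict (Icc a b),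
      Tendsto (fun ε => ε⁻¹ * ∫ r in t..t + ε, m r) (𝓝[>] 0) (𝓝 (m t)) := by
  filter_upwards [ae_hasDerivAt_primitive hab hm.integrableOn] with t ht
  simpa only [integral_primitive_sub hm, smul_eq_mul] using ht.tendsto_slope_zero_right

namespace IsFlow

variable {X : Type*} [NormedAddCommGroup X] [NormedSpace ℝ X] [FiniteDimensional ℝ X]
  {a b : ℝ} {m : ℝ → ℝ} {w : ℝ → X → X} {Y : ℝ → (X →ᵇ X)}

theorem norm_apply_sub_le (hY : IsFlow a b w Y) (hm : Integrable m) (hm0 : ∀ t, 0 ≤ m t)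
    (hw : IsLipschitzField a b m w) {t : ℝ} (ht : t ∈ Icc a b) (x y : X) :
    ‖Y t x - Y t y‖ ≤ ‖Y a x - Y a y‖ * Real.exp (∫ s in a..b, m s) := by
  have hle := hY.norm_sub_le_mul_exp hY hw hw hm hm0 (g := fun _ => 0) continuous_const
    (fun _ => le_rfl) (by simpa using hw.norm_sub_le) ht x y
  simp only [mul_zero, intervalIntegral.integral_zero, add_zero] at hle
  refine hle.trans ?_
  gcongr
  exact primitive_mono hm hm0 ht.2

theorem norm_increment_sub_le (hY : IsFlow a b w Y) (hm : Integrable m) (hm0 : ∀ t, 0 ≤ m t)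
    (hw : IsLipschitzField a b m w) {s t : ℝ} (hs : a ≤ s) (hst : s ≤ t) (ht : t ≤ b) (x y : X) :
    ‖(Y t x - Y s x) - (Y t y - Y s y)‖ ≤
      ‖Y a x - Y a y‖ * Real.exp (∫ r in a..b, m r) * ∫ r in s..t, m r := by
  have hsI : s ∈ Icc a b := ⟨hs, hst.trans ht⟩
  have htI : t ∈ Icc a b := ⟨hs.trans hst, ht⟩
  rw [hY.sub_eq_integral hm hw x hsI htI, hY.sub_eq_integral hm hw y hsI htI,
    ← intervalIntegral.integral_sub
      (intervalIntegrable_of_integrableOn_Icc (hY.integrableOn hm hw x) hsI htI)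
      (intervalIntegrable_of_integrableOn_Icc (hY.integrableOn hm hw y) hsI htI),
    ← intervalIntegral.integral_const_mul]
  refine norm_intervalIntegral_le_of_ae_le hs hst ht ?_ (hm.integrableOn.const_mul _)
  filter_upwards [hw.norm_sub_le, ae_restrict_mem measurableSet_Icc] with r hr hmem
  refine (hr _ _).trans ?_
  rw [mul_comm]
  exact mul_le_mul_of_nonneg_right (hY.norm_apply_sub_le hm hm0 hw hmem x y) (hm0 r)

theorem norm_slope_sub_le (hY : IsFlow a b w Y) (hm : Integrable m) (hm0 : ∀ t, 0 ≤ m t)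
    (hw : IsLipschitzField a b m w) {t ε : ℝ} (ht : a ≤ t) (hε : 0 < ε) (htε : t + ε ≤ b)
    (hwt : ∀ x y, ‖w t x - w t y‖ ≤ m t * ‖x - y‖) (x y : X) :
    ‖ε⁻¹ • (Y (t + ε) x - Y t x) - w t (Y t x)‖ ≤
      ‖ε⁻¹ • (Y (t + ε) y - Y t y) - w t (Y t y)‖ + ‖Y a x - Y a y‖ *
        Real.exp (∫ r in a..b, m r) * (ε⁻¹ * (∫ r in t..t + ε, m r) + m t) := by
  set L := ‖Y a x - Y a y‖ * Real.exp (∫ r in a..b, m r)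
  have hslope : ‖ε⁻¹ • ((Y (t + ε) x - Y t x) - (Y (t + ε) y - Y t y))‖ ≤
      L * (ε⁻¹ * ∫ r in t..t + ε, m r) := by
    rw [norm_smul, norm_inv, Real.norm_of_nonneg hε.le, mul_left_comm]
    have hincr := hY.norm_increment_sub_le hm hm0 hw ht (by linarith) htε x y
    gcongr
  have hvelocity : ‖w t (Y t x) - w t (Y t y)‖ ≤ L * m t := by
    refine (hwt _ _).trans ?_
    rw [mul_comm]
    exact mul_le_mul_of_nonneg_right (hY.norm_apply_sub_le hm hm0 hw ⟨ht, by linarith⟩ x y) (hm0 t)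
  have hsplit : ε⁻¹ • (Y (t + ε) x - Y t x) - w t (Y t x) =
      (ε⁻¹ • (Y (t + ε) y - Y t y) - w t (Y t y)) +
      (ε⁻¹ • ((Y (t + ε) x - Y t x) - (Y (t + ε) y - Y t y)) -
        (w t (Y t x) - w t (Y t y))) := by
    rw [smul_sub ε⁻¹ (Y (t + ε) x - Y t x)]
    abel
  rw [hsplit, mul_add]
  exact (norm_add_le _ _).trans (add_le_add le_rfl
    ((_root_.norm_sub_le _ _).trans (add_le_add hslope hvelocity)))

/-- The exceptional null set can be chosen independently of `x`: the difference quotients at `t` are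
equi-Lipschitz, so that convergence on a countable dense set is enough. -/
theorem ae_forall_tendsto_slope (hY : IsFlow a b w Y) (hab : a ≤ b) (hm : Integrable m)
    (hm0 : ∀ t, 0 ≤ m t) (hw : IsLipschitzField a b m w) :
    ∀ᵐ t ∂volume.restrict (Icc a b), ∀ x,
      Tendsto (fun ε => ‖ε⁻¹ • (Y (t + ε) x - Y t x) - w t (Y t x)‖) (𝓝[>] 0) (𝓝 0) := by
  have : Nonempty X := ⟨0⟩
  have hdense := ae_all_iff.2 fun n => hY.ae_hasDerivAt hab hm hw (TopologicalSpace.denseSeq X n)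
  have hrate := ae_tendsto_inv_mul_integral hm hab
  have hlip := hw.norm_sub_le
  rw [← restrict_Ioo_eq_restrict_Icc] at hdense hrate hlip ⊢
  filter_upwards [hdense, hrate, hlip, ae_restrict_mem measurableSet_Ioo]
    with t hdense hrate hlip ht x
  rw [Metric.tendsto_nhds]
  intro η hη
  set L : X → ℝ := fun y => ‖Y a x - Y a y‖ * Real.exp (∫ r in a..b, m r) * (m t + 1 + m t)
  have hL : Continuous L := by
    have := (Y a).continuous
    fun_prop
  obtain ⟨n, hn⟩ := (TopologicalSpace.denseRange_denseSeq X).exists_mem_open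
    (isOpen_lt hL continuous_const) ⟨x, (by simpa [L] using hη : L x < η / 2)⟩
  have hslope := tendsto_iff_norm_sub_tendsto_zero.1 (hdense n).tendsto_slope_zero_right
  filter_upwards [self_mem_nhdsWithin, hrate.eventually_lt_const (lt_add_one (m t)),
    hslope.eventually_lt_const (half_pos hη), eventually_add_mem_Ioo ht.2]
    with ε hε hrateε hslopeε htε
  have hle := hY.norm_slope_sub_le hm hm0 hw ht.1.le hε htε.2.le hlip x
    (TopologicalSpace.denseSeq X n)
  have hLn : L (TopologicalSpace.denseSeq X n) < η / 2 := hn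
  have hLε : ‖Y a x - Y a (TopologicalSpace.denseSeq X n)‖ * Real.exp (∫ r in a..b, m r) *
      (ε⁻¹ * (∫ r in t..t + ε, m r) + m t) ≤ L (TopologicalSpace.denseSeq X n) := by
    simp only [L]
    gcongr
  rw [dist_zero_right, norm_norm]
  linarith

variable [MeasurableSpace X] [BorelSpace X]

theorem ae_tendsto_integral_slope (hY : IsFlow a b w Y) (hab : a ≤ b) (hm : Integrable m)
    (hm0 : ∀ t, 0 ≤ m t) (hw : IsLipschitzField a b m w) (ρ : Measure X) [IsFiniteMeasure ρ] :
    ∀ᵐ t ∂volume.restrict (Icc a b), Tendsto (fun ε =>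
      ∫ x, ‖ε⁻¹ • (Y (t + ε) x - Y t x) - w t (Y t x)‖ ∂ρ) (𝓝[>] 0) (𝓝 0) := by
  have hslope := hY.ae_forall_tendsto_slope hab hm hm0 hw
  have hrate := ae_tendsto_inv_mul_integral hm hab
  have hbound := hw.norm_le
  have hcont := hw.ae_continuous
  rw [← restrict_Ioo_eq_restrict_Icc] at hslope hrate hbound hcont ⊢
  filter_upwards [hslope, hrate, hbound, hcont, ae_restrict_mem measurableSet_Ioo]
    with t hslope hrate hbound hcont ht
  rw [show (𝓝 (0 : ℝ)) = 𝓝 (∫ _ : X, 0 ∂ρ) by rw [integral_zero]]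
  refine tendsto_integral_filter_of_dominated_convergence (fun _ => m t + 1 + m t)
    (Eventually.of_forall fun ε => Continuous.aestronglyMeasurable ?_) ?_ (integrable_const _)
    (Eventually.of_forall hslope)
  · have := (Y t).continuous
    have := (Y (t + ε)).continuous
    fun_prop
  · filter_upwards [self_mem_nhdsWithin, hrate.eventually_lt_const (lt_add_one (m t)),
      eventually_add_mem_Ioo ht.2] with ε hε hrateε htε
    refine Eventually.of_forall fun x => ?_
    rw [norm_norm]
    refine (_root_.norm_sub_le _ _).trans (add_le_add (le_trans ?_ hrateε.le) (hbound _))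
    rw [norm_smul, norm_inv, Real.norm_of_nonneg (le_of_lt hε)]
    have hincr := hY.norm_sub_le hm hw x ht.1.le htε.1.le htε.2.le
    have hε0 : 0 ≤ ε := le_of_lt hε
    gcongr

end IsFlow

end FlowDerivative

section Barycenter

variable {d : ℕ} {ν : Pc (E d × E d)}

theorem integral_inner_barycenter {g : E d → E d} (hg : Continuous g) :
    ∫ x, ⟪barycenter ν x, g x⟫_ℝ ∂ν.fst.toMeasure = ∫ z, ⟪z.2, g z.1⟫_ℝ ∂ν.toMeasure := by
  have hsnd : Integrable (fun z : E d × E d => z.2) ν.toMeasure :=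
    ν.integrable_of_continuous continuous_snd
  have hinner : Integrable (fun z : E d × E d => ⟪z.2, g z.1⟫_ℝ) ν.toMeasure :=
    ν.integrable_of_continuous (by fun_prop)
  rw [← Measure.integral_condKernel hinner]
  refine integral_congr_ae ?_
  filter_upwards [hsnd.condKernel_ae] with x hx
  simp only [barycenter, real_inner_comm (g x), integral_inner hx]

theorem integral_inner_neg_barycenter_add_hamiltonian {U : Type*}
    {v : ℝ → Pc (E d) → U → E d → E d} {t : ℝ} {u : U} (hcont : Continuous (v t ν.fst u)) :
    ∫ x, ⟪-barycenter ν x, v t ν.fst u x⟫_ℝ ∂ν.fst.toMeasure + hamiltonian v t ν u = 0 := by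
  simp only [inner_neg_left, integral_neg, integral_inner_barycenter hcont, hamiltonian,
    neg_add_cancel]

end Barycenter

section Perturbation

variable {d : ℕ} {μ : Pc (E d)}

theorem upperDini_eventually_le {V : ℝ → Pc (E d) → ℝ} {t : ℝ} {F : Lp (E d) ⊤ μ.toMeasure}
    (h : upperDini V t μ 1 F ≤ 0) {η : ℝ} (hη : 0 < η) :
    ∀ᶠ ε in 𝓝[>] (0 : ℝ), V (t + ε) (μ.perturb F ε) - V t μ ≤ η * ε := by
  have hlt : upperDini V t μ 1 F < (η : EReal) := h.trans_lt (by exact_mod_cast hη)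
  filter_upwards [eventually_lt_of_limsup_lt hlt, self_mem_nhdsWithin] with ε hε hε0
  rw [EReal.coe_lt_coe_iff, mul_one, div_lt_iff₀ hε0] at hε
  exact hε.le

theorem Pc.exists_perturb_mem_POn_closedBall (μ : Pc (E d)) (F : Lp (E d) ⊤ μ.toMeasure) :
    ∃ R > 0, ∀ ε ∈ Icc (0 : ℝ) 1, μ.perturb F ε ∈ POn (Metric.closedBall (0 : E d) R) := by
  obtain ⟨S, hS0, hS⟩ := μ.exists_mem_POn_closedBall
  set M := lpNorm F ⊤ μ.toMeasure
  have hM : 0 ≤ M := lpNorm_nonneg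
  refine ⟨S + M, by positivity, fun ε hε => mem_POn_closedBall_iff.2 ?_⟩
  have hmeas : AEMeasurable (fun x => x + ε • F x) μ.toMeasure :=
    aemeasurable_id.add ((Lp.aestronglyMeasurable F).aemeasurable.const_smul ε)
  refine (ae_map_iff hmeas (measurableSet_le measurable_norm measurable_const)).2 ?_
  filter_upwards [mem_POn_closedBall_iff.1 hS, ae_le_lpNorm_exponent_top (Lp.memLp F)] with x hx hFx
  calc ‖x + ε • F x‖ ≤ ‖x‖ + ‖ε • F x‖ := norm_add_le _ _
    _ = ‖x‖ + ε * ‖F x‖ := by rw [norm_smul, Real.norm_of_nonneg hε.1]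
    _ ≤ S + 1 * M := by gcongr; exact hε.2
    _ = S + M := by rw [one_mul]

theorem Pc.perturb_toMeasure_eq_map {F : Lp (E d) ⊤ μ.toMeasure} {w : E d → E d}
    (hF : F =ᵐ[μ.toMeasure] w) (ε : ℝ) :
    (μ.perturb F ε).toMeasure = μ.toMeasure.map fun x => x + ε • w x :=
  Measure.map_congr (hF.mono fun x hx => by simp only [hx])

theorem wass_one_perturb_map_le {ρ : Pc (E d)} {Y Z w : E d → E d} (hY : Continuous Y)
    (hZ : Continuous Z) (hw : Continuous w) (hμ : μ = ρ.map Y hY) {F : Lp (E d) ⊤ μ.toMeasure}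
    (hF : F =ᵐ[μ.toMeasure] w) {ε : ℝ} (hε : 0 < ε) :
    wass 1 (μ.perturb F ε) (ρ.map Z hZ) ≤
      ε * ∫ x, ‖ε⁻¹ • (Z x - Y x) - w (Y x)‖ ∂ρ.toMeasure := by
  subst hμ
  have hstep : Continuous fun x => Y x + ε • w (Y x) := by fun_prop
  have hlaw : ρ.toMeasure.map (fun x => Y x + ε • w (Y x)) =
      ((ρ.map Y hY).perturb F ε).toMeasure := by
    rw [Pc.perturb_toMeasure_eq_map hF]
    exact (Measure.map_map (g := fun x => x + ε • w x) (by fun_prop) hY.measurable).symm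
  have hdist (x : E d) :
      dist (Y x + ε • w (Y x)) (Z x) = ε * ‖ε⁻¹ • (Z x - Y x) - w (Y x)‖ := by
    rw [dist_comm, dist_eq_norm, ← Real.norm_of_nonneg hε.le, ← norm_smul,
      Real.norm_of_nonneg hε.le, smul_sub, smul_inv_smul₀ hε.ne', sub_sub]
  rw [← integral_const_mul]
  simp only [← hdist]
  exact wass_one_le_integral_dist hstep.aemeasurable hZ.aemeasurable hlaw rfl
    (ρ.integrable_of_continuous (hstep.dist hZ))

end Perturbation

section Verification

variable {d : ℕ} {U : Type*} [TopologicalSpace U] {T : ℝ} {v : ℝ → Pc (E d) → U → E d → E d}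

theorem RegularDynamics.ae_continuous_velocity (hv : RegularDynamics T v) :
    ∀ᵐ t ∂volume.restrict (Icc 0 T), ∀ u μ, Continuous (v t μ u) := by
  choose l _ _ hlip using fun n : ℕ => hv.exists_lipschitz_rate (R := n + 1) (by positivity)
  filter_upwards [ae_all_iff.2 hlip] with t hlip u μ
  refine continuous_iff_continuousAt.2 fun x => ?_
  obtain ⟨R, -, hμ⟩ := μ.exists_mem_POn_closedBall
  obtain ⟨n, hn⟩ := exists_nat_ge (max R ‖x‖)
  have hμn : μ ∈ POn (Metric.closedBall (0 : E d) (n + 1)) :=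
    POn_mono (Metric.closedBall_subset_closedBall
      (((le_max_left _ _).trans hn).trans (lt_add_one _).le)) hμ
  have hlipOn : LipschitzOnWith (l n t).toNNReal (v t μ u)
      (Metric.closedBall (0 : E d) (n + 1)) :=
    LipschitzOnWith.of_dist_le' fun y hy z hz => by
      simpa only [dist_eq_norm, wass_one_self, add_zero] using hlip n u μ hμn μ hμn y hy z hz
  refine hlipOn.continuousOn.continuousAt (Metric.closedBall_mem_nhds_of_mem ?_)
  rw [mem_ball_zero_iff]
  exact ((le_max_right _ _).trans hn).trans_lt (lt_add_one _)

variable [TopologicalSpace.MetrizableSpace U] [SecondCountableTopology U] [MeasurableSpace U]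
  [BorelSpace U] {φ : Pc (E d) → ℝ} {ρ : Pc (E d)} {μ : ℝ → Pc (E d)} {u : ℝ → U}

theorem RegularDynamics.ae_exists_tendsto_wass_perturb (hv : RegularDynamics T v) (hT : 0 ≤ T)
    (hu : u ∈ controls U T) (h : IsTrajectory T v 0 ρ μ u) :
    ∀ᵐ t ∂volume.restrict (Icc 0 T), ∃ F : Lp (E d) ⊤ (μ t).toMeasure,
      F =ᵐ[(μ t).toMeasure] v t (μ t) (u t) ∧
      Tendsto (fun ε => ε⁻¹ * wass 1 ((μ t).perturb F ε) (μ (t + ε))) (𝓝[>] 0) (𝓝 0) := by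
  obtain ⟨R, hR, hρ⟩ := ρ.exists_mem_POn_closedBall
  obtain ⟨S, hRS, hS⟩ := hv.exists_uniform_support R
  obtain ⟨P, C, m, hP⟩ := hv.exists_isTruncation (hR.trans_le hRS)
  have h0 : (0 : ℝ) ∈ Icc 0 T := ⟨le_rfl, hT⟩
  have hμ := hS 0 h0 ρ hρ μ u h
  obtain ⟨hw, Y, hY, -, hYμ⟩ := h.exists_flow hv hP h0 hu hμ
  have hslope := hY.ae_tendsto_integral_slope hT hP.integrable hP.nonneg hw ρ.toMeasure
  have hbound := hw.norm_le
  have hcont := hw.ae_continuous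
  rw [← restrict_Ioo_eq_restrict_Icc] at hslope hbound hcont ⊢
  filter_upwards [hslope, hbound, hcont, ae_restrict_mem measurableSet_Ioo]
    with t hslope hbound hcont ht
  have htI : t ∈ Icc 0 T := Ioo_subset_Icc_self ht
  have hLp : MemLp (fun x => v t (μ t) (u t) (P x)) ⊤ (μ t).toMeasure :=
    memLp_top_of_bound hcont.aestronglyMeasurable (m t) (Eventually.of_forall hbound)
  refine ⟨hLp.toLp _, ?_, squeeze_zero' ?_ ?_ hslope⟩
  · filter_upwards [hLp.coeFn_toLp, mem_POn_closedBall_iff.1 (hμ t htI)] with x hx hxS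
    rw [hx, hP.eq_self x hxS]
  · filter_upwards [self_mem_nhdsWithin] with ε hε
    exact mul_nonneg (inv_nonneg.2 (le_of_lt hε)) (wass_nonneg _ _ _)
  · filter_upwards [self_mem_nhdsWithin, eventually_add_mem_Ioo ht.2] with ε hε htε
    rw [hYμ (t + ε) ⟨ht.1.le.trans htε.1.le, htε.2.le⟩, inv_mul_le_iff₀ hε]
    exact wass_one_perturb_map_le (Y t).continuous (Y (t + ε)).continuous hcont (hYμ t htI)
      hLp.coeFn_toLp hε

variable {δ : ℝ → ℝ} {ξ : ℝ → E d → E d}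

theorem RegularDynamics.ae_value_le (hv : RegularDynamics T v) (hφ : IsLipschitzOnBalls φ)
    (hT : 0 ≤ T) (hu : u ∈ controls U T) (h : IsTrajectory T v 0 ρ μ u)
    (hsuper : ∀ᵐ t ∂volume.restrict (Icc 0 T),
      MemDiniSuperdifferential (value T v φ) t (μ t) (δ t) (ξ t))
    (hle : ∀ᵐ t ∂volume.restrict (Icc 0 T),
      ∫ x, ⟪ξ t x, v t (μ t) (u t) x⟫_ℝ ∂(μ t).toMeasure + δ t ≤ 0) :
    ∀ᵐ t ∂volume.restrict (Icc 0 T), ∀ η > 0, ∀ᶠ ε in 𝓝[>] (0 : ℝ),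
      value T v φ (t + ε) (μ (t + ε)) - value T v φ t (μ t) ≤ η * ε := by
  obtain ⟨R, hR, hρ⟩ := ρ.exists_mem_POn_closedBall
  obtain ⟨S, hRS, hS⟩ := hv.exists_uniform_support R
  have hμ := hS 0 ⟨le_rfl, hT⟩ ρ hρ μ u h
  have hdirection := hv.ae_exists_tendsto_wass_perturb hT hu h
  rw [← restrict_Ioo_eq_restrict_Icc] at hdirection hsuper hle ⊢
  filter_upwards [hdirection, hsuper, hle, ae_restrict_mem measurableSet_Ioo]
    with t ⟨F, hF, hwass⟩ hsuper hle ht η hη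
  have hdini : upperDini (value T v φ) t (μ t) 1 F ≤ 0 := by
    refine (hsuper.2 1 F).trans ?_
    rw [integral_congr_ae (g := fun x => ⟪ξ t x, v t (μ t) (u t) x⟫_ℝ)
      (hF.mono fun x hx => by simp only [hx]), mul_one]
    exact_mod_cast hle
  obtain ⟨R', hR', hF_mem⟩ := (μ t).exists_perturb_mem_POn_closedBall F
  obtain ⟨K, -, hV⟩ := hv.exists_value_lipschitz hφ ⟨u, hu⟩ (lt_max_of_lt_right hR' : 0 < max S R')
  have hwass_lt := (hwass.const_mul K).eventually_lt_const
    (show K * 0 < η / 2 by simpa using half_pos hη)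
  filter_upwards [upperDini_eventually_le hdini (half_pos hη), hwass_lt,
    self_mem_nhdsWithin, eventually_add_mem_Ioo ht.2,
    nhdsWithin_le_nhds (Iio_mem_nhds zero_lt_one)] with ε hdiniε hwassε hε htε hε1
  have htεI : t + ε ∈ Icc 0 T := ⟨ht.1.le.trans htε.1.le, htε.2.le⟩
  have hVε := hV (t + ε) htεI _
    (POn_mono (Metric.closedBall_subset_closedBall (le_max_right _ _))
      (hF_mem ε ⟨le_of_lt hε, le_of_lt hε1⟩)) _
    (POn_mono (Metric.closedBall_subset_closedBall (le_max_left _ _)) (hμ _ htεI))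
  have hwass_le : K * wass 1 ((μ t).perturb F ε) (μ (t + ε)) ≤ η / 2 * ε := by
    rw [← mul_assoc, mul_comm K, mul_assoc, inv_mul_lt_iff₀ hε] at hwassε
    linarith
  linarith

theorem RegularDynamics.isOptimal_of_memDiniSuperdifferential (hv : RegularDynamics T v)
    (hφ : IsLipschitzOnBalls φ) (hT : 0 ≤ T) (hadm : IsAdmissible T v ρ μ u)
    (hsuper : ∀ᵐ t ∂volume.restrict (Icc 0 T),
      MemDiniSuperdifferential (value T v φ) t (μ t) (δ t) (ξ t))
    (hle : ∀ᵐ t ∂volume.restrict (Icc 0 T),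
      ∫ x, ⟪ξ t x, v t (μ t) (u t) x⟫_ℝ ∂(μ t).toMeasure + δ t ≤ 0) :
    IsOptimal T v φ ρ μ u := by
  obtain ⟨hu, h⟩ := hadm
  refine ⟨⟨hu, h⟩, fun μ' u' ⟨hu', h'⟩ => ?_⟩
  obtain ⟨m, hm, hrate⟩ := hv.exists_value_rate hφ hu hT h
  calc φ (μ T) = value T v φ T (μ T) := (hv.value_terminal hT φ (μ T) ⟨u, hu⟩).symm
    _ ≤ value T v φ 0 (μ 0) :=
      le_of_ae_right_derivative_nonpos (f := fun t => value T v φ t (μ t)) hm hT hrate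
        (hv.ae_value_le hφ hT hu h hsuper hle)
    _ = value T v φ 0 ρ := by rw [h.2]
    _ ≤ φ (μ' T) := hv.value_le hφ ⟨le_rfl, hT⟩ hu' h'

end Verification

end MeanField

theorem mainTheorem9_general {d : ℕ} {U : Type*} [TopologicalSpace U]
    [TopologicalSpace.MetrizableSpace U] [SecondCountableTopology U] [MeasurableSpace U]
    [BorelSpace U] {T : ℝ} (hT : 0 ≤ T)
    {v : ℝ → MeanField.Pc (MeanField.E d) → U → MeanField.E d → MeanField.E d}
    {φ : MeanField.Pc (MeanField.E d) → ℝ} (hv : MeanField.RegularDynamics T v)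
    (hφ : MeanField.IsLipschitzOnBalls φ) {μ₀ : MeanField.Pc (MeanField.E d)}
    {μ : ℝ → MeanField.Pc (MeanField.E d)} {u : ℝ → U}
    (hadm : MeanField.IsAdmissible T v μ₀ μ u)
    {ν : ℝ → MeanField.Pc (MeanField.E d × MeanField.E d)}
    (hν : ∀ t ∈ Icc 0 T, (ν t).fst = μ t)
    (hsens : ∀ᵐ t ∂volume.restrict (Icc 0 T),
      MeanField.MemDiniSuperdifferential (MeanField.value T v φ) t (μ t)
        (MeanField.hamiltonian v t (ν t) (u t)) (fun x => -MeanField.barycenter (ν t) x)) :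
    MeanField.IsOptimal T v φ μ₀ μ u := by
  refine hv.isOptimal_of_memDiniSuperdifferential hφ hT hadm hsens ?_
  filter_upwards [hv.ae_continuous_velocity, ae_restrict_mem measurableSet_Icc] with t hcont ht
  rw [← hν t ht]
  exact (MeanField.integral_inner_neg_barycenter_add_hamiltonian (hcont _ _)).le

theorem mainTheorem9 {d : ℕ} {U : Type*} [MetricSpace U] [CompactSpace U] [MeasurableSpace U]
    [BorelSpace U] (T : ℝ) (hT : 0 < T)
    (v : ℝ → MeanField.Pc (MeanField.E d) → U → MeanField.E d → MeanField.E d)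
    (φ : MeanField.Pc (MeanField.E d) → ℝ) (hyp : MeanField.Hypotheses T v φ)
    (μ₀ : MeanField.Pc (MeanField.E d))
    (μ : ℝ → MeanField.Pc (MeanField.E d)) (u : ℝ → U)
    (hadm : MeanField.IsAdmissible T v μ₀ μ u)
    (ν : ℝ → MeanField.Pc (MeanField.E d × MeanField.E d))
    (hPMP : MeanField.SatisfiesPMP T v φ μ u ν)
    (hsens : ∀ᵐ t ∂volume.restrict (Icc 0 T),
      MeanField.MemDiniSuperdifferential (MeanField.value T v φ) t (μ t)
        (MeanField.hamiltonian v t (ν t) (u t)) (fun x => -MeanField.barycenter (ν t) x)) :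
    MeanField.IsOptimal T v φ μ₀ μ u :=
  mainTheorem9_general hT.le hyp.regularDynamics hyp.cost_lipschitz hadm hPMP.marginal hsens
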